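/- Let $\eta\ge 0$, $\eta\neq 1$, $T>0$, and let $\ell:[0,\infty)\to(0,\infty)$ be differentiable with $|\ell'(t)|<1$ for all $t\ge 0$; put $L=\ell(0)$. Let $\varphi\in C^1([-L,\infty))$ be real-valued with $\varphi'>0$ on $[-L,\infty)$ and $$\varphi(t+\ell(t))-\varphi(t-\ell(t))=2\qquad (t\ge 0).$$ Put $V_0(0,l)=\{w\in H^1(0,l): w(0)=0\}$ and let $u^0\in V_0(0,L)$, $u^1\in L^2(0,L)$ be real-valued. Consider the problem $$\text{(WP)}\quad\begin{cases}u_{tt}-u_{xx}=0, & 0<x<\ell(t),\ 0<t<T,\\ (1+\eta\ell'(t))\,u_x(\ell(t),t)+(\eta+\ell'(t))\,u_t(\ell(t),t)=0, & 0<t<T,\\ u(0,t)=0, & 0<t<T,\\ u(x,0)=u^0(x),\quad u_t(x,0)=u^1(x), & 0<x<L.\end{cases}$$ Here a solution is a function $u\in C([0,T];V_0(0,\ell(t)))\cap C^1([0,T];L^2(0,\ell(t)))$ that takes the initial data and satisfies the wave equation and the condition at $x=\ell(t)$ in the weak sense $$\int_0^T\Big[\int_0^{\ell(t)}\big(u_t\psi_t-u_x\psi_x\big)\,dx+\eta\,u(\ell(t),t)\,\frac{d}{dt}\psi(\ell(t),t)\Big]dt=0$$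 for all $\psi\in C^1(\mathbb R^2)$ that vanish on the parts $x=0$, $t=0$ and $t=T$ of the boundary of $\{0\le x\le\ell(t),\ 0\le t\le T\}$. (Continuity in time of functions on the varying intervals $(0,\ell(t))$ is that of their extensions by zero, and likewise of $u_x$, in $L^2(\mathbb R)$. The time derivative is the limit of the difference quotients in $L^2$ of the common interval $(0,\min(\ell(s),\ell(t)))$ as $s\to t$.) Let $\gamma_\eta=\frac{1+\eta}{1-\eta}$ and, for $n\in\mathbb Z$, $$\omega_n=-\tfrac12\ln|\gamma_\eta|+\begin{cases}\frac{2n+1}{2}\,i\pi, & 0\le\eta<1,\\ n\,i\pi, & \eta>1,\end{cases}\qquad c_n=\frac1{4\omega_n}\int_{-L}^{L}\big(\tilde u^0_x+\tilde u^1\big)e^{-\omega_n\varphi(x)}\,dx,$$ where $\tilde u^0_x$ is the even extension of $u^0_x$ and $\tilde u^1$ the odd extension of $u^1$ to $(-L,L)$. Then (WP) has a unique solution on $[0,T]$, and it is given by $$u(x,t)=\sum_{n\in\mathbb Z}c_n\big(e^{\omega_n\varphi(t+x)}-e^{\omega_n\varphi(t-x)}\big),\qquad 0\le x\le\ell(t),\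 0\le t\le T,$$ where the series converges unconditionally at every such point. Moreover, $$\sum_{n\in\mathbb Z}|\omega_nc_n|^2=\frac18\int_{-L}^{L}\big(\tilde u^0_x+\tilde u^1\big)^2e^{\ln|\gamma_\eta|\,\varphi(x)}\,\frac{dx}{\varphi'(x)}<+\infty .$$ -/

import Mathlib

open MeasureTheory Set Filter Topology
open scoped ContDiff

/-- Weak derivative on the interval `(0, l)`: `∫₀ˡ w ψ' = - ∫₀ˡ g ψ` for every smooth `ψ`
with compact support in `(0, l)`. -/
def IsWeakDerivOn (l : ℝ) (w g : ℝ → ℝ) : Prop :=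
  ∀ ψ : ℝ → ℝ, ContDiff ℝ ∞ ψ → HasCompactSupport ψ → tsupport ψ ⊆ Ioo 0 l →
    ∫ x in Ioo 0 l, w x * deriv ψ x = - ∫ x in Ioo 0 l, g x * ψ x

/-- `w ∈ V₀(0, l) = {w ∈ H¹(0, l) : w(0) = 0}`, with weak derivative `g`. As usual in one space
dimension, an element of `H¹(0, l)` is identified with its continuous representative on
`[0, l]`, so that the values at the end points make sense. -/
structure MemV0 (l : ℝ) (w g : ℝ → ℝ) : Prop where
  continuousOn : ContinuousOn w (Icc 0 l)
  zero : w 0 = 0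
  memLp : MemLp w 2 (volume.restrict (Ioo 0 l))
  memLp_deriv : MemLp g 2 (volume.restrict (Ioo 0 l))
  weakDeriv : IsWeakDerivOn l w g

/-- `v ∈ C([0, T]; L²(0, ℓ(t)))`: every `v(·, t)` is in `L²(0, ℓ(t))`, and the extensions by zero
depend continuously on `t` in the norm of `L²(ℝ)`. Functions are written `v x t`. -/
def ContL2 (ℓ : ℝ → ℝ) (T : ℝ) (v : ℝ → ℝ → ℝ) : Prop :=
  (∀ t ∈ Icc 0 T, MemLp (fun x => v x t) 2 (volume.restrict (Ioo 0 (ℓ t)))) ∧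
  ∀ t ∈ Icc 0 T,
    Tendsto
      (fun s => eLpNorm
        (fun x => (Ioo 0 (ℓ s)).indicator (fun y => v y s) x
          - (Ioo 0 (ℓ t)).indicator (fun y => v y t) x) 2 volume)
      (𝓝[Icc 0 T] t) (𝓝 0)

/-- `u ∈ C([0, T]; V₀(0, ℓ(t)))`, where `ux` is the weak derivative of `u` in `x`. -/
def ContV0 (ℓ : ℝ → ℝ) (T : ℝ) (u ux : ℝ → ℝ → ℝ) : Prop :=
  (∀ t ∈ Icc 0 T, MemV0 (ℓ t) (fun x => u x t) (fun x => ux x t)) ∧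
  ContL2 ℓ T u ∧ ContL2 ℓ T ux

/-- `u ∈ C¹([0, T]; L²(0, ℓ(t)))` with time derivative `ut`: at every `t ∈ [0, T]` the difference
quotients of `u` converge to `ut(·, t)` in `L²` of the interval `(0, min (ℓ(s), ℓ(t)))` on which
they are defined, and `u` and `ut` are in `C([0, T]; L²(0, ℓ(t)))`. -/
def ContDiffL2 (ℓ : ℝ → ℝ) (T : ℝ) (u ut : ℝ → ℝ → ℝ) : Prop :=
  ContL2 ℓ T u ∧ ContL2 ℓ T ut ∧
  ∀ t ∈ Icc 0 T,
    Tendsto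
      (fun s => eLpNorm (fun x => (u x s - u x t) / (s - t) - ut x t) 2
        (volume.restrict (Ioo 0 (min (ℓ s) (ℓ t)))))
      (𝓝[Icc 0 T \ {t}] t) (𝓝 0)

/-- Weak form, for functions of finite energy, of the wave equation `u_tt = u_xx` in
`{0 < x < ℓ(t), 0 < t < T}` together with
`(1 + η ℓ'(t)) u_x(ℓ(t), t) + (η + ℓ'(t)) u_t(ℓ(t), t) = 0`.
This boundary condition reads `u_x + ℓ' u_t = - η (d/dt) [u(ℓ(t), t)]` at `x = ℓ(t)`, and
`u_x + ℓ' u_t` is the boundary flux of the wave equation. Multiplying the equation by a test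
function `ψ(x, t)` that vanishes at `x = 0`, at `t = 0` and at `t = T`, and integrating by parts,
in the boundary term along `t ↦ (ℓ(t), t)` as well, gives the identity below. -/
def WeakWaveEq (ℓ : ℝ → ℝ) (η T : ℝ) (u ux ut : ℝ → ℝ → ℝ) : Prop :=
  ∀ ψ : ℝ × ℝ → ℝ, ContDiff ℝ 1 ψ →
    (∀ t ∈ Icc 0 T, ψ (0, t) = 0) →
    (∀ x ∈ Icc 0 (ℓ 0), ψ (x, 0) = 0) →
    (∀ x ∈ Icc 0 (ℓ T), ψ (x, T) = 0) →
    ∫ t in (0 : ℝ)..T,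
      ((∫ x in (0 : ℝ)..ℓ t,
          (ut x t * deriv (fun s => ψ (x, s)) t - ux x t * deriv (fun y => ψ (y, t)) x))
        + η * u (ℓ t) t * deriv (fun s => ψ (ℓ s, s)) t) = 0

/-- `u` is a solution on `[0, T]`, of class
`C([0, T]; V₀(0, ℓ(t))) ∩ C¹([0, T]; L²(0, ℓ(t)))`, of the problem with initial data `u0`, `u1`.
The condition `u(0, t) = 0` is part of `V₀(0, ℓ(t))`. -/
def IsSolutionWP (ℓ : ℝ → ℝ) (η T : ℝ) (u0 u1 : ℝ → ℝ) (u : ℝ → ℝ → ℝ) : Prop :=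
  ∃ ux ut : ℝ → ℝ → ℝ,
    ContV0 ℓ T u ux ∧ ContDiffL2 ℓ T u ut ∧ WeakWaveEq ℓ η T u ux ut ∧
    (∀ x ∈ Icc 0 (ℓ 0), u x 0 = u0 x) ∧
    (∀ᵐ x ∂(volume.restrict (Ioo 0 (ℓ 0))), ut x 0 = u1 x)

noncomputable section

/-- `γ_η = (1 + η) / (1 - η)`, for `η ≠ 1`. -/
def gammaEta (η : ℝ) : ℝ := (1 + η) / (1 - η)

/-- `ω_n = - (1/2) ln |γ_η| + (2n + 1) i π / 2` if `η < 1`, and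
`ω_n = - (1/2) ln |γ_η| + n i π` if `η > 1`. -/
def omegaN (η : ℝ) (n : ℤ) : ℂ :=
  -(1 / 2) * ((Real.log |gammaEta η| : ℝ) : ℂ) +
    if η < 1 then (2 * (n : ℂ) + 1) / 2 * Complex.I * (Real.pi : ℂ)
    else (n : ℂ) * Complex.I * (Real.pi : ℂ)

/-- The function `ũ⁰_x + ũ¹` on `(-L, L)`: the even extension of `u0'` plus the odd extension
of `u1`. -/
def extData (u0' u1 : ℝ → ℝ) (x : ℝ) : ℝ := u0' |x| + Real.sign x * u1 |x|

/-- `c_n = (1 / (4 ω_n)) ∫_{-L}^{L} (ũ⁰_x + ũ¹) e^{-ω_n φ(x)} dx`. -/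
def coeffC (η L : ℝ) (φ u0' u1 : ℝ → ℝ) (n : ℤ) : ℂ :=
  1 / (4 * omegaN η n) *
    ∫ x in (-L)..L, (extData u0' u1 x : ℂ) * Complex.exp (-omegaN η n * (φ x : ℂ))

end

/-!
For every profile `f` with derivative `p ∈ L²`, the d'Alembert wave `u(x, t) = f(t + x) - f(t - x)`
solves the wave equation and vanishes at `x = 0`. The condition at the moving end then says that
`(1 + η) f(t + ℓ(t)) + (1 - η) f(t - ℓ(t))` is constant. The phase `φ` straightens the boundary:
`φ(t + ℓ(t)) = φ(t - ℓ(t)) + 2`, so with `f = F ∘ φ` and a suitable additive constant the condition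
reads `F(s + 2) = r F(s)`, where `r = -1 / γ_η ≠ 1`. The initial data prescribe `F'` on the single
period `φ((-L, L))`, and hence everywhere (`exists_quasiPeriodic_primitive`,
`StraighteningPhase.exists_quasiPeriodic_profile`, `wave_initial_data`).

* Series and energy identity. As `e^{2 ω_n} = r`, the function `F(s) e^{-ω_0 s}` is `2`-periodic,
  and the `ω_n - ω_0` are the frequencies of its Fourier series. Integration by parts shows that
  its coefficients are `c_n`, while the `ω_n c_n` are the Fourier coefficients of `F'(s) e^{-ω_0 s}`.
  Parseval gives the energy identity, and also `∑ |c_n| < ∞`, hence unconditional pointwise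
  convergence (`hasSum_quasiPeriodic`).
* Existence. The basic identity `MovingEnd.integral_waveAction` pairs a function of finite energy
  with a `C¹` d'Alembert wave: the derivative in time of `∫₀^{ℓ(t)} w ψ_t dx` is computed by
  integrating by parts along the moving interval. Taking for `w` a test function, and passing to
  the limit from `C¹` profiles to profiles with derivative in `L²`, gives the weak equation for
  the wave `u` (`MovingEnd.weakWaveEq_wave`). That `u` has the required continuity in time follows
  from the continuity of translations in `L²` (`MovingEnd.finiteEnergy_wave`).
* Uniqueness is by duality (`IsSolutionWP.eqOn`). Given `τ` and a test function `θ` on `(0, ℓ(τ))`,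
  there is a `C¹` d'Alembert wave that satisfies the adjoint condition at the moving end,
  vanishes at time `τ` and has there the velocity `2 θ'`
  (`StraighteningPhase.exists_dual_profile`). Testing the weak equation with it, times a cut-off
  in `t`, shows that a certain bilinear pairing with the solution is constant in time
  (`MovingEnd.dualMomentum_sub_waveMoment_eq`), so `∫ u(x, τ) θ'(x) dx` depends only on the initial
  data. Two solutions thus differ at time `τ` by a constant, which is `0` because both vanish at
  `x = 0`.

The phase is only of class `C¹` on a half line. It is continued to a diffeomorphism of `ℝ`
(`exists_diffeomorph_eqOn_Icc`), which does not affect the values that matter; and the equation for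
`φ` forces `ℓ'` to be continuous (`movingEnd_of_moore`).
-/

/-! ### Primitives of integrable functions and weak derivatives -/

/-- Integration by parts for an indefinite integral `w` of an integrable function `g`. -/
theorem integral_primitive_mul_deriv {a b : ℝ} {w g m : ℝ → ℝ}
    (hg : IntervalIntegrable g volume a b)
    (hw : ∀ x ∈ uIcc a b, w x = w a + ∫ y in a..x, g y) (hm : ContDiff ℝ 1 m) :
    ∫ x in a..b, w x * deriv m x = w b * m b - w a * m a - ∫ x in a..b, g x * m x := by
  have hmAC : AbsolutelyContinuousOnInterval m a b :=
    hm.contDiffOn.absolutelyContinuousOnInterval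
  have hIAC : AbsolutelyContinuousOnInterval (fun x => ∫ y in a..x, g y) a b :=
    hg.absolutelyContinuousOnInterval_intervalIntegral (by simp)
  have h1 := hIAC.integral_mul_deriv_eq_deriv_mul hmAC
  have h2 : ∫ x in a..b, deriv (fun x => ∫ y in a..x, g y) x * m x = ∫ x in a..b, g x * m x := by
    apply intervalIntegral.integral_congr_ae
    filter_upwards [hg.ae_hasDerivAt_integral] with x hx hx'
    rw [(hx (uIoc_subset_uIcc hx') a (by simp)).deriv]
  have hm' : Continuous (deriv m) := hm.continuous_deriv le_rfl
  have h3 : ∫ x in a..b, w x * deriv m x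
      = ∫ x in a..b, (w a * deriv m x + (∫ y in a..x, g y) * deriv m x) := by
    apply intervalIntegral.integral_congr
    intro x hx
    simp only
    rw [hw x hx]; ring
  rw [h3, intervalIntegral.integral_add, h1, h2, intervalIntegral.integral_const_mul,
    intervalIntegral.integral_deriv_eq_sub' m rfl
      (fun x _ => (hm.differentiable one_ne_zero).differentiableAt) hm'.continuousOn,
    hw b (by simp)]
  · simp; ring
  · exact (hm'.const_smul (w a)).intervalIntegrable _ _
  · exact (hIAC.continuousOn.mul hm'.continuousOn).intervalIntegrable

/-- Du Bois-Reymond: a continuous function whose weak derivative vanishes is constant. -/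
theorem eq_of_integral_mul_deriv_eq_zero {l : ℝ} (hl : 0 < l) {d : ℝ → ℝ}
    (hd : ContinuousOn d (Icc 0 l))
    (h : ∀ ψ : ℝ → ℝ, ContDiff ℝ ∞ ψ → HasCompactSupport ψ → tsupport ψ ⊆ Ioo 0 l →
      ∫ x in Ioo 0 l, d x * deriv ψ x = 0) :
    ∀ x ∈ Icc 0 l, d x = d 0 := by
  let B : ContDiffBump (l / 2) := ⟨l / 8, l / 4, by linarith, by linarith⟩
  set χ : ℝ → ℝ := B.normed volume with hχdef
  have hχ : ContDiff ℝ ∞ χ := B.contDiff_normed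
  have hχc : HasCompactSupport χ := B.hasCompactSupport_normed
  have hχs : tsupport χ ⊆ Ioo 0 l := by
    rw [hχdef, B.tsupport_normed_eq, Real.closedBall_eq_Icc]
    intro x hx
    simp only [B, mem_Icc, mem_Ioo] at hx ⊢
    constructor <;> linarith [hx.1, hx.2]
  have hχi : ∫ x, χ x = 1 := B.integral_normed
  set c : ℝ := ∫ x in Ioo 0 l, d x * χ x with hc
  have hint : ∀ θ : ℝ → ℝ, Continuous θ → IntegrableOn (fun x => d x * θ x) (Ioo 0 l) :=
    fun θ hθ => ((hd.mul hθ.continuousOn).integrableOn_Icc).mono_set Ioo_subset_Icc_self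
  have hθ0 : ∀ θ : ℝ → ℝ, ContDiff ℝ ∞ θ → HasCompactSupport θ → tsupport θ ⊆ Ioo 0 l →
      ∫ x, θ x • (d x - c) = 0 := by
    intro θ hθ hθc hθs
    -- subtracting a multiple of the normalized bump `χ` from `θ` leaves the derivative of a test
    -- function
    set I : ℝ := ∫ x, θ x with hI
    set κ : ℝ → ℝ := fun x => θ x - I * χ x with hκ
    have hκC : ContDiff ℝ ∞ κ := hθ.sub (contDiff_const.mul hχ)
    have hκcont : Continuous κ := hκC.continuous
    -- the supports stay away from the end points
    obtain ⟨ε, hε, hεs⟩ : ∃ ε > 0, ∀ x, κ x ≠ 0 → ε ≤ x ∧ x ≤ l - ε := by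
      have hK : IsCompact (tsupport θ ∪ tsupport χ) := hθc.isCompact.union hχc.isCompact
      have hKs : tsupport θ ∪ tsupport χ ⊆ Ioo 0 l := union_subset hθs hχs
      obtain ⟨δ, hδ, hδs⟩ := hK.exists_cthickening_subset_open isOpen_Ioo hKs
      refine ⟨δ, hδ, fun x hx => ?_⟩
      have hxK : x ∈ tsupport θ ∪ tsupport χ := by
        by_contra hcon
        rw [mem_union, not_or] at hcon
        apply hx
        simp [hκ, image_eq_zero_of_notMem_tsupport hcon.1,
          image_eq_zero_of_notMem_tsupport hcon.2]
      have key : ∀ y, |y - x| ≤ δ → y ∈ Ioo 0 l := fun y hy =>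
        hδs (Metric.mem_cthickening_of_dist_le y x δ _ hxK (by simpa [Real.dist_eq] using hy))
      have h1 := key (x - δ) (by simp [abs_of_pos hδ])
      have h2 := key (x + δ) (by simp [abs_of_pos hδ])
      constructor
      · linarith [h1.1]
      · linarith [h2.2]
    have hθint : Integrable θ := hθ.continuous.integrable_of_hasCompactSupport hθc
    have hχint : Integrable χ := hχ.continuous.integrable_of_hasCompactSupport hχc
    have hκ0 : ∫ x, κ x = 0 := by
      rw [hκ, integral_sub hθint (hχint.const_mul I), integral_const_mul, hχi]; simp [hI]
    set ψ : ℝ → ℝ := fun x => ∫ y in (0 : ℝ)..x, κ y with hψ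
    have hψd : ∀ x, HasDerivAt ψ (κ x) x := fun x =>
      intervalIntegral.integral_hasDerivAt_right (hκcont.intervalIntegrable _ _)
        hκcont.stronglyMeasurable.stronglyMeasurableAtFilter hκcont.continuousAt
    have hψder : deriv ψ = κ := funext fun x => (hψd x).deriv
    have hψC : ContDiff ℝ ∞ ψ := by
      rw [contDiff_infty_iff_deriv]
      exact ⟨fun x => (hψd x).differentiableAt, by rw [hψder]; exact hκC⟩
    have hψs : Function.support ψ ⊆ Icc ε (l - ε) := by
      intro x hx
      by_contra hcon
      apply hx
      rw [mem_Icc, not_and_or, not_le, not_le] at hcon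
      rcases hcon with hcon | hcon
      · apply intervalIntegral.integral_zero_ae
        refine Eventually.of_forall fun y hy => ?_
        by_contra h0
        have h1 := hεs y h0
        have : y ≤ max 0 x := (mem_uIoc.1 hy).elim (fun h => h.2.trans (le_max_right _ _))
          (fun h => h.2.trans (le_max_left _ _))
        have : max 0 x < ε := max_lt hε hcon
        linarith [h1.1]
      · have h0 : ∀ y, y ∉ Ioc 0 x → κ y = 0 := by
          intro y hy
          by_contra h0
          have h1 := hεs y h0
          exact hy ⟨by linarith [h1.1], by linarith [h1.2]⟩
        have hx0 : 0 ≤ x := by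
          by_contra hneg
          have h2 : ∀ y, κ y = 0 := fun y => h0 y (fun hy => by linarith [hy.1, hy.2])
          exact hx (by simp [hψ, h2])
        rw [hψ]
        simp only
        rw [intervalIntegral.integral_of_le hx0, setIntegral_eq_integral_of_forall_compl_eq_zero h0,
          hκ0]
    have hψt : tsupport ψ ⊆ Icc ε (l - ε) := closure_minimal hψs isClosed_Icc
    have hψcs : HasCompactSupport ψ := isCompact_Icc.of_isClosed_subset (isClosed_tsupport _) hψt
    have h1 := h ψ hψC hψcs (hψt.trans fun x hx => ⟨by linarith [hx.1], by linarith [hx.2]⟩)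
    rw [hψder] at h1
    have h2 : ∫ x in Ioo 0 l, d x * κ x = (∫ x in Ioo 0 l, d x * θ x) - I * c := by
      rw [hc, ← integral_const_mul, ← integral_sub (hint θ hθ.continuous)
        ((hint χ hχ.continuous).const_mul I)]
      congr 1; ext x; simp only [hκ]; ring
    have h3 : ∫ x in Ioo 0 l, d x * θ x = ∫ x in Ioo 0 l, (θ x * (d x - c) + c * θ x) := by
      congr 1; ext x; ring
    have h4 : ∫ x in Ioo 0 l, θ x = I :=
      setIntegral_eq_integral_of_forall_compl_eq_zero fun x hx =>
        image_eq_zero_of_notMem_tsupport fun h' => hx (hθs h')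
    have hi1 : IntegrableOn (fun x => θ x * (d x - c)) (Ioo 0 l) := by
      have := (hint θ hθ.continuous).sub ((hθint.integrableOn (s := Ioo 0 l)).const_mul c)
      refine this.congr (Eventually.of_forall fun x => ?_)
      simp; ring
    rw [integral_add hi1 (hθint.integrableOn.const_mul c), integral_const_mul, h4] at h3
    have h5 : ∫ x in Ioo 0 l, θ x * (d x - c) = ∫ x, θ x * (d x - c) :=
      setIntegral_eq_integral_of_forall_compl_eq_zero fun x hx => by
        rw [image_eq_zero_of_notMem_tsupport fun h' => hx (hθs h'), zero_mul]
    simp only [smul_eq_mul]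
    rw [← h5]
    linarith
  have hae := isOpen_Ioo.ae_eq_zero_of_integral_contDiff_smul_eq_zero (μ := volume)
    (U := Ioo 0 l) (f := fun x => d x - c)
    (((hd.mono Ioo_subset_Icc_self).sub continuousOn_const).locallyIntegrableOn
      measurableSet_Ioo) hθ0
  have heq : EqOn d (fun _ => c) (Ioo 0 l) := by
    apply Measure.eqOn_open_of_ae_eq (μ := volume) _ isOpen_Ioo (hd.mono Ioo_subset_Icc_self)
      continuousOn_const
    rw [EventuallyEq, ae_restrict_iff' measurableSet_Ioo]
    filter_upwards [hae] with x hx hx'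
    linarith [hx hx']
  have heq' : EqOn d (fun _ => c) (Icc 0 l) :=
    heq.of_subset_closure hd continuousOn_const Ioo_subset_Icc_self
      (by rw [closure_Ioo hl.ne])
  intro x hx
  rw [heq' hx, heq' (left_mem_Icc.2 hl.le)]

theorem MemV0.intervalIntegrable {l : ℝ} {w g : ℝ → ℝ} (hl : 0 ≤ l) (h : MemV0 l w g) :
    IntervalIntegrable g volume 0 l := by
  rw [intervalIntegrable_iff_integrableOn_Ioo_of_le hl]
  exact h.memLp_deriv.integrable (by norm_num)

theorem continuousOn_primitive_Icc {l : ℝ} {g : ℝ → ℝ} (hl : 0 ≤ l)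
    (hg : IntervalIntegrable g volume 0 l) :
    ContinuousOn (fun x => ∫ y in (0 : ℝ)..x, g y) (Icc 0 l) := by
  have := intervalIntegral.continuousOn_primitive_interval (μ := volume) (f := g) (a := 0) (b := l)
    (by rw [uIcc_of_le hl]; exact (intervalIntegrable_iff_integrableOn_Icc_of_le hl).1 hg)
  rwa [uIcc_of_le hl] at this

/-- Every primitive of an integrable function has that function as weak derivative. -/
theorem isWeakDerivOn_primitive {l : ℝ} (hl : 0 ≤ l) {w g : ℝ → ℝ}
    (hg : IntervalIntegrable g volume 0 l)
    (hw : ∀ x ∈ Icc 0 l, w x = w 0 + ∫ y in (0 : ℝ)..x, g y) : IsWeakDerivOn l w g := by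
  intro ψ hψ _ hψs
  have h := integral_primitive_mul_deriv (w := w) hg (by rwa [uIcc_of_le hl])
    (hψ.of_le (by norm_cast))
  have h0 : ψ 0 = 0 := image_eq_zero_of_notMem_tsupport fun h' => (hψs h').1.false
  have hl0 : ψ l = 0 := image_eq_zero_of_notMem_tsupport fun h' => (hψs h').2.false
  rw [h0, hl0, intervalIntegral.integral_of_le hl, intervalIntegral.integral_of_le hl,
    integral_Ioc_eq_integral_Ioo, integral_Ioc_eq_integral_Ioo] at h
  rw [h]; ring

theorem MemV0.eq_integral {l : ℝ} {w g : ℝ → ℝ} (hl : 0 < l) (h : MemV0 l w g) :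
    ∀ x ∈ Icc 0 l, w x = ∫ y in (0 : ℝ)..x, g y := by
  have hg := h.intervalIntegrable hl.le
  have hc := continuousOn_primitive_Icc hl.le hg
  have hw1 : IsWeakDerivOn l (fun x => ∫ y in (0 : ℝ)..x, g y) g :=
    isWeakDerivOn_primitive hl.le hg (by simp)
  have := eq_of_integral_mul_deriv_eq_zero hl (h.continuousOn.sub hc) ?_
  · intro x hx
    have h1 := this x hx
    simp only [Pi.sub_apply, h.zero, intervalIntegral.integral_same] at h1
    linarith
  · intro ψ hψ hψc hψs
    have hψ' : Continuous (deriv ψ) := hψ.continuous_deriv (by norm_cast)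
    have e1 := h.weakDeriv ψ hψ hψc hψs
    have e2 := hw1 ψ hψ hψc hψs
    rw [← e2] at e1
    have i1 : IntegrableOn (fun x => w x * deriv ψ x) (Ioo 0 l) :=
      ((h.continuousOn.mul hψ'.continuousOn).integrableOn_Icc).mono_set Ioo_subset_Icc_self
    have i2 : IntegrableOn (fun x => (∫ y in (0 : ℝ)..x, g y) * deriv ψ x) (Ioo 0 l) :=
      ((hc.mul hψ'.continuousOn).integrableOn_Icc).mono_set Ioo_subset_Icc_self
    have := integral_sub i1 i2
    rw [e1, sub_self] at this
    refine Eq.trans (integral_congr_ae (Eventually.of_forall fun x => ?_)) this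
    exact sub_mul _ _ _

/-! ### Continuous families of square integrable functions on a moving interval -/

theorem MeasureTheory.MemLp.eLpNorm_two_eq_ofReal_sqrt {μ : Measure ℝ} {f : ℝ → ℝ}
    (hf : MemLp f 2 μ) : eLpNorm f 2 μ = ENNReal.ofReal (Real.sqrt (∫ x, f x ^ 2 ∂μ)) := by
  rw [hf.eLpNorm_eq_integral_rpow_norm (by norm_num) (by norm_num), Real.sqrt_eq_rpow]
  norm_num

/-- Dominated convergence in `L²`. -/
theorem tendsto_eLpNorm_two_zero_of_dominated {ι : Type*} {l : Filter ι} [l.IsCountablyGenerated]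
    {μ : Measure ℝ} {F : ι → ℝ → ℝ} (bound : ℝ → ℝ) (hb : MemLp bound 2 μ)
    (hm : ∀ᶠ i in l, AEStronglyMeasurable (F i) μ)
    (hle : ∀ᶠ i in l, ∀ᵐ x ∂μ, ‖F i x‖ ≤ bound x)
    (hlim : ∀ᵐ x ∂μ, Tendsto (fun i => F i x) l (𝓝 0)) :
    Tendsto (fun i => eLpNorm (F i) 2 μ) l (𝓝 0) := by
  have h1 : Tendsto (fun i => ∫ x, F i x ^ 2 ∂μ) l (𝓝 (∫ _, (0 : ℝ) ∂μ)) := by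
    apply tendsto_integral_filter_of_dominated_convergence (fun x => bound x ^ 2)
    · filter_upwards [hm] with i hi using hi.pow 2
    · filter_upwards [hle] with i hi
      filter_upwards [hi] with x hx
      rw [norm_pow]
      gcongr
    · exact hb.integrable_sq
    · filter_upwards [hlim] with x hx
      simpa using hx.pow 2
  rw [integral_zero] at h1
  have h2 : Tendsto (fun i => ENNReal.ofReal (Real.sqrt (∫ x, F i x ^ 2 ∂μ))) l (𝓝 0) := by
    have := ENNReal.tendsto_ofReal ((Real.continuous_sqrt.tendsto 0).comp h1)
    simpa using this
  refine h2.congr' ?_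
  filter_upwards [hm, hle] with i hi hi'
  exact (MemLp.eLpNorm_two_eq_ofReal_sqrt (hb.mono' hi hi')).symm

theorem exists_bound_Icc {ℓ : ℝ → ℝ} {T : ℝ} (hℓ : ContinuousOn ℓ (Icc 0 T)) :
    ∃ M : ℝ, 0 < M ∧ ∀ t ∈ Icc 0 T, ℓ t ≤ M := by
  obtain ⟨M, hM⟩ := isCompact_Icc.exists_bound_of_continuousOn hℓ
  exact ⟨max M 1, by positivity, fun t ht => (le_abs_self _).trans ((hM t ht).trans (le_max_left _ _))⟩

/-- If `K` is bounded on a bounded interval, then so is its restriction to a smaller interval, and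
the function is square integrable there. -/
theorem memLp_indicator_Ioo_of_continuous {K : ℝ → ℝ} (hK : Continuous K) (a b : ℝ) :
    MemLp ((Ioo a b).indicator K) 2 volume := by
  rw [memLp_indicator_iff_restrict measurableSet_Ioo]
  obtain ⟨C, hC⟩ := isCompact_Icc.exists_bound_of_continuousOn (hK.continuousOn (s := Icc a b))
  refine MemLp.of_bound hK.aestronglyMeasurable C ?_
  rw [ae_restrict_iff' measurableSet_Ioo]
  exact Eventually.of_forall fun x hx => hC x (Ioo_subset_Icc_self hx)

/-- Restrictions of a jointly continuous function to a moving interval depend continuously on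
time in `L²`. -/
theorem contL2_of_continuous {ℓ : ℝ → ℝ} {T : ℝ} (hℓ : ContinuousOn ℓ (Icc 0 T))
    {v : ℝ → ℝ → ℝ} (hv : Continuous fun p : ℝ × ℝ => v p.1 p.2) : ContL2 ℓ T v := by
  have hvt : ∀ t, Continuous fun x => v x t := fun t => by fun_prop
  refine ⟨fun t _ => (memLp_indicator_iff_restrict measurableSet_Ioo).1
    (memLp_indicator_Ioo_of_continuous (hvt t) 0 (ℓ t)), fun t ht => ?_⟩
  obtain ⟨M, hM0, hM⟩ := exists_bound_Icc hℓ
  obtain ⟨C, hC⟩ := (isCompact_Icc.prod isCompact_Icc).exists_bound_of_continuousOn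
    (hv.continuousOn (s := Icc (0 : ℝ) M ×ˢ Icc (0 : ℝ) T))
  have hC' : ∀ s ∈ Icc 0 T, ∀ x, ‖(Ioo 0 (ℓ s)).indicator (fun y => v y s) x‖
      ≤ (Ioo (0 : ℝ) M).indicator (fun _ => C) x := by
    intro s hs x
    by_cases hx : x ∈ Ioo 0 (ℓ s)
    · have hxM : x ∈ Ioo 0 M := ⟨hx.1, hx.2.trans_le (hM s hs)⟩
      rw [indicator_of_mem hx, indicator_of_mem hxM]
      exact hC (x, s) ⟨Ioo_subset_Icc_self hxM, hs⟩
    · rw [indicator_of_notMem hx, norm_zero]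
      by_cases hxM : x ∈ Ioo 0 M
      · rw [indicator_of_mem hxM]
        exact (norm_nonneg _).trans (hC (x, s) ⟨Ioo_subset_Icc_self hxM, hs⟩)
      · rw [indicator_of_notMem hxM]
  apply tendsto_eLpNorm_two_zero_of_dominated
    (fun x => (Ioo (0 : ℝ) M).indicator (fun _ => C) x + (Ioo (0 : ℝ) M).indicator (fun _ => C) x)
  · exact (memLp_indicator_Ioo_of_continuous continuous_const 0 M).add
      (memLp_indicator_Ioo_of_continuous continuous_const 0 M)
  · exact Eventually.of_forall fun s =>
      ((hvt s).aestronglyMeasurable.indicator measurableSet_Ioo).sub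
        ((hvt t).aestronglyMeasurable.indicator measurableSet_Ioo)
  · filter_upwards [self_mem_nhdsWithin] with s hs
    exact Eventually.of_forall fun x => (norm_sub_le _ _).trans
      (add_le_add (hC' s hs x) (hC' t ht x))
  · have hne : ∀ᵐ x : ℝ, x ≠ ℓ t := by simp [ae_iff, measure_singleton]
    filter_upwards [hne] with x hx
    have hℓt : Tendsto ℓ (𝓝[Icc 0 T] t) (𝓝 (ℓ t)) := hℓ t ht
    have hvx : Tendsto (fun s => v x s - v x t) (𝓝[Icc 0 T] t) (𝓝 0) := by
      have : Continuous fun s => v x s - v x t := by fun_prop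
      simpa using (this.tendsto t).mono_left (nhdsWithin_le_nhds (s := Icc 0 T))
    by_cases hx0 : 0 < x
    · rcases lt_or_gt_of_ne hx with hlt | hgt
      · refine hvx.congr' ?_
        filter_upwards [hℓt.eventually (lt_mem_nhds hlt)] with s hs
        rw [indicator_of_mem (show x ∈ Ioo 0 (ℓ s) from ⟨hx0, hs⟩),
          indicator_of_mem (show x ∈ Ioo 0 (ℓ t) from ⟨hx0, hlt⟩)]
      · refine tendsto_const_nhds.congr' ?_
        filter_upwards [hℓt.eventually (gt_mem_nhds hgt)] with s hs
        rw [indicator_of_notMem (show x ∉ Ioo 0 (ℓ s) from fun h => h.2.not_gt hs),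
          indicator_of_notMem (show x ∉ Ioo 0 (ℓ t) from fun h => h.2.not_gt hgt), sub_zero]
    · refine tendsto_const_nhds.congr fun s => ?_
      rw [indicator_of_notMem (show x ∉ Ioo 0 (ℓ s) from fun h => hx0 h.1),
          indicator_of_notMem (show x ∉ Ioo 0 (ℓ t) from fun h => hx0 h.1), sub_zero]

theorem ContL2.memLp_indicator {ℓ : ℝ → ℝ} {T : ℝ} {v : ℝ → ℝ → ℝ} (h : ContL2 ℓ T v)
    (t : Icc (0 : ℝ) T) :
    MemLp (fun x => (Ioo 0 (ℓ t)).indicator (fun y => v y t) x) 2 volume :=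
  (memLp_indicator_iff_restrict measurableSet_Ioo).2 (h.1 t t.2)

/-- The curve in `L²(ℝ)` of the extensions by zero. -/
noncomputable def ContL2.curve {ℓ : ℝ → ℝ} {T : ℝ} {v : ℝ → ℝ → ℝ} (h : ContL2 ℓ T v)
    (t : Icc (0 : ℝ) T) : Lp ℝ 2 (volume : Measure ℝ) :=
  (h.memLp_indicator t).toLp _

theorem ContL2.continuous_curve {ℓ : ℝ → ℝ} {T : ℝ} {v : ℝ → ℝ → ℝ} (h : ContL2 ℓ T v) :
    Continuous h.curve := by
  rw [continuous_iff_continuousAt]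
  intro t
  have h2 := h.2 t t.2
  rw [nhdsWithin_eq_map_subtype_coe t.2, tendsto_map'_iff] at h2
  exact (Lp.tendsto_Lp_iff_tendsto_eLpNorm'' _ h.memLp_indicator _ (h.memLp_indicator t)).2 h2

theorem ContL2.inner_curve {ℓ ℓ' : ℝ → ℝ} {T T' : ℝ} {v v' : ℝ → ℝ → ℝ} (h : ContL2 ℓ T v)
    (h' : ContL2 ℓ' T' v') (t : Icc (0 : ℝ) T) (s : Icc (0 : ℝ) T')
    (h0 : 0 ≤ min (ℓ t) (ℓ' s)) :
    inner ℝ (h'.curve s) (h.curve t) = ∫ x in (0 : ℝ)..min (ℓ t) (ℓ' s), v x t * v' x s := by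
  rw [L2.inner_def, intervalIntegral.integral_of_le h0, integral_Ioc_eq_integral_Ioo,
    ← integral_indicator measurableSet_Ioo]
  apply integral_congr_ae
  filter_upwards [(h.memLp_indicator t).coeFn_toLp, (h'.memLp_indicator s).coeFn_toLp]
    with x hx hx'
  unfold ContL2.curve
  have hmem : x ∈ Ioo 0 (min (ℓ t) (ℓ' s)) ↔ x ∈ Ioo 0 (ℓ t) ∧ x ∈ Ioo 0 (ℓ' s) := by
    simp only [mem_Ioo, lt_min_iff]; tauto
  rw [hx, hx']
  by_cases h1 : x ∈ Ioo 0 (ℓ t)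
  · by_cases h2 : x ∈ Ioo 0 (ℓ' s)
    · rw [indicator_of_mem (hmem.2 ⟨h1, h2⟩), indicator_of_mem h1, indicator_of_mem h2]
      simp
    · rw [indicator_of_notMem (fun h => h2 (hmem.1 h).2), indicator_of_notMem h2, inner_zero_left]
  · rw [indicator_of_notMem (fun h => h1 (hmem.1 h).1), indicator_of_notMem h1, inner_zero_right]

/-- Integrals of a curve in `L²` against a continuous function are continuous in time. -/
theorem ContL2.continuousOn_integral_mul {ℓ : ℝ → ℝ} {T : ℝ} {v : ℝ → ℝ → ℝ}
    (h : ContL2 ℓ T v) (hℓ : ContinuousOn ℓ (Icc 0 T)) (hℓ0 : ∀ t ∈ Icc 0 T, 0 ≤ ℓ t)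
    {k : ℝ × ℝ → ℝ} (hk : Continuous k) :
    ContinuousOn (fun t => ∫ x in (0 : ℝ)..ℓ t, v x t * k (x, t)) (Icc 0 T) := by
  have hk' : ContL2 ℓ T (fun x t => k (x, t)) := contL2_of_continuous hℓ hk
  rw [continuousOn_iff_continuous_domRestrict]
  refine (hk'.continuous_curve.inner h.continuous_curve (𝕜 := ℝ)).congr fun t => ?_
  rw [h.inner_curve hk' t t (by simpa using hℓ0 t t.2)]
  simp

/-- A function of class `C([0, T]; V₀(0, ℓ(t)))` is jointly continuous: it agrees with a continuous
function on the plane. -/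
theorem ContV0.exists_continuous {ℓ : ℝ → ℝ} {T : ℝ} {w wx : ℝ → ℝ → ℝ}
    (h : ContV0 ℓ T w wx) (hT : 0 ≤ T) (hℓ : ContinuousOn ℓ (Icc 0 T))
    (hℓ0 : ∀ t ∈ Icc 0 T, 0 < ℓ t) :
    ∃ W : ℝ × ℝ → ℝ, Continuous W ∧ ∀ t ∈ Icc 0 T, ∀ x ∈ Icc 0 (ℓ t), w x t = W (x, t) := by
  obtain ⟨M, hM0, hM⟩ := exists_bound_Icc hℓ
  have hχ : ContL2 id M (fun _ _ => 1) := contL2_of_continuous continuousOn_id continuous_const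
  refine ⟨fun p => inner ℝ (hχ.curve (projIcc 0 M hM0.le p.1))
    (h.2.2.curve (projIcc 0 T hT p.2)), ?_, fun t ht x hx => ?_⟩
  · exact (hχ.continuous_curve.comp (continuous_projIcc.comp continuous_fst)).inner
      (h.2.2.continuous_curve.comp (continuous_projIcc.comp continuous_snd))
  · have hxM : x ∈ Icc 0 M := ⟨hx.1, hx.2.trans (hM t ht)⟩
    simp only
    rw [projIcc_of_mem hM0.le hxM, projIcc_of_mem hT ht,
      h.2.2.inner_curve hχ ⟨t, ht⟩ ⟨x, hxM⟩ (le_min (hℓ0 t ht).le hx.1)]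
    simp only [id, min_eq_right hx.2, mul_one]
    exact (h.1 t ht).eq_integral (hℓ0 t ht) x hx

/-! ### Differentiation of integrals over the moving interval -/

/-- Cauchy-Schwarz on `(0, m)`, with a bounded second factor. -/
theorem abs_integral_mul_le_eLpNorm {m C : ℝ} (hm : 0 ≤ m) {f g : ℝ → ℝ}
    (hf : MemLp f 2 (volume.restrict (Ioo 0 m))) (hg : ∀ x ∈ Ioo 0 m, |g x| ≤ C) :
    |∫ x in (0 : ℝ)..m, f x * g x|
      ≤ C * (Real.sqrt m * (eLpNorm f 2 (volume.restrict (Ioo 0 m))).toReal) := by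
  rw [intervalIntegral.integral_of_le hm, integral_Ioc_eq_integral_Ioo]
  have hfi : Integrable f (volume.restrict (Ioo 0 m)) := hf.integrable (by norm_num)
  rcases hm.eq_or_lt with rfl | hm
  · simp
  have hC : 0 ≤ C := (abs_nonneg _).trans (hg (m / 2) ⟨by linarith, by linarith⟩)
  have h1 : ‖∫ x in Ioo 0 m, f x * g x‖ ≤ ∫ x in Ioo 0 m, C * ‖f x‖ := by
    apply norm_integral_le_of_norm_le (hfi.norm.const_mul C)
    rw [ae_restrict_iff' measurableSet_Ioo]
    refine Eventually.of_forall fun x hx => ?_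
    rw [norm_mul, mul_comm]
    exact mul_le_mul_of_nonneg_right (hg x hx) (norm_nonneg _)
  rw [integral_const_mul] at h1
  refine h1.trans (mul_le_mul_of_nonneg_left ?_ hC)
  have h2 : eLpNorm f 1 (volume.restrict (Ioo 0 m))
      ≤ eLpNorm f 2 (volume.restrict (Ioo 0 m)) * ENNReal.ofReal (Real.sqrt m) := by
    have := eLpNorm_le_eLpNorm_mul_rpow_measure_univ (μ := volume.restrict (Ioo 0 m))
      (p := 1) (q := 2) (by norm_num) hf.1
    refine this.trans (le_of_eq ?_)
    congr 1
    rw [Measure.restrict_apply_univ, Real.volume_Ioo, sub_zero, Real.sqrt_eq_rpow,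
      ENNReal.ofReal_rpow_of_pos hm]
    norm_num
  have h3 : ∫ x in Ioo 0 m, ‖f x‖ = (eLpNorm f 1 (volume.restrict (Ioo 0 m))).toReal := by
    rw [eLpNorm_one_eq_lintegral_enorm, integral_norm_eq_lintegral_enorm hfi.1]
  rw [h3]
  calc _ ≤ (eLpNorm f 2 (volume.restrict (Ioo 0 m)) * ENNReal.ofReal (Real.sqrt m)).toReal :=
        ENNReal.toReal_mono (ENNReal.mul_ne_top hf.2.ne ENNReal.ofReal_ne_top) h2
    _ = _ := by
        rw [ENNReal.toReal_mul, ENNReal.toReal_ofReal (Real.sqrt_nonneg _), mul_comm]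

/-- The contribution of the moving end point to the difference quotient of an integral. -/
theorem tendsto_slope_moving_endpoint {F : ℝ × ℝ → ℝ} (hF : Continuous F) {ℓ : ℝ → ℝ} {ℓd t : ℝ}
    {S : Set ℝ} (hℓ : HasDerivWithinAt ℓ ℓd S t) :
    Tendsto (fun s => (s - t)⁻¹ * ((∫ x in (min (ℓ s) (ℓ t))..ℓ s, F (x, s))
      - ∫ x in (min (ℓ s) (ℓ t))..ℓ t, F (x, t))) (𝓝[S \ {t}] t) (𝓝 (ℓd * F (ℓ t, t))) := by
  set G : ℝ × ℝ → ℝ := fun p => ∫ r in (0 : ℝ)..1, F (r * (p.1 - ℓ t) + ℓ t, p.2) with hG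
  have hGc : Continuous G := by
    apply intervalIntegral.continuous_parametric_intervalIntegral_of_continuous'
    simp only [Function.uncurry_def]
    fun_prop
  -- the time at which the integrand is frozen on the interval between the two end points
  set c : ℝ → ℝ := fun s => if ℓ t ≤ ℓ s then s else t with hc
  have hct : Tendsto c (𝓝[S \ {t}] t) (𝓝 t) := by
    have h1 : Tendsto (fun s : ℝ => s) (𝓝[S \ {t}] t) (𝓝 t) := nhdsWithin_le_nhds
    exact Tendsto.if' h1 tendsto_const_nhds
  have hsub : ∀ b y, ∫ x in ℓ t..b, F (x, y) = (b - ℓ t) * G (b, y) := by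
    intro b y
    have := intervalIntegral.smul_integral_comp_mul_add (a := 0) (b := 1)
      (fun x => F (x, y)) (b - ℓ t) (ℓ t)
    simp only [mul_zero, zero_add, mul_one, sub_add_cancel, smul_eq_mul] at this
    rw [← this, hG]
    simp only [mul_comm]
  have hE : ∀ s, (∫ x in (min (ℓ s) (ℓ t))..ℓ s, F (x, s))
      - ∫ x in (min (ℓ s) (ℓ t))..ℓ t, F (x, t) = (ℓ s - ℓ t) * G (ℓ s, c s) := by
    intro s
    by_cases h : ℓ t ≤ ℓ s
    · rw [min_eq_right h, intervalIntegral.integral_same, sub_zero, hsub]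
      simp [hc, h]
    · rw [min_eq_left (not_le.1 h).le, intervalIntegral.integral_same, zero_sub,
        ← intervalIntegral.integral_symm, hsub]
      simp [hc, h]
  have hℓt : Tendsto ℓ (𝓝[S \ {t}] t) (𝓝 (ℓ t)) :=
    hℓ.continuousWithinAt.tendsto.mono_left (nhdsWithin_mono _ sdiff_subset)
  have h1 : Tendsto (fun s => slope ℓ t s * G (ℓ s, c s)) (𝓝[S \ {t}] t)
      (𝓝 (ℓd * G (ℓ t, t))) :=
    (hasDerivWithinAt_iff_tendsto_slope.1 hℓ).mul
      ((hGc.tendsto (ℓ t, t)).comp (hℓt.prodMk_nhds hct))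
  have h2 : G (ℓ t, t) = F (ℓ t, t) := by simp [hG]
  rw [h2] at h1
  refine h1.congr fun s => ?_
  rw [hE, slope_def_field]
  ring

/-- Leibniz rule on the moving interval, for a product `w k` in which `k` is `C¹` in time and `w` has
a time derivative only in `L²`. The difference quotient splits into the integral over the common
interval, where the quotients of `w` and of `k` are treated separately, and the contribution of the
end point. -/
theorem hasDerivWithinAt_integral_moving {ℓ : ℝ → ℝ} {T t ℓd : ℝ} {w wt : ℝ → ℝ → ℝ}
    {W k kt : ℝ × ℝ → ℝ} (hℓc : ContinuousOn ℓ (Icc 0 T)) (hℓ0 : ∀ t ∈ Icc 0 T, 0 < ℓ t)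
    (ht : t ∈ Icc 0 T) (hℓd : HasDerivWithinAt ℓ ℓd (Icc 0 T) t)
    (hW : Continuous W) (hwW : ∀ t ∈ Icc 0 T, ∀ x ∈ Icc 0 (ℓ t), w x t = W (x, t))
    (hw : ContDiffL2 ℓ T w wt) (hk : Continuous k) (hkt : Continuous kt)
    (hkd : ∀ x s, HasDerivAt (fun s => k (x, s)) (kt (x, s)) s) :
    HasDerivWithinAt (fun t => ∫ x in (0 : ℝ)..ℓ t, w x t * k (x, t))
      ((∫ x in (0 : ℝ)..ℓ t, (wt x t * k (x, t) + w x t * kt (x, t)))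
        + ℓd * (w (ℓ t) t * k (ℓ t, t))) (Icc 0 T) t := by
  obtain ⟨M, hM0, hM⟩ := exists_bound_Icc hℓc
  have hbd : ∀ K : ℝ × ℝ → ℝ, Continuous K → ∃ C, ∀ x ∈ Icc 0 M, ∀ s ∈ Icc 0 T, ‖K (x, s)‖ ≤ C := by
    intro K hK
    obtain ⟨C, hC⟩ := (isCompact_Icc.prod isCompact_Icc).exists_bound_of_continuousOn
      (hK.continuousOn (s := Icc (0 : ℝ) M ×ˢ Icc (0 : ℝ) T))
    exact ⟨C, fun x hx s hs => hC (x, s) ⟨hx, hs⟩⟩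
  obtain ⟨C, hC⟩ := hbd k hk
  obtain ⟨C', hC'⟩ := hbd kt hkt
  obtain ⟨D, hD⟩ := hbd W hW
  rw [hasDerivWithinAt_iff_tendsto_slope]
  set lF := 𝓝[Icc 0 T \ {t}] t with hlF
  have hmem : ∀ᶠ s in lF, s ∈ Icc 0 T \ {t} := self_mem_nhdsWithin
  have hℓt : Tendsto ℓ lF (𝓝 (ℓ t)) :=
    (hℓc t ht).tendsto.mono_left (nhdsWithin_mono _ sdiff_subset)
  set m : ℝ → ℝ := fun s => min (ℓ s) (ℓ t) with hm
  have hm0 : ∀ s ∈ Icc 0 T, 0 < m s := fun s hs => lt_min (hℓ0 s hs) (hℓ0 t ht)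
  have hmM : ∀ s, m s ≤ M := fun s => (min_le_right _ _).trans (hM t ht)
  have hmt : Tendsto m lF (𝓝 (ℓ t)) := by
    simpa [hm] using hℓt.min (tendsto_const_nhds (x := ℓ t))
  -- the error in the difference quotients of `w` on the common interval tends to zero in `L²`
  set q : ℝ → ℝ → ℝ := fun s x => (w x s - w x t) / (s - t) - wt x t with hq
  have hq2 : ∀ s ∈ Icc 0 T \ {t}, MemLp (q s) 2 (volume.restrict (Ioo 0 (m s))) := by
    intro s hs
    have h1 : MemLp (fun x => wt x t) 2 (volume.restrict (Ioo 0 (m s))) :=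
      (hw.2.1.1 t ht).mono_measure
        (Measure.restrict_mono (Ioo_subset_Ioo_right (min_le_right _ _)) le_rfl)
    have h2 : MemLp (fun x => (s - t)⁻¹ * (w x s - w x t)) 2 (volume.restrict (Ioo 0 (m s))) :=
      (((hw.1.1 s hs.1).mono_measure
        (Measure.restrict_mono (Ioo_subset_Ioo_right (min_le_left _ _)) le_rfl)).sub
      ((hw.1.1 t ht).mono_measure
        (Measure.restrict_mono (Ioo_subset_Ioo_right (min_le_right _ _)) le_rfl))).const_mul _
    refine (h2.sub h1).ae_eq (Eventually.of_forall fun x => ?_)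
    simp only [hq, Pi.sub_apply]; ring
  have hP1 : Tendsto (fun s => ∫ x in (0 : ℝ)..m s, q s x * k (x, s)) lF (𝓝 0) := by
    have hlim : Tendsto (fun s => C * (Real.sqrt M *
        (eLpNorm (q s) 2 (volume.restrict (Ioo 0 (m s)))).toReal)) lF (𝓝 0) := by
      have h1 := (ENNReal.tendsto_toReal ENNReal.zero_ne_top).comp (hw.2.2 t ht)
      have h2 := (h1.const_mul (Real.sqrt M)).const_mul C
      simpa using h2
    apply squeeze_zero_norm' _ hlim
    filter_upwards [hmem] with s hs
    refine (abs_integral_mul_le_eLpNorm (hm0 s hs.1).le (hq2 s hs) (C := C) ?_).trans ?_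
    · exact fun x hx => hC x ⟨hx.1.le, hx.2.le.trans (hmM s)⟩ s hs.1
    · have hC0 : 0 ≤ C := (norm_nonneg _).trans (hC 0 ⟨le_rfl, hM0.le⟩ t ht)
      gcongr
      exact hmM s
  -- the difference quotients of `k` converge boundedly; their limit is taken on a fixed interval
  have hquot : ∀ s ∈ Icc 0 T, ∀ x ∈ Icc 0 M, ‖(s - t)⁻¹ * (k (x, s) - k (x, t))‖ ≤ C' := by
    intro s hs x hx
    have h1 := (convex_Icc 0 T).norm_image_sub_le_of_norm_hasDerivWithin_le
      (f := fun s => k (x, s)) (f' := fun s => kt (x, s)) (C := C')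
      (fun y _ => (hkd x y).hasDerivWithinAt) (fun y hy => hC' x hx y hy) ht hs
    rw [norm_mul, norm_inv]
    have hC0 : 0 ≤ C' := (norm_nonneg _).trans (hC' 0 ⟨le_rfl, hM0.le⟩ t ht)
    exact inv_mul_le_of_le_mul₀ (norm_nonneg _) hC0 (by rwa [mul_comm])
  have hwti : IntervalIntegrable (fun x => wt x t) volume 0 (ℓ t) := by
    rw [intervalIntegrable_iff_integrableOn_Ioo_of_le (hℓ0 t ht).le]
    exact (hw.2.1.1 t ht).integrable (by norm_num)
  have hP2 : Tendsto (fun s => ∫ x in (0 : ℝ)..ℓ t, (Ioo 0 (m s)).indicator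
      (fun x => wt x t * k (x, s) + W (x, t) * ((s - t)⁻¹ * (k (x, s) - k (x, t)))) x) lF
      (𝓝 (∫ x in (0 : ℝ)..ℓ t, (wt x t * k (x, t) + W (x, t) * kt (x, t)))) := by
    apply intervalIntegral.tendsto_integral_filter_of_dominated_convergence
      (fun x => ‖wt x t‖ * C + D * C')
    · refine Eventually.of_forall fun s => AEStronglyMeasurable.indicator ?_ measurableSet_Ioo
      rw [uIoc_of_le (hℓ0 t ht).le]
      refine (hwti.1.aestronglyMeasurable.mul ?_).add ?_
      · exact (by fun_prop : Continuous fun x => k (x, s)).aestronglyMeasurable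
      · exact (by fun_prop : Continuous fun x =>
          W (x, t) * ((s - t)⁻¹ * (k (x, s) - k (x, t)))).aestronglyMeasurable
    · filter_upwards [hmem] with s hs
      refine Eventually.of_forall fun x hx => ?_
      rw [uIoc_of_le (hℓ0 t ht).le] at hx
      have hxM : x ∈ Icc 0 M := ⟨hx.1.le, hx.2.trans (hM t ht)⟩
      refine (norm_indicator_le_norm_self _ _).trans ((norm_add_le _ _).trans ?_)
      rw [norm_mul, norm_mul]
      have hD0 : 0 ≤ D := (norm_nonneg _).trans (hD 0 ⟨le_rfl, hM0.le⟩ t ht)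
      gcongr
      · exact hC x hxM s hs.1
      · exact hD x hxM t ht
      · exact hquot s hs.1 x hxM
    · exact (hwti.norm.mul_const C).add intervalIntegrable_const
    · have hne : ∀ᵐ x : ℝ, x ≠ ℓ t := by simp [ae_iff, measure_singleton]
      filter_upwards [hne] with x hx hx'
      rw [uIoc_of_le (hℓ0 t ht).le] at hx'
      have hxt : x < ℓ t := lt_of_le_of_ne hx'.2 hx
      have hk1 : Tendsto (fun s => k (x, s)) lF (𝓝 (k (x, t))) :=
        ((by fun_prop : Continuous fun s => k (x, s)).tendsto t).mono_left nhdsWithin_le_nhds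
      have hk2 : Tendsto (fun s => (s - t)⁻¹ * (k (x, s) - k (x, t))) lF (𝓝 (kt (x, t))) := by
        have h1 := hasDerivWithinAt_iff_tendsto_slope.1
          ((hkd x t).hasDerivWithinAt (s := Icc 0 T))
        refine h1.congr fun s => ?_
        rw [slope_def_field]; ring
      refine ((hk1.const_mul (wt x t)).add (hk2.const_mul (W (x, t)))).congr' ?_
      filter_upwards [hmt.eventually (lt_mem_nhds hxt)] with s hs
      rw [indicator_of_mem (show x ∈ Ioo 0 (m s) from ⟨hx'.1, hs⟩)]
  have hP3 := tendsto_slope_moving_endpoint (hW.mul hk) hℓd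
  have hval : (∫ x in (0 : ℝ)..ℓ t, (wt x t * k (x, t) + w x t * kt (x, t)))
      = ∫ x in (0 : ℝ)..ℓ t, (wt x t * k (x, t) + W (x, t) * kt (x, t)) := by
    apply intervalIntegral.integral_congr
    intro x hx
    rw [uIcc_of_le (hℓ0 t ht).le] at hx
    simp only [hwW t ht x hx]
  rw [hval, hwW t ht (ℓ t) ⟨(hℓ0 t ht).le, le_rfl⟩, ← zero_add (intervalIntegral _ _ _ _)]
  refine ((hP1.add hP2).add hP3).congr' ?_
  filter_upwards [hmem] with s hs
  have hms := hm0 s hs.1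
  have e1 : ∀ s ∈ Icc 0 T, ∫ x in (0 : ℝ)..ℓ s, w x s * k (x, s)
      = ∫ x in (0 : ℝ)..ℓ s, W (x, s) * k (x, s) := by
    intro s hs
    apply intervalIntegral.integral_congr
    intro x hx
    rw [uIcc_of_le (hℓ0 s hs).le] at hx
    simp only [hwW s hs x hx]
  have hcont : ∀ s, Continuous fun x => W (x, s) * k (x, s) := fun s => by fun_prop
  have hi : ∀ s a b, IntervalIntegrable (fun x => W (x, s) * k (x, s)) volume a b :=
    fun s a b => (hcont s).intervalIntegrable a b
  have e2 : ∫ x in (0 : ℝ)..ℓ t, (Ioo 0 (m s)).indicator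
      (fun x => wt x t * k (x, s) + W (x, t) * ((s - t)⁻¹ * (k (x, s) - k (x, t)))) x
      = ∫ x in (0 : ℝ)..m s,
        (wt x t * k (x, s) + W (x, t) * ((s - t)⁻¹ * (k (x, s) - k (x, t)))) := by
    rw [intervalIntegral.integral_of_le (hℓ0 t ht).le, intervalIntegral.integral_of_le hms.le,
      integral_Ioc_eq_integral_Ioo, integral_Ioc_eq_integral_Ioo,
      setIntegral_indicator measurableSet_Ioo,
      inter_eq_self_of_subset_right (Ioo_subset_Ioo_right (min_le_right _ _))]
  have hwti' : IntervalIntegrable (fun x => wt x t) volume 0 (m s) := by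
    refine hwti.mono_set ?_
    rw [uIcc_of_le hms.le, uIcc_of_le (hℓ0 t ht).le]
    exact Icc_subset_Icc_right (min_le_right _ _)
  have hks : ∀ s, Continuous fun x => k (x, s) := fun s => by fun_prop
  have hqW : ∫ x in (0 : ℝ)..m s, q s x * k (x, s)
      = ∫ x in (0 : ℝ)..m s, ((s - t)⁻¹ * ((W (x, s) - W (x, t)) * k (x, s))
          - wt x t * k (x, s)) := by
    apply intervalIntegral.integral_congr
    intro x hx
    rw [uIcc_of_le hms.le] at hx
    simp only [hq]
    rw [hwW t ht x ⟨hx.1, hx.2.trans (min_le_right _ _)⟩,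
      hwW s hs.1 x ⟨hx.1, hx.2.trans (min_le_left _ _)⟩]
    ring
  have hi1 : IntervalIntegrable (fun x => (s - t)⁻¹ * ((W (x, s) - W (x, t)) * k (x, s)))
      volume 0 (m s) := Continuous.intervalIntegrable (by fun_prop) _ _
  have hi2 : IntervalIntegrable (fun x => wt x t * k (x, s)) volume 0 (m s) :=
    hwti'.mul_continuousOn (hks s).continuousOn
  have hi3 : IntervalIntegrable (fun x => W (x, t) * ((s - t)⁻¹ * (k (x, s) - k (x, t))))
      volume 0 (m s) := Continuous.intervalIntegrable (by fun_prop) _ _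
  have e3 : (∫ x in (0 : ℝ)..m s, q s x * k (x, s)) + (∫ x in (0 : ℝ)..m s,
        (wt x t * k (x, s) + W (x, t) * ((s - t)⁻¹ * (k (x, s) - k (x, t)))))
      = (s - t)⁻¹ * ((∫ x in (0 : ℝ)..m s, W (x, s) * k (x, s))
          - ∫ x in (0 : ℝ)..m s, W (x, t) * k (x, t)) := by
    rw [hqW, ← intervalIntegral.integral_add (hi1.sub hi2) (hi2.add hi3),
      ← intervalIntegral.integral_sub (hi s _ _) (hi t _ _),
      ← intervalIntegral.integral_const_mul]
    congr 1
    ext x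
    ring
  rw [e2, e3, slope_def_field, e1 s hs.1, e1 t ht,
    ← intervalIntegral.integral_add_adjacent_intervals (hi s 0 (m s)) (hi s (m s) (ℓ s)),
    ← intervalIntegral.integral_add_adjacent_intervals (hi t 0 (m s)) (hi t (m s) (ℓ t))]
  simp only [hm, Pi.mul_apply]
  ring

/-! ### The pairing of a finite energy function with a d'Alembert wave -/

/-- `ℓ` is the position of a moving end point on `[0, T]`, with continuous velocity `ℓd` of modulus
less than `1`. The derivative is taken within `[0, ∞)`. -/
structure MovingEnd (ℓ ℓd : ℝ → ℝ) (T : ℝ) : Prop where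
  T_pos : 0 < T
  pos : ∀ t ∈ Icc 0 T, 0 < ℓ t
  hasDeriv : ∀ t ∈ Icc 0 T, HasDerivWithinAt ℓ (ℓd t) (Ici 0) t
  cont : ContinuousOn ℓd (Icc 0 T)
  lt_one : ∀ t ∈ Icc 0 T, |ℓd t| < 1

theorem MovingEnd.continuousOn {ℓ ℓd : ℝ → ℝ} {T : ℝ} (h : MovingEnd ℓ ℓd T) :
    ContinuousOn ℓ (Icc 0 T) :=
  fun t ht => (h.hasDeriv t ht).continuousWithinAt.mono Icc_subset_Ici_self

/-- The class `C([0, T]; V₀(0, ℓ(t))) ∩ C¹([0, T]; L²(0, ℓ(t)))`, with the derivatives `wx`, `wt`. -/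
structure FiniteEnergy (ℓ : ℝ → ℝ) (T : ℝ) (w wx wt : ℝ → ℝ → ℝ) : Prop where
  contV0 : ContV0 ℓ T w wx
  contDiffL2 : ContDiffL2 ℓ T w wt

/-- `∫₀^{ℓ(t)} w ψ_t dx` for the d'Alembert wave `ψ` with profile derivative `h`, that is
`ψ_t(x, t) = h(t + x) - h(t - x)`. -/
noncomputable def waveMoment (ℓ : ℝ → ℝ) (w : ℝ → ℝ → ℝ) (h : ℝ → ℝ) (t : ℝ) : ℝ :=
  ∫ x in (0 : ℝ)..ℓ t, w x t * (h (t + x) - h (t - x))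

/-- `∫₀^{ℓ(t)} (w_t ψ_t - w_x ψ_x) dx` for the d'Alembert wave `ψ` with profile derivative `h`, that
is `ψ_t(x, t) = h(t + x) - h(t - x)` and `ψ_x(x, t) = h(t + x) + h(t - x)`. -/
noncomputable def waveAction (ℓ : ℝ → ℝ) (wx wt : ℝ → ℝ → ℝ) (h : ℝ → ℝ) (t : ℝ) : ℝ :=
  ∫ x in (0 : ℝ)..ℓ t, (wt x t * (h (t + x) - h (t - x)) - wx x t * (h (t + x) + h (t - x)))

/-- `ψ_x + ℓ' ψ_t` at the moving end, for the d'Alembert wave `ψ` with profile derivative `h`. -/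
noncomputable def waveFlux (ℓ ℓd h : ℝ → ℝ) (t : ℝ) : ℝ :=
  (1 + ℓd t) * h (t + ℓ t) + (1 - ℓd t) * h (t - ℓ t)

section

variable {ℓ ℓd : ℝ → ℝ} {T : ℝ} {w wx wt : ℝ → ℝ → ℝ}

theorem ContL2.intervalIntegrable {v : ℝ → ℝ → ℝ} (hv : ContL2 ℓ T v) {t : ℝ} (ht : t ∈ Icc 0 T)
    (h0 : 0 ≤ ℓ t) : IntervalIntegrable (fun x => v x t) volume 0 (ℓ t) := by
  rw [intervalIntegrable_iff_integrableOn_Ioo_of_le h0]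
  exact (hv.1 t ht).integrable (by norm_num)

theorem ContL2.intervalIntegrable_mul {v : ℝ → ℝ → ℝ} (hv : ContL2 ℓ T v) {t : ℝ}
    (ht : t ∈ Icc 0 T) (h0 : 0 ≤ ℓ t) {k : ℝ → ℝ} (hk : Continuous k) :
    IntervalIntegrable (fun x => v x t * k x) volume 0 (ℓ t) :=
  (hv.intervalIntegrable ht h0).mul_continuousOn hk.continuousOn

theorem ContL2.exists_bound {v : ℝ → ℝ → ℝ} (hv : ContL2 ℓ T v) :
    ∃ B, 0 ≤ B ∧ ∀ t ∈ Icc 0 T,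
      (eLpNorm (fun x => v x t) 2 (volume.restrict (Ioo 0 (ℓ t)))).toReal ≤ B := by
  obtain ⟨B, hB⟩ := isCompact_univ.exists_bound_of_continuousOn
    (hv.continuous_curve.continuousOn (s := univ))
  refine ⟨max B 0, le_max_right _ _, fun t ht => le_trans (le_of_eq ?_)
    ((hB ⟨t, ht⟩ (mem_univ _)).trans (le_max_left _ _))⟩
  rw [ContL2.curve, Lp.norm_toLp, eLpNorm_indicator_eq_eLpNorm_restrict measurableSet_Ioo]

theorem MovingEnd.continuousOn_waveMoment (hℓ : MovingEnd ℓ ℓd T) (hw : ContL2 ℓ T w) {h : ℝ → ℝ}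
    (hh : Continuous h) : ContinuousOn (waveMoment ℓ w h) (Icc 0 T) :=
  hw.continuousOn_integral_mul hℓ.continuousOn (fun t ht => (hℓ.pos t ht).le)
    (k := fun p => h (p.2 + p.1) - h (p.2 - p.1)) (by fun_prop)

theorem MovingEnd.waveAction_eq (hℓ : MovingEnd ℓ ℓd T) (hw : FiniteEnergy ℓ T w wx wt)
    {h : ℝ → ℝ} (hh : Continuous h) {t : ℝ} (ht : t ∈ Icc 0 T) :
    waveAction ℓ wx wt h t = (∫ x in (0 : ℝ)..ℓ t, wt x t * (h (t + x) - h (t - x)))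
      - ∫ x in (0 : ℝ)..ℓ t, wx x t * (h (t + x) + h (t - x)) := by
  rw [waveAction, intervalIntegral.integral_sub]
  · exact hw.contDiffL2.2.1.intervalIntegrable_mul ht (hℓ.pos t ht).le (by fun_prop)
  · exact hw.contV0.2.2.intervalIntegrable_mul ht (hℓ.pos t ht).le (by fun_prop)

theorem MovingEnd.continuousOn_waveAction (hℓ : MovingEnd ℓ ℓd T) (hw : FiniteEnergy ℓ T w wx wt)
    {h : ℝ → ℝ} (hh : Continuous h) : ContinuousOn (waveAction ℓ wx wt h) (Icc 0 T) := by
  refine ContinuousOn.congr (ContinuousOn.sub ?_ ?_) fun t ht => hℓ.waveAction_eq hw hh ht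
  · exact hw.contDiffL2.2.1.continuousOn_integral_mul hℓ.continuousOn
      (fun t ht => (hℓ.pos t ht).le) (k := fun p => h (p.2 + p.1) - h (p.2 - p.1)) (by fun_prop)
  · exact hw.contV0.2.2.continuousOn_integral_mul hℓ.continuousOn
      (fun t ht => (hℓ.pos t ht).le) (k := fun p => h (p.2 + p.1) + h (p.2 - p.1)) (by fun_prop)

theorem MovingEnd.continuousOn_trace (hℓ : MovingEnd ℓ ℓd T) (hw : FiniteEnergy ℓ T w wx wt) :
    ContinuousOn (fun t => w (ℓ t) t) (Icc 0 T) := by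
  obtain ⟨W, hW, hwW⟩ := hw.contV0.exists_continuous hℓ.T_pos.le hℓ.continuousOn hℓ.pos
  refine ContinuousOn.congr (f := fun t => W (ℓ t, t))
    (hW.comp_continuousOn (hℓ.continuousOn.prodMk continuousOn_id)) fun t ht => ?_
  exact hwW t ht _ ⟨(hℓ.pos t ht).le, le_rfl⟩

theorem MovingEnd.continuousOn_waveFlux (hℓ : MovingEnd ℓ ℓd T) {h : ℝ → ℝ}
    (hh : Continuous h) : ContinuousOn (waveFlux ℓ ℓd h) (Icc 0 T) := by
  have h1 := hℓ.continuousOn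
  have h2 := hℓ.cont
  unfold waveFlux
  exact ((continuousOn_const.add h2).mul (hh.comp_continuousOn (continuousOn_id.add h1))).add
    ((continuousOn_const.sub h2).mul (hh.comp_continuousOn (continuousOn_id.sub h1)))

/-- The pairing identity in differential form: the Leibniz rule leaves `∫ w ψ_tt dx`, and as
`ψ_tt = ψ_xx`, integration by parts in `x` turns this into `-∫ w_x ψ_x dx` and the boundary term
`w ψ_x` at the moving end. -/
theorem MovingEnd.hasDerivWithinAt_waveMoment (hℓ : MovingEnd ℓ ℓd T)
    (hw : FiniteEnergy ℓ T w wx wt) {h : ℝ → ℝ} (hh : ContDiff ℝ 1 h) {t : ℝ}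
    (ht : t ∈ Icc 0 T) :
    HasDerivWithinAt (waveMoment ℓ w h)
      (waveAction ℓ wx wt h t + w (ℓ t) t * waveFlux ℓ ℓd h t) (Icc 0 T) t := by
  obtain ⟨W, hW, hwW⟩ := hw.contV0.exists_continuous hℓ.T_pos.le hℓ.continuousOn hℓ.pos
  have hhc := hh.continuous
  have hdc : Continuous (deriv h) := hh.continuous_deriv le_rfl
  have hd : ∀ x, HasDerivAt h (deriv h x) x := fun x =>
    (hh.differentiable one_ne_zero x).hasDerivAt
  have key := hasDerivWithinAt_integral_moving (k := fun p => h (p.2 + p.1) - h (p.2 - p.1))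
    (kt := fun p => deriv h (p.2 + p.1) - deriv h (p.2 - p.1)) hℓ.continuousOn hℓ.pos ht
    ((hℓ.hasDeriv t ht).mono Icc_subset_Ici_self) hW hwW hw.contDiffL2 (by fun_prop) (by fun_prop)
    (fun x s => ((hd (s + x)).comp_add_const s x).sub ((hd (s - x)).comp_sub_const s x))
  refine key.congr_deriv ?_
  have hl := hℓ.pos t ht
  have hV0 := hw.contV0.1 t ht
  have hwc : IntervalIntegrable (fun x => w x t * (deriv h (t + x) - deriv h (t - x)))
      volume 0 (ℓ t) :=
    hw.contDiffL2.1.intervalIntegrable_mul ht hl.le (by fun_prop)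
  have hwtc : IntervalIntegrable (fun x => wt x t * (h (t + x) - h (t - x))) volume 0 (ℓ t) :=
    hw.contDiffL2.2.1.intervalIntegrable_mul ht hl.le (by fun_prop)
  have hm : ContDiff ℝ 1 fun x => h (t + x) + h (t - x) :=
    (hh.comp (contDiff_const.add contDiff_id)).add (hh.comp (contDiff_const.sub contDiff_id))
  have hmd : deriv (fun x => h (t + x) + h (t - x)) = fun x => deriv h (t + x) - deriv h (t - x) := by
    funext x
    have h1 := (hd (t + x)).comp x ((hasDerivAt_id x).const_add t)
    have h2 := (hd (t - x)).comp x ((hasDerivAt_id x).const_sub t)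
    have h3 := (h1.add h2).deriv
    simp only [mul_one, mul_neg, ← sub_eq_add_neg] at h3
    exact h3
  have ibp := integral_primitive_mul_deriv (w := fun x => w x t) (hV0.intervalIntegrable hl.le)
    (fun x hx => by
      rw [uIcc_of_le hl.le] at hx
      simp only [hV0.zero, zero_add]
      exact hV0.eq_integral hl x hx) hm
  rw [hmd] at ibp
  rw [intervalIntegral.integral_add hwtc hwc, ibp, hℓ.waveAction_eq hw hhc ht, waveFlux, hV0.zero]
  ring

/-- The pairing identity for a profile of class `C²`. -/
theorem MovingEnd.integral_waveAction_of_contDiff (hℓ : MovingEnd ℓ ℓd T)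
    (hw : FiniteEnergy ℓ T w wx wt) {h : ℝ → ℝ} (hh : ContDiff ℝ 1 h) {τ : ℝ}
    (hτ : τ ∈ Icc 0 T) :
    ∫ t in (0 : ℝ)..τ, (waveAction ℓ wx wt h t + w (ℓ t) t * waveFlux ℓ ℓd h t)
      = waveMoment ℓ w h τ - waveMoment ℓ w h 0 := by
  have hsub : Icc 0 τ ⊆ Icc 0 T := Icc_subset_Icc_right hτ.2
  apply intervalIntegral.integral_eq_sub_of_hasDeriv_right_of_le hτ.1
    ((hℓ.continuousOn_waveMoment hw.contDiffL2.1 hh.continuous).mono hsub)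
  · intro t ht
    have ht' : t ∈ Icc 0 T := hsub (Ioo_subset_Icc_self ht)
    exact ((hℓ.hasDerivWithinAt_waveMoment hw hh ht').hasDerivAt
      (Icc_mem_nhds ht.1 (ht.2.trans_le hτ.2))).hasDerivWithinAt
  · apply ContinuousOn.intervalIntegrable
    rw [uIcc_of_le hτ.1]
    exact ((hℓ.continuousOn_waveAction hw hh.continuous).add ((hℓ.continuousOn_trace hw).mul
      (hℓ.continuousOn_waveFlux hh.continuous))).mono hsub

theorem MovingEnd.waveMoment_sub (hℓ : MovingEnd ℓ ℓd T) (hw : ContL2 ℓ T w) {h g : ℝ → ℝ}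
    (hh : Continuous h) (hg : Continuous g) {t : ℝ} (ht : t ∈ Icc 0 T) :
    waveMoment ℓ w (fun x => h x - g x) t = waveMoment ℓ w h t - waveMoment ℓ w g t := by
  unfold waveMoment
  rw [← intervalIntegral.integral_sub
    (hw.intervalIntegrable_mul ht (hℓ.pos t ht).le (by fun_prop))
    (hw.intervalIntegrable_mul ht (hℓ.pos t ht).le (by fun_prop))]
  congr 1; ext x; ring

theorem MovingEnd.waveAction_sub (hℓ : MovingEnd ℓ ℓd T) (hw : FiniteEnergy ℓ T w wx wt)
    {h g : ℝ → ℝ} (hh : Continuous h) (hg : Continuous g) {t : ℝ} (ht : t ∈ Icc 0 T) :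
    waveAction ℓ wx wt (fun x => h x - g x) t
      = waveAction ℓ wx wt h t - waveAction ℓ wx wt g t := by
  have h1 := hℓ.waveMoment_sub hw.contDiffL2.2.1 hh hg ht
  unfold waveMoment at h1
  have h2 := hw.contV0.2.2.intervalIntegrable_mul ht (hℓ.pos t ht).le
    (by fun_prop : Continuous fun x => h (t + x) + h (t - x))
  have h3 := hw.contV0.2.2.intervalIntegrable_mul ht (hℓ.pos t ht).le
    (by fun_prop : Continuous fun x => g (t + x) + g (t - x))
  have h4 : ∫ x in (0 : ℝ)..ℓ t, wx x t * (h (t + x) - g (t + x) + (h (t - x) - g (t - x)))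
      = (∫ x in (0 : ℝ)..ℓ t, wx x t * (h (t + x) + h (t - x)))
        - ∫ x in (0 : ℝ)..ℓ t, wx x t * (g (t + x) + g (t - x)) := by
    rw [← intervalIntegral.integral_sub h2 h3]
    congr 1; ext x; ring
  rw [hℓ.waveAction_eq hw (by fun_prop) ht, hℓ.waveAction_eq hw hh ht, hℓ.waveAction_eq hw hg ht,
    h1, h4]
  ring

/-- The pairing identity: `d/dt ∫ w ψ_t dx = ∫ (w_t ψ_t - w_x ψ_x) dx + w (ψ_x + ℓ' ψ_t)` at the
moving end, integrated in time. For profiles of class `C¹` only, it follows from the `C²` case by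
uniform approximation of `h` by polynomials. -/
theorem MovingEnd.integral_waveAction (hℓ : MovingEnd ℓ ℓd T)
    (hw : FiniteEnergy ℓ T w wx wt) {h : ℝ → ℝ} (hh : Continuous h) {τ : ℝ}
    (hτ : τ ∈ Icc 0 T) :
    ∫ t in (0 : ℝ)..τ, (waveAction ℓ wx wt h t + w (ℓ t) t * waveFlux ℓ ℓd h t)
      = waveMoment ℓ w h τ - waveMoment ℓ w h 0 := by
  have hsub : Icc 0 τ ⊆ Icc 0 T := Icc_subset_Icc_right hτ.2
  obtain ⟨M, hM0, hM⟩ := exists_bound_Icc hℓ.continuousOn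
  obtain ⟨B0, hB0, hB0'⟩ := hw.contDiffL2.1.exists_bound
  obtain ⟨Bt, hBt, hBt'⟩ := hw.contDiffL2.2.1.exists_bound
  obtain ⟨Bx, hBx, hBx'⟩ := hw.contV0.2.2.exists_bound
  obtain ⟨D, hD⟩ := isCompact_Icc.exists_bound_of_continuousOn (hℓ.continuousOn_trace hw)
  have h0T : (0 : ℝ) ∈ Icc 0 T := ⟨le_rfl, hℓ.T_pos.le⟩
  have hD0 : 0 ≤ D := (norm_nonneg _).trans (hD 0 h0T)
  set K : ℝ := (2 * (Real.sqrt M * Bt) + 2 * (Real.sqrt M * Bx) + D * 2) * τ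
    + 2 * (2 * (Real.sqrt M * B0)) with hK
  have hK0 : 0 ≤ K := by have := hτ.1; positivity
  -- the defect `J` of the identity is linear, vanishes on polynomials, and is bounded by a multiple
  -- of the supremum of the profile over the characteristics that meet the domain
  set J : (ℝ → ℝ) → ℝ := fun h =>
    (∫ t in (0 : ℝ)..τ, (waveAction ℓ wx wt h t + w (ℓ t) t * waveFlux ℓ ℓd h t))
      - (waveMoment ℓ w h τ - waveMoment ℓ w h 0) with hJ
  have hcont : ∀ h : ℝ → ℝ, Continuous h → IntervalIntegrable
      (fun t => waveAction ℓ wx wt h t + w (ℓ t) t * waveFlux ℓ ℓd h t) volume 0 τ := by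
    intro h hh
    apply ContinuousOn.intervalIntegrable
    rw [uIcc_of_le hτ.1]
    exact ((hℓ.continuousOn_waveAction hw hh).add ((hℓ.continuousOn_trace hw).mul
      (hℓ.continuousOn_waveFlux hh))).mono hsub
  have hJsub : ∀ h g : ℝ → ℝ, Continuous h → Continuous g →
      J (fun x => h x - g x) = J h - J g := by
    intro h g hh hg
    have h1 : ∫ t in (0 : ℝ)..τ, (waveAction ℓ wx wt (fun x => h x - g x) t
          + w (ℓ t) t * waveFlux ℓ ℓd (fun x => h x - g x) t)
        = (∫ t in (0 : ℝ)..τ, (waveAction ℓ wx wt h t + w (ℓ t) t * waveFlux ℓ ℓd h t))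
          - ∫ t in (0 : ℝ)..τ, (waveAction ℓ wx wt g t + w (ℓ t) t * waveFlux ℓ ℓd g t) := by
      rw [← intervalIntegral.integral_sub (hcont h hh) (hcont g hg)]
      apply intervalIntegral.integral_congr
      intro t ht
      rw [uIcc_of_le hτ.1] at ht
      simp only [hℓ.waveAction_sub hw hh hg (hsub ht), waveFlux]
      ring
    simp only [hJ]
    rw [h1, hℓ.waveMoment_sub hw.contDiffL2.1 hh hg hτ,
      hℓ.waveMoment_sub hw.contDiffL2.1 hh hg h0T]
    ring
  have hJbd : ∀ δ : ℝ → ℝ, Continuous δ → ∀ ε : ℝ, 0 ≤ ε →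
      (∀ x ∈ Icc (-M) (T + M), |δ x| ≤ ε) → |J δ| ≤ K * ε := by
    intro δ hδ ε hε hδε
    have hr : ∀ t ∈ Icc 0 T, ∀ x ∈ Icc 0 (ℓ t), |δ (t + x)| ≤ ε ∧ |δ (t - x)| ≤ ε := by
      intro t ht x hx
      have := hM t ht
      exact ⟨hδε _ ⟨by linarith [ht.1, hx.1], by linarith [ht.2, hx.2]⟩,
        hδε _ ⟨by linarith [ht.1, hx.2], by linarith [ht.2, hx.1]⟩⟩
    have hpair : ∀ v : ℝ → ℝ → ℝ, ContL2 ℓ T v → ∀ B, 0 ≤ B → (∀ t ∈ Icc 0 T,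
        (eLpNorm (fun x => v x t) 2 (volume.restrict (Ioo 0 (ℓ t)))).toReal ≤ B) →
        ∀ t ∈ Icc 0 T, ∀ k : ℝ → ℝ, (∀ x ∈ Icc 0 (ℓ t), |k x| ≤ 2 * ε) →
        |∫ x in (0 : ℝ)..ℓ t, v x t * k x| ≤ 2 * ε * (Real.sqrt M * B) := by
      intro v hv B hB hvB t ht k hk
      refine (abs_integral_mul_le_eLpNorm (hℓ.pos t ht).le (hv.1 t ht)
        (fun x hx => hk x (Ioo_subset_Icc_self hx))).trans ?_
      gcongr
      · exact hM t ht
      · exact hvB t ht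
    have hm : ∀ t ∈ Icc 0 T, |waveMoment ℓ w δ t| ≤ 2 * ε * (Real.sqrt M * B0) := fun t ht =>
      hpair w hw.contDiffL2.1 B0 hB0 hB0' t ht _ fun x hx => by
        have := hr t ht x hx
        linarith [abs_sub (δ (t + x)) (δ (t - x))]
    have hi : ∀ t ∈ uIoc 0 τ, ‖waveAction ℓ wx wt δ t + w (ℓ t) t * waveFlux ℓ ℓd δ t‖
        ≤ (2 * (Real.sqrt M * Bt) + 2 * (Real.sqrt M * Bx) + D * 2) * ε := by
      intro t ht
      rw [uIoc_of_le hτ.1] at ht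
      have ht' : t ∈ Icc 0 T := hsub (Ioc_subset_Icc_self ht)
      have h1 := hpair wt hw.contDiffL2.2.1 Bt hBt hBt' t ht'
        (fun x => δ (t + x) - δ (t - x)) fun x hx => by
          have := hr t ht' x hx
          linarith [abs_sub (δ (t + x)) (δ (t - x))]
      have h2 := hpair wx hw.contV0.2.2 Bx hBx hBx' t ht'
        (fun x => δ (t + x) + δ (t - x)) fun x hx => by
          have := hr t ht' x hx
          linarith [abs_add_le (δ (t + x)) (δ (t - x))]
      have h3 : |waveFlux ℓ ℓd δ t| ≤ 2 * ε := by
        obtain ⟨h4, h5⟩ := hr t ht' (ℓ t) ⟨(hℓ.pos t ht').le, le_rfl⟩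
        have h6 := abs_lt.1 (hℓ.lt_one t ht')
        unfold waveFlux
        refine (abs_add_le _ _).trans ?_
        rw [abs_mul, abs_mul, abs_of_pos (by linarith : 0 < 1 + ℓd t),
          abs_of_pos (by linarith : 0 < 1 - ℓd t)]
        have h7 : (1 + ℓd t) * |δ (t + ℓ t)| ≤ (1 + ℓd t) * ε :=
          mul_le_mul_of_nonneg_left h4 (by linarith)
        have h8 : (1 - ℓd t) * |δ (t - ℓ t)| ≤ (1 - ℓd t) * ε :=
          mul_le_mul_of_nonneg_left h5 (by linarith)
        linarith
      have h9 : |w (ℓ t) t * waveFlux ℓ ℓd δ t| ≤ D * (2 * ε) := by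
        rw [abs_mul]
        exact mul_le_mul (hD t ht') h3 (abs_nonneg _) hD0
      rw [hℓ.waveAction_eq hw hδ ht', Real.norm_eq_abs]
      refine (abs_add_le _ _).trans ?_
      linarith [abs_sub (∫ x in (0 : ℝ)..ℓ t, wt x t * (δ (t + x) - δ (t - x)))
        (∫ x in (0 : ℝ)..ℓ t, wx x t * (δ (t + x) + δ (t - x)))]
    have hI := intervalIntegral.norm_integral_le_of_norm_le_const hi
    rw [sub_zero, abs_of_nonneg hτ.1, Real.norm_eq_abs] at hI
    simp only [hJ]
    have h1 := abs_sub (∫ t in (0 : ℝ)..τ,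
      (waveAction ℓ wx wt δ t + w (ℓ t) t * waveFlux ℓ ℓd δ t))
      (waveMoment ℓ w δ τ - waveMoment ℓ w δ 0)
    have h2 := abs_sub (waveMoment ℓ w δ τ) (waveMoment ℓ w δ 0)
    have h3 := hm τ hτ
    have h4 := hm 0 h0T
    rw [hK]
    nlinarith
  have hJ0 : J h = 0 := by
    rw [← abs_nonpos_iff]
    apply le_of_forall_pos_le_add
    intro ε hε
    obtain ⟨P, hP⟩ := exists_polynomial_near_of_continuousOn (-M) (T + M) h hh.continuousOn
      (ε / (K + 1)) (by positivity)
    have hPc : ContDiff ℝ 1 fun x => P.eval x := by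
      simpa [Polynomial.coe_aeval_eq_eval] using P.contDiff_aeval (𝕜 := ℝ) 1
    have h1 : J (fun x => P.eval x) = 0 := by
      simp only [hJ]
      rw [hℓ.integral_waveAction_of_contDiff hw hPc hτ, sub_self]
    have h2 := hJbd (fun x => h x - P.eval x) (hh.sub hPc.continuous) (ε / (K + 1)) (by positivity)
      fun x hx => by rw [abs_sub_comm]; exact (hP x hx).le
    rw [hJsub _ _ hh hPc.continuous, h1, sub_zero] at h2
    rw [zero_add]
    refine h2.trans ?_
    rw [← mul_div_assoc, div_le_iff₀ (by positivity)]
    nlinarith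
  simp only [hJ] at hJ0
  linarith

end

/-! ### Uniqueness by duality -/

section

variable {ℓ ℓd : ℝ → ℝ} {T : ℝ} {w wx wt : ℝ → ℝ → ℝ}

theorem MovingEnd.hasDerivAt_of_mem_Ioc (hℓ : MovingEnd ℓ ℓd T) {t : ℝ} (ht : t ∈ Ioc 0 T) :
    HasDerivAt ℓ (ℓd t) t :=
  (hℓ.hasDeriv t (Ioc_subset_Icc_self ht)).hasDerivAt (Ici_mem_nhds ht.1)

theorem MovingEnd.hasDerivAt_comp_add (hℓ : MovingEnd ℓ ℓd T) {g : ℝ → ℝ} (hg : ContDiff ℝ 1 g)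
    {t : ℝ} (ht : t ∈ Ioc 0 T) :
    HasDerivAt (fun s => g (s + ℓ s)) ((1 + ℓd t) * deriv g (t + ℓ t)) t := by
  have h1 := ((hg.differentiable one_ne_zero (t + ℓ t)).hasDerivAt).comp t
    ((hasDerivAt_id t).add (hℓ.hasDerivAt_of_mem_Ioc ht))
  exact h1.congr_deriv (by ring)

theorem MovingEnd.hasDerivAt_comp_sub (hℓ : MovingEnd ℓ ℓd T) {g : ℝ → ℝ} (hg : ContDiff ℝ 1 g)
    {t : ℝ} (ht : t ∈ Ioc 0 T) :
    HasDerivAt (fun s => g (s - ℓ s)) ((1 - ℓd t) * deriv g (t - ℓ t)) t := by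
  have h1 := ((hg.differentiable one_ne_zero (t - ℓ t)).hasDerivAt).comp t
    ((hasDerivAt_id t).sub (hℓ.hasDerivAt_of_mem_Ioc ht))
  exact h1.congr_deriv (by ring)

/-- `∫₀^{ℓ(t)} w_t ψ dx + η w(ℓ(t), t) ψ(ℓ(t), t)` for the d'Alembert wave
`ψ(x, t) = g(t + x) - g(t - x)`. -/
noncomputable def dualMomentum (ℓ : ℝ → ℝ) (η : ℝ) (w wt : ℝ → ℝ → ℝ) (g : ℝ → ℝ) (t : ℝ) : ℝ :=
  waveMoment ℓ wt g t + η * w (ℓ t) t * (g (t + ℓ t) - g (t - ℓ t))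

/-- Conservation law of a weak solution `w` against a d'Alembert wave `ψ` with profile `g` that
satisfies the adjoint boundary condition: `∫ (w_t ψ - w ψ_t) dx + η w ψ` at the moving end does not
depend on time. The weak equation is tested with `χ(t) ψ(x, t)`. -/
theorem MovingEnd.dualMomentum_sub_waveMoment_eq (hℓ : MovingEnd ℓ ℓd T) {η : ℝ}
    (hw : FiniteEnergy ℓ T w wx wt) (hweak : WeakWaveEq ℓ η T w wx wt) {g : ℝ → ℝ}
    (hg : ContDiff ℝ 1 g)
    (hdual : ∀ t ∈ Icc 0 T, (1 - η) * g (t + ℓ t) + (1 + η) * g (t - ℓ t) = 0)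
    {τ : ℝ} (hτ : τ ∈ Icc 0 T) :
    dualMomentum ℓ η w wt g τ - waveMoment ℓ w (deriv g) τ
      = dualMomentum ℓ η w wt g 0 - waveMoment ℓ w (deriv g) 0 := by
  have hgc := hg.continuous
  have hhc : Continuous (deriv g) := hg.continuous_deriv le_rfl
  set R : ℝ → ℝ := fun t => waveAction ℓ wx wt (deriv g) t + w (ℓ t) t * waveFlux ℓ ℓd (deriv g) t
    with hR
  have hRc : ContinuousOn R (Icc 0 T) :=
    (hℓ.continuousOn_waveAction hw hhc).add ((hℓ.continuousOn_trace hw).mul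
      (hℓ.continuousOn_waveFlux hhc))
  have hAc : ContinuousOn (waveMoment ℓ w (deriv g)) (Icc 0 T) :=
    hℓ.continuousOn_waveMoment hw.contDiffL2.1 hhc
  have hNc : ContinuousOn (dualMomentum ℓ η w wt g) (Icc 0 T) :=
    (hℓ.continuousOn_waveMoment hw.contDiffL2.2.1 hgc).add
      ((continuousOn_const.mul (hℓ.continuousOn_trace hw)).mul
        ((hgc.comp_continuousOn (continuousOn_id.add hℓ.continuousOn)).sub
          (hgc.comp_continuousOn (continuousOn_id.sub hℓ.continuousOn))))
  -- the adjoint condition, differentiated in time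
  have hflux : ∀ t ∈ Ioo 0 T, waveFlux ℓ ℓd (deriv g) t
      = η * ((1 + ℓd t) * deriv g (t + ℓ t) - (1 - ℓd t) * deriv g (t - ℓ t)) := by
    intro t ht
    have h1 := ((hℓ.hasDerivAt_comp_add hg (Ioo_subset_Ioc_self ht)).const_mul (1 - η)).add
      ((hℓ.hasDerivAt_comp_sub hg (Ioo_subset_Ioc_self ht)).const_mul (1 + η))
    have h2 : HasDerivAt (fun s => (1 - η) * g (s + ℓ s) + (1 + η) * g (s - ℓ s)) 0 t := by
      refine (hasDerivAt_const t (0 : ℝ)).congr_of_eventuallyEq ?_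
      filter_upwards [Ioo_mem_nhds ht.1 ht.2] with s hs
      exact hdual s (Ioo_subset_Icc_self hs)
    have h3 := h1.unique h2
    unfold waveFlux
    linarith
  have hconst := eq_of_integral_mul_deriv_eq_zero hℓ.T_pos (hNc.sub hAc) ?_
  · exact hconst τ hτ
  intro χ hχ hχc hχs
  have hχ1 : ContDiff ℝ 1 χ := hχ.of_le (by norm_cast)
  have hχd : Continuous (deriv χ) := hχ1.continuous_deriv le_rfl
  have hχ0 : χ 0 = 0 := image_eq_zero_of_notMem_tsupport fun h' => (hχs h').1.false
  have hχT : χ T = 0 := image_eq_zero_of_notMem_tsupport fun h' => (hχs h').2.false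
  have hweak' := hweak (fun p => χ p.2 * (g (p.2 + p.1) - g (p.2 - p.1)))
    ((hχ1.comp contDiff_snd).mul ((hg.comp (contDiff_snd.add contDiff_fst)).sub
      (hg.comp (contDiff_snd.sub contDiff_fst))))
    (fun t _ => by simp) (fun x _ => by simp [hχ0]) (fun x _ => by simp [hχT])
  have hd : ∀ x, HasDerivAt g (deriv g x) x := fun x =>
    (hg.differentiable one_ne_zero x).hasDerivAt
  have hχd' : ∀ x, HasDerivAt χ (deriv χ x) x := fun x =>
    (hχ1.differentiable one_ne_zero x).hasDerivAt
  -- the weak equation: by the adjoint condition the boundary terms without `χ'` combine to the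
  -- flux term of the pairing identity
  have hform : ∫ t in (0 : ℝ)..T, (dualMomentum ℓ η w wt g t * deriv χ t + R t * χ t) = 0 := by
    refine Eq.trans (intervalIntegral.integral_congr_ae ?_) hweak'
    have hne : ∀ᵐ x : ℝ, x ≠ T := by simp [ae_iff, measure_singleton]
    filter_upwards [hne] with t htT ht
    rw [uIoc_of_le hℓ.T_pos.le] at ht
    have ht' : t ∈ Icc 0 T := Ioc_subset_Icc_self ht
    have ht'' : t ∈ Ioo 0 T := ⟨ht.1, lt_of_le_of_ne ht.2 htT⟩
    have hl := hℓ.pos t ht'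
    have e1 : ∀ x, deriv (fun s => χ s * (g (s + x) - g (s - x))) t
        = deriv χ t * (g (t + x) - g (t - x)) + χ t * (deriv g (t + x) - deriv g (t - x)) :=
      fun x => ((hχd' t).mul (((hd (t + x)).comp_add_const t x).sub
        ((hd (t - x)).comp_sub_const t x))).deriv
    have e2 : ∀ x, deriv (fun y => χ t * (g (t + y) - g (t - y))) x
        = χ t * (deriv g (t + x) + deriv g (t - x)) := fun x => by
      have := (((hd (t + x)).comp_const_add t x).sub ((hd (t - x)).comp_const_sub t x)).const_mul
        (χ t)
      rw [sub_neg_eq_add] at this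
      exact this.deriv
    have e3 : deriv (fun s => χ s * (g (s + ℓ s) - g (s - ℓ s))) t
        = deriv χ t * (g (t + ℓ t) - g (t - ℓ t)) + χ t * ((1 + ℓd t) * deriv g (t + ℓ t)
          - (1 - ℓd t) * deriv g (t - ℓ t)) :=
      ((hχd' t).mul ((hℓ.hasDerivAt_comp_add hg ht).sub (hℓ.hasDerivAt_comp_sub hg ht))).deriv
    have e4 : (∫ x in (0 : ℝ)..ℓ t, (wt x t * (deriv χ t * (g (t + x) - g (t - x))
          + χ t * (deriv g (t + x) - deriv g (t - x)))
          - wx x t * (χ t * (deriv g (t + x) + deriv g (t - x)))))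
        = deriv χ t * waveMoment ℓ wt g t + χ t * waveAction ℓ wx wt (deriv g) t := by
      rw [hℓ.waveAction_eq hw hhc ht', waveMoment, mul_sub,
        ← intervalIntegral.integral_const_mul, ← intervalIntegral.integral_const_mul,
        ← intervalIntegral.integral_const_mul, ← add_sub_assoc, ← intervalIntegral.integral_add,
        ← intervalIntegral.integral_sub]
      · congr 1; ext x; ring
      · exact ((hw.contDiffL2.2.1.intervalIntegrable_mul ht' hl.le (by fun_prop)).const_mul _).add
          ((hw.contDiffL2.2.1.intervalIntegrable_mul ht' hl.le (by fun_prop)).const_mul _)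
      · exact (hw.contV0.2.2.intervalIntegrable_mul ht' hl.le (by fun_prop)).const_mul _
      · exact (hw.contDiffL2.2.1.intervalIntegrable_mul ht' hl.le (by fun_prop)).const_mul _
      · exact (hw.contDiffL2.2.1.intervalIntegrable_mul ht' hl.le (by fun_prop)).const_mul _
    simp only [e1, e2]
    rw [e3, e4, hR]
    simp only
    rw [hflux t ht'', dualMomentum]
    ring
  have hRi : IntervalIntegrable R volume 0 T := by
    apply ContinuousOn.intervalIntegrable
    rwa [uIcc_of_le hℓ.T_pos.le]
  -- by the pairing identity, `R` is the derivative of `∫ w ψ_t dx`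
  have ibp := integral_primitive_mul_deriv (w := waveMoment ℓ w (deriv g)) hRi
    (fun t ht => by
      rw [uIcc_of_le hℓ.T_pos.le] at ht
      rw [hR, hℓ.integral_waveAction hw hhc ht]; ring) hχ1
  rw [hχ0, hχT] at ibp
  have hi1 : IntervalIntegrable (fun t => dualMomentum ℓ η w wt g t * deriv χ t) volume 0 T := by
    apply ContinuousOn.intervalIntegrable
    rw [uIcc_of_le hℓ.T_pos.le]
    exact hNc.mul hχd.continuousOn
  have hi2 : IntervalIntegrable (fun t => waveMoment ℓ w (deriv g) t * deriv χ t) volume 0 T := by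
    apply ContinuousOn.intervalIntegrable
    rw [uIcc_of_le hℓ.T_pos.le]
    exact hAc.mul hχd.continuousOn
  have hi3 : IntervalIntegrable (fun t => R t * χ t) volume 0 T :=
    hRi.mul_continuousOn hχ1.continuous.continuousOn
  rw [intervalIntegral.integral_add hi1 hi3] at hform
  rw [← integral_Ioc_eq_integral_Ioo, ← intervalIntegral.integral_of_le hℓ.T_pos.le]
  have : ∫ t in (0 : ℝ)..T, (dualMomentum ℓ η w wt g - waveMoment ℓ w (deriv g)) t * deriv χ t
      = (∫ t in (0 : ℝ)..T, dualMomentum ℓ η w wt g t * deriv χ t)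
        - ∫ t in (0 : ℝ)..T, waveMoment ℓ w (deriv g) t * deriv χ t := by
    rw [← intervalIntegral.integral_sub hi1 hi2]
    congr 1; ext t; simp only [Pi.sub_apply]; ring
  rw [this, ibp]
  linarith

end

/-- A `C¹` diffeomorphism `Φ` of the line, with inverse `Ψ`, that straightens the moving end:
`Φ(t + ℓ(t)) = Φ(t - ℓ(t)) + 2` for `t ∈ [0, T]`. -/
structure StraighteningPhase (ℓ Φ Ψ : ℝ → ℝ) (T : ℝ) : Prop where
  contDiff : ContDiff ℝ 1 Φ
  deriv_pos : ∀ x, 0 < deriv Φ x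
  left_inv : ∀ x, Ψ (Φ x) = x
  right_inv : ∀ s, Φ (Ψ s) = s
  contDiff_inv : ContDiff ℝ 1 Ψ
  moore : ∀ t ∈ Icc 0 T, Φ (t + ℓ t) = Φ (t - ℓ t) + 2

theorem StraighteningPhase.strictMono {ℓ Φ Ψ : ℝ → ℝ} {T : ℝ} (h : StraighteningPhase ℓ Φ Ψ T) :
    StrictMono Φ := strictMono_of_deriv_pos h.deriv_pos

/-- The quasi-periodic profile with `G(s + 2) = q G(s)` that equals a given bump on one period,
built as a finite sum of translates; it suffices on a bounded range. -/
theorem exists_quasiPeriodic_extension {κ : ℝ → ℝ} (hκ : ContDiff ℝ 1 κ) {c : ℝ}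
    (hκs : ∀ s, s ∉ Ioo c (c + 2) → κ s = 0) {q : ℝ} (hq : q ≠ 0) (B : ℝ) :
    ∃ G : ℝ → ℝ, ContDiff ℝ 1 G ∧ (∀ s, |s - c| ≤ B → G (s + 2) = q * G s) ∧
      ∀ s ∈ Icc c (c + 2), G s = κ s := by
  obtain ⟨N, hN⟩ := exists_nat_ge B
  set b : ℝ → ℕ → ℝ := fun s j => q ^ ((j : ℤ) - N) * κ (s - 2 * ((j : ℝ) - N)) with hb
  refine ⟨fun s => ∑ j ∈ Finset.range (2 * N + 1), b s j, ?_, fun s hs => ?_, fun s hs => ?_⟩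
  · apply ContDiff.sum
    intro j _
    exact contDiff_const.mul (hκ.comp (contDiff_id.sub contDiff_const))
  · rw [abs_le] at hs
    have h1 : ∀ j, b (s + 2) (j + 1) = q * b s j := by
      intro j
      simp only [hb]
      rw [show ((j + 1 : ℕ) : ℤ) - N = ((j : ℤ) - N) + 1 by push_cast; ring, zpow_add_one₀ hq]
      rw [show s + 2 - 2 * (((j + 1 : ℕ) : ℝ) - N) = s - 2 * ((j : ℝ) - N) by push_cast; ring]
      ring
    have h2 : b (s + 2) 0 = 0 := by
      simp only [hb]
      rw [hκs, mul_zero]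
      intro h
      have h3 := h.2
      push_cast at h3
      have : (0 : ℝ) ≤ N := Nat.cast_nonneg N
      linarith
    have h3 : b s (2 * N) = 0 := by
      simp only [hb]
      rw [hκs, mul_zero]
      intro h
      have h3 := h.1
      push_cast at h3
      have : (0 : ℝ) ≤ N := Nat.cast_nonneg N
      linarith
    simp only
    rw [Finset.sum_range_succ', h2, add_zero, Finset.sum_range_succ, h3, add_zero, Finset.mul_sum]
    exact Finset.sum_congr rfl fun j _ => h1 j
  · simp only
    rw [Finset.sum_eq_single N]
    · simp [hb]
    · intro j _ hj
      simp only [hb]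
      rw [hκs, mul_zero]
      intro h
      have h4 : (j : ℝ) - N < 1 := by linarith [h.1, hs.2]
      have h5 : (-1 : ℝ) < (j : ℝ) - N := by linarith [h.2, hs.1]
      have h6 : (j : ℤ) - N < 1 := by exact_mod_cast h4
      have h7 : (-1 : ℤ) < (j : ℤ) - N := by exact_mod_cast h5
      omega
    · intro h
      exact absurd (Finset.mem_range.2 (by omega)) h

/-- Solvability of the adjoint problem: there is a d'Alembert wave with the adjoint boundary
condition whose profile is prescribed, and even about `τ`, on the period around `τ`. -/
theorem StraighteningPhase.exists_dual_profile {ℓ ℓd Φ Ψ : ℝ → ℝ} {T η : ℝ}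
    (hΦ : StraighteningPhase ℓ Φ Ψ T) (hℓ : MovingEnd ℓ ℓd T) (hη : 0 ≤ η) (hη1 : η ≠ 1)
    {τ : ℝ} (hτ : τ ∈ Icc 0 T) {θ : ℝ → ℝ} (hθ : ContDiff ℝ 1 θ) (hθs : tsupport θ ⊆ Ioo 0 (ℓ τ)) :
    ∃ g : ℝ → ℝ, ContDiff ℝ 1 g ∧
      (∀ t ∈ Icc 0 T, (1 - η) * g (t + ℓ t) + (1 + η) * g (t - ℓ t) = 0) ∧
      ∀ x ∈ Icc (-ℓ τ) (ℓ τ), g (τ + x) = θ x + θ (-x) := by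
  have hη1' : 1 - η ≠ 0 := sub_ne_zero.2 hη1.symm
  have hθ0 : ∀ x, x ∉ Ioo 0 (ℓ τ) → θ x = 0 := fun x hx =>
    image_eq_zero_of_notMem_tsupport fun h => hx (hθs h)
  set c := Φ (τ - ℓ τ) with hc
  have hc2 : Φ (τ + ℓ τ) = c + 2 := hΦ.moore τ hτ
  have hbd : ContinuousOn (fun t => Φ (t - ℓ t) - c) (Icc 0 T) :=
    (hΦ.contDiff.continuous.comp_continuousOn (continuousOn_id.sub hℓ.continuousOn)).sub
      continuousOn_const
  obtain ⟨B, hB⟩ := isCompact_Icc.exists_bound_of_continuousOn hbd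
  obtain ⟨G, hG, hGq, hGκ⟩ := exists_quasiPeriodic_extension
    (κ := fun s => θ (Ψ s - τ) + θ (-(Ψ s - τ))) (c := c) (q := -((1 + η) / (1 - η)))
    ((hθ.comp (hΦ.contDiff_inv.sub contDiff_const)).add
      (hθ.comp (hΦ.contDiff_inv.sub contDiff_const).neg))
    (fun s hs => by
      have : ∀ y, |y| = |Ψ s - τ| → θ y = 0 := by
        intro y hy
        apply hθ0
        intro hy'
        apply hs
        rw [abs_of_pos hy'.1] at hy
        have h1 : |Ψ s - τ| < ℓ τ := hy ▸ hy'.2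
        rw [abs_lt] at h1
        constructor
        · rw [hc, ← hΦ.right_inv s]
          exact hΦ.strictMono (by linarith)
        · rw [← hc2, ← hΦ.right_inv s]
          exact hΦ.strictMono (by linarith)
      rw [this _ rfl, this _ (abs_neg _), add_zero])
    (neg_ne_zero.2 (div_ne_zero (by linarith) hη1')) B
  refine ⟨G ∘ Φ, hG.comp hΦ.contDiff, fun t ht => ?_, fun x hx => ?_⟩
  · simp only [Function.comp]
    rw [hΦ.moore t ht, hGq _ (hB t ht)]
    field_simp
    ring
  · simp only [Function.comp]
    rw [hGκ, hΦ.left_inv, add_sub_cancel_left]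
    rw [← hc2]
    exact ⟨hΦ.strictMono.monotone (by linarith [hx.1]), hΦ.strictMono.monotone (by linarith [hx.2])⟩

/-- Two solutions with the same initial data coincide. -/
theorem IsSolutionWP.eqOn {ℓ ℓd Φ Ψ : ℝ → ℝ} {T η : ℝ} (hΦ : StraighteningPhase ℓ Φ Ψ T)
    (hℓ : MovingEnd ℓ ℓd T) (hη : 0 ≤ η) (hη1 : η ≠ 1) {u0 u1 : ℝ → ℝ} {u v : ℝ → ℝ → ℝ}
    (hu : IsSolutionWP ℓ η T u0 u1 u) (hv : IsSolutionWP ℓ η T u0 u1 v) {τ : ℝ}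
    (hτ : τ ∈ Icc 0 T) : ∀ x ∈ Icc 0 (ℓ τ), v x τ = u x τ := by
  have h0T : (0 : ℝ) ∈ Icc 0 T := ⟨le_rfl, hℓ.T_pos.le⟩
  have hl := hℓ.pos τ hτ
  have hl0 := hℓ.pos 0 h0T
  -- the integrals of a solution against derivatives of test functions depend only on the data
  have key : ∀ w : ℝ → ℝ → ℝ, IsSolutionWP ℓ η T u0 u1 w → ∀ (θ g : ℝ → ℝ), ContDiff ℝ 1 θ →
      tsupport θ ⊆ Ioo 0 (ℓ τ) → ContDiff ℝ 1 g →
      (∀ t ∈ Icc 0 T, (1 - η) * g (t + ℓ t) + (1 + η) * g (t - ℓ t) = 0) →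
      (∀ x ∈ Icc (-ℓ τ) (ℓ τ), g (τ + x) = θ x + θ (-x)) →
      -(2 * ∫ x in (0 : ℝ)..ℓ τ, w x τ * deriv θ x)
        = waveMoment ℓ (fun x _ => u1 x) g 0 + η * u0 (ℓ 0) * (g (0 + ℓ 0) - g (0 - ℓ 0))
          - waveMoment ℓ (fun x _ => u0 x) (deriv g) 0 := by
    rintro w ⟨wx, wt, hV0, hL2, hweak, hi0, hi1⟩ θ g hθ hθs hg hgd hgθ
    have hcons := hℓ.dualMomentum_sub_waveMoment_eq ⟨hV0, hL2⟩ hweak hg hgd hτ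
    -- the profile is even about `τ`, so the d'Alembert wave vanishes at time `τ`
    have hsym : ∀ x ∈ Icc 0 (ℓ τ), g (τ + x) - g (τ - x) = 0 := by
      intro x hx
      rw [hgθ x ⟨by linarith [hx.1], hx.2⟩, sub_eq_add_neg τ x,
        hgθ (-x) ⟨by linarith [hx.2], by linarith [hx.1]⟩, neg_neg]
      ring
    have e1 : dualMomentum ℓ η w wt g τ = 0 := by
      rw [dualMomentum, hsym (ℓ τ) ⟨hl.le, le_rfl⟩, waveMoment, mul_zero, add_zero]
      apply intervalIntegral.integral_zero_ae
      refine Eventually.of_forall fun x hx => ?_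
      rw [uIoc_of_le hl.le] at hx
      rw [hsym x (Ioc_subset_Icc_self hx), mul_zero]
    have hgder : ∀ y ∈ Ioo (-ℓ τ) (ℓ τ), deriv g (τ + y) = deriv θ y - deriv θ (-y) := by
      intro y hy
      have h1 : HasDerivAt (fun y => g (τ + y)) (deriv g (τ + y)) y :=
        ((hg.differentiable one_ne_zero (τ + y)).hasDerivAt).comp_const_add τ y
      have h2 : HasDerivAt (fun y => θ y + θ (-y)) (deriv θ y - deriv θ (-y)) y := by
        have h3 := ((hθ.differentiable one_ne_zero (-y)).hasDerivAt).comp y (hasDerivAt_neg y)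
        have h4 := ((hθ.differentiable one_ne_zero y).hasDerivAt).add h3
        exact h4.congr_deriv (by ring)
      refine h1.unique (h2.congr_of_eventuallyEq ?_)
      filter_upwards [Ioo_mem_nhds hy.1 hy.2] with z hz
      exact hgθ z (Ioo_subset_Icc_self hz)
    -- its velocity there is `2 θ'`
    have e2 : waveMoment ℓ w (deriv g) τ = 2 * ∫ x in (0 : ℝ)..ℓ τ, w x τ * deriv θ x := by
      rw [waveMoment, ← intervalIntegral.integral_const_mul]
      apply intervalIntegral.integral_congr_ae
      have hne : ∀ᵐ x : ℝ, x ≠ ℓ τ := by simp [ae_iff, measure_singleton]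
      filter_upwards [hne] with x hx hx'
      rw [uIoc_of_le hl.le] at hx'
      have hxl : x < ℓ τ := lt_of_le_of_ne hx'.2 hx
      have hθneg : deriv θ (-x) = 0 := by
        apply image_eq_zero_of_notMem_tsupport
        intro h
        have := (hθs (tsupport_deriv_subset h)).1
        linarith [hx'.1]
      rw [hgder x ⟨by linarith [hx'.1], hxl⟩, sub_eq_add_neg τ x,
        hgder (-x) ⟨by linarith, by linarith [hx'.1]⟩, neg_neg, hθneg]
      ring
    have e3 : dualMomentum ℓ η w wt g 0 = waveMoment ℓ (fun x _ => u1 x) g 0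
        + η * u0 (ℓ 0) * (g (0 + ℓ 0) - g (0 - ℓ 0)) := by
      rw [dualMomentum, hi0 (ℓ 0) ⟨hl0.le, le_rfl⟩, waveMoment, waveMoment]
      congr 1
      rw [intervalIntegral.integral_of_le hl0.le, intervalIntegral.integral_of_le hl0.le,
        integral_Ioc_eq_integral_Ioo, integral_Ioc_eq_integral_Ioo]
      apply integral_congr_ae
      filter_upwards [hi1] with x hx
      rw [hx]
    have e4 : waveMoment ℓ w (deriv g) 0 = waveMoment ℓ (fun x _ => u0 x) (deriv g) 0 := by
      rw [waveMoment, waveMoment]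
      apply intervalIntegral.integral_congr
      intro x hx
      rw [uIcc_of_le hl0.le] at hx
      simp only [hi0 x hx]
    rw [e1, e2, e3, e4, zero_sub] at hcons
    exact hcons
  have hu' := hu
  have hv' := hv
  obtain ⟨ux, ut, huV0, huL2, -, -, -⟩ := hu'
  obtain ⟨vx, vt, hvV0, hvL2, -, -, -⟩ := hv'
  have huc := (huV0.1 τ hτ).continuousOn
  have hvc := (hvV0.1 τ hτ).continuousOn
  have hconst := eq_of_integral_mul_deriv_eq_zero hl (hvc.sub huc) ?_
  · intro x hx
    have h1 := hconst x hx
    simp only [Pi.sub_apply, (huV0.1 τ hτ).zero, (hvV0.1 τ hτ).zero] at h1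
    linarith
  intro θ hθ _ hθs
  have hθ1 : ContDiff ℝ 1 θ := hθ.of_le (by norm_cast)
  have hθd : Continuous (deriv θ) := hθ1.continuous_deriv le_rfl
  obtain ⟨g, hg, hgd, hgθ⟩ := hΦ.exists_dual_profile hℓ hη hη1 hτ hθ1 hθs
  have h1 := key u hu θ g hθ1 hθs hg hgd hgθ
  have h2 := key v hv θ g hθ1 hθs hg hgd hgθ
  rw [← integral_Ioc_eq_integral_Ioo, ← intervalIntegral.integral_of_le hl.le]
  have h3 : ∫ x in (0 : ℝ)..ℓ τ, ((fun x => v x τ) - fun x => u x τ) x * deriv θ x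
      = (∫ x in (0 : ℝ)..ℓ τ, v x τ * deriv θ x) - ∫ x in (0 : ℝ)..ℓ τ, u x τ * deriv θ x := by
    rw [← intervalIntegral.integral_sub (hvL2.1.intervalIntegrable_mul hτ hl.le hθd)
      (huL2.1.intervalIntegrable_mul hτ hl.le hθd)]
    congr 1; ext x; simp only [Pi.sub_apply]; ring
  rw [h3]
  linarith

/-! ### d'Alembert waves with square integrable profile derivative -/

section

variable {ℓ ℓd : ℝ → ℝ} {T : ℝ}

theorem hasDerivAt_slice_snd {ψ : ℝ × ℝ → ℝ} (hψ : ContDiff ℝ 1 ψ) (x t : ℝ) :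
    HasDerivAt (fun s => ψ (x, s)) (fderiv ℝ ψ (x, t) (0, 1)) t :=
  ((hψ.differentiable one_ne_zero (x, t)).hasFDerivAt).comp_hasDerivAt t
    ((hasDerivAt_const t x).prodMk (hasDerivAt_id t))

theorem hasDerivAt_slice_fst {ψ : ℝ × ℝ → ℝ} (hψ : ContDiff ℝ 1 ψ) (x t : ℝ) :
    HasDerivAt (fun y => ψ (y, t)) (fderiv ℝ ψ (x, t) (1, 0)) x :=
  ((hψ.differentiable one_ne_zero (x, t)).hasFDerivAt).comp_hasDerivAt x
    ((hasDerivAt_id x).prodMk (hasDerivAt_const x t))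

theorem continuous_fderiv_slice {ψ : ℝ × ℝ → ℝ} (hψ : ContDiff ℝ 1 ψ) (v : ℝ × ℝ) :
    Continuous fun p => fderiv ℝ ψ p v :=
  (hψ.continuous_fderiv one_ne_zero).clm_apply continuous_const

/-- A `C¹` function that vanishes at the fixed end is of finite energy. -/
theorem MovingEnd.finiteEnergy_of_contDiff (hℓ : MovingEnd ℓ ℓd T) {ψ : ℝ × ℝ → ℝ}
    (hψ : ContDiff ℝ 1 ψ) (h0 : ∀ t ∈ Icc 0 T, ψ (0, t) = 0) :
    FiniteEnergy ℓ T (fun x t => ψ (x, t)) (fun x t => fderiv ℝ ψ (x, t) (1, 0))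
      (fun x t => fderiv ℝ ψ (x, t) (0, 1)) := by
  have hc := hψ.continuous
  have hcx := continuous_fderiv_slice hψ (1, 0)
  have hct := continuous_fderiv_slice hψ (0, 1)
  have hL := contL2_of_continuous hℓ.continuousOn (v := fun x t => ψ (x, t)) hc
  have hLx := contL2_of_continuous hℓ.continuousOn (v := fun x t => fderiv ℝ ψ (x, t) (1, 0)) hcx
  have hLt := contL2_of_continuous hℓ.continuousOn (v := fun x t => fderiv ℝ ψ (x, t) (0, 1)) hct
  refine ⟨⟨fun t ht => ⟨?_, h0 t ht, hL.1 t ht, hLx.1 t ht, ?_⟩, hL, hLx⟩, hL, hLt, fun t ht => ?_⟩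
  · exact (by fun_prop : Continuous fun x => ψ (x, t)).continuousOn
  · apply isWeakDerivOn_primitive (hℓ.pos t ht).le
    · exact (by fun_prop : Continuous fun x => fderiv ℝ ψ (x, t) (1, 0)).intervalIntegrable _ _
    · intro x _
      rw [intervalIntegral.integral_eq_sub_of_hasDerivAt (f := fun x => ψ (x, t))
        (fun y _ => hasDerivAt_slice_fst hψ y t)
        ((by fun_prop : Continuous fun x => fderiv ℝ ψ (x, t) (1, 0)).intervalIntegrable _ _)]
      ring
  · obtain ⟨M, hM0, hM⟩ := exists_bound_Icc hℓ.continuousOn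
    obtain ⟨C, hC⟩ := (isCompact_Icc.prod isCompact_Icc).exists_bound_of_continuousOn
      (hct.continuousOn (s := Icc (0 : ℝ) M ×ˢ Icc (0 : ℝ) T))
    have hlim : Tendsto (fun s => eLpNorm (fun x => (ψ (x, s) - ψ (x, t)) / (s - t)
        - fderiv ℝ ψ (x, t) (0, 1)) 2 (volume.restrict (Ioo 0 M))) (𝓝[Icc 0 T \ {t}] t) (𝓝 0) := by
      apply tendsto_eLpNorm_two_zero_of_dominated (fun _ => C + C) (memLp_const _)
      · refine Eventually.of_forall fun s => Continuous.aestronglyMeasurable ?_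
        fun_prop
      · filter_upwards [self_mem_nhdsWithin] with s hs
        rw [ae_restrict_iff' measurableSet_Ioo]
        refine Eventually.of_forall fun x hx => (norm_sub_le _ _).trans (add_le_add ?_ ?_)
        · have h1 := (convex_Icc 0 T).norm_image_sub_le_of_norm_hasDerivWithin_le
            (f := fun s => ψ (x, s)) (f' := fun s => fderiv ℝ ψ (x, s) (0, 1)) (C := C)
            (fun y _ => (hasDerivAt_slice_snd hψ x y).hasDerivWithinAt)
            (fun y hy => hC (x, y) ⟨Ioo_subset_Icc_self hx, hy⟩) ht hs.1
          have hne : 0 < ‖s - t‖ := norm_pos_iff.2 (sub_ne_zero.2 hs.2)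
          rw [norm_div, div_le_iff₀ hne]
          exact h1
        · exact hC (x, t) ⟨Ioo_subset_Icc_self hx, ht⟩
      · refine Eventually.of_forall fun x => ?_
        have h1 := hasDerivWithinAt_iff_tendsto_slope.1
          ((hasDerivAt_slice_snd hψ x t).hasDerivWithinAt (s := Icc 0 T))
        have h2 := h1.sub_const (fderiv ℝ ψ (x, t) (0, 1))
        rw [sub_self] at h2
        refine h2.congr fun s => ?_
        rw [slope_def_field]
    refine tendsto_of_tendsto_of_tendsto_of_le_of_le tendsto_const_nhds hlim
      (fun _ => zero_le) fun s => eLpNorm_mono_measure _ (Measure.restrict_mono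
        (Ioo_subset_Ioo_right ((min_le_right _ _).trans (hM t ht))) le_rfl)

/-- Continuity in `L²(ℝ)` of a continuous family of measure preserving substitutions. -/
theorem tendsto_eLpNorm_comp_sub {p : ℝ → ℝ} (hp : MemLp p 2 volume) {g : ℝ × ℝ → ℝ}
    (hg : Continuous g) (hgm : ∀ t, MeasurePreserving fun x => g (t, x)) (t : ℝ) :
    Tendsto (fun s => eLpNorm (fun x => p (g (s, x)) - p (g (t, x))) 2 volume) (𝓝 t) (𝓝 0) := by
  set γ : ℝ → C(ℝ, ℝ) := fun s => (ContinuousMap.mk g hg).curry s with hγ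
  have hγc : Continuous γ := (ContinuousMap.mk g hg).curry.continuous
  have h1 := (continuous_const (y := hp.toLp p)).compMeasurePreservingLp hγc hgm (by norm_num)
  have h2 := (Lp.tendsto_Lp_iff_tendsto_eLpNorm' _ _).1 (h1.tendsto t)
  refine h2.congr fun s => eLpNorm_congr_ae ?_
  have h3 : ∀ s, (Lp.compMeasurePreserving (γ s) (hgm s) (hp.toLp p) : ℝ → ℝ)
      =ᵐ[volume] fun x => p (g (s, x)) := fun s =>
    (Lp.coeFn_compMeasurePreserving (hp.toLp p) (hgm s)).trans
      ((hgm s).quasiMeasurePreserving.ae_eq_comp hp.coeFn_toLp)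
  filter_upwards [h3 s, h3 t] with x hx hx'
  rw [Pi.sub_apply, hx, hx']

theorem MovingEnd.contL2_comp (hℓ : MovingEnd ℓ ℓd T) {p : ℝ → ℝ} (hp : MemLp p 2 volume)
    {g : ℝ × ℝ → ℝ} (hg : Continuous g) (hgm : ∀ t, MeasurePreserving fun x => g (t, x)) :
    ContL2 ℓ T fun x t => p (g (t, x)) := by
  have hpg : ∀ t, MemLp (fun x => p (g (t, x))) 2 volume := fun t =>
    hp.comp_measurePreserving (hgm t)
  refine ⟨fun t _ => (hpg t).restrict _, fun t ht => ?_⟩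
  have h1 := (tendsto_eLpNorm_comp_sub hp hg hgm t).mono_left
    (nhdsWithin_le_nhds (s := Icc 0 T))
  -- the interval moves while the function is frozen at time `t`
  have h2 : Tendsto (fun s => eLpNorm (fun x => (Ioo 0 (ℓ s)).indicator (fun y => p (g (t, y))) x
      - (Ioo 0 (ℓ t)).indicator (fun y => p (g (t, y))) x) 2 volume) (𝓝[Icc 0 T] t) (𝓝 0) := by
    have hi : ∀ s x, ‖(Ioo 0 (ℓ s)).indicator (fun y => p (g (t, y))) x‖ ≤ ‖p (g (t, x))‖ :=
      fun s x => norm_indicator_le_norm_self _ _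
    apply tendsto_eLpNorm_two_zero_of_dominated (fun x => ‖p (g (t, x))‖ + ‖p (g (t, x))‖)
      ((hpg t).norm.add (hpg t).norm)
    · exact Eventually.of_forall fun s => ((hpg t).1.indicator measurableSet_Ioo).sub
        ((hpg t).1.indicator measurableSet_Ioo)
    · exact Eventually.of_forall fun s => Eventually.of_forall fun x =>
        (norm_sub_le _ _).trans (add_le_add (hi s x) (hi t x))
    · have hne : ∀ᵐ x : ℝ, x ≠ ℓ t := by simp [ae_iff, measure_singleton]
      filter_upwards [hne] with x hx
      have hℓt : Tendsto ℓ (𝓝[Icc 0 T] t) (𝓝 (ℓ t)) := hℓ.continuousOn t ht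
      have hev : ∀ᶠ s in 𝓝[Icc 0 T] t, (x ∈ Ioo 0 (ℓ s) ↔ x ∈ Ioo 0 (ℓ t)) := by
        rcases lt_or_gt_of_ne hx with hlt | hgt
        · filter_upwards [hℓt.eventually (lt_mem_nhds hlt)] with s hs
          simp [hs, hlt]
        · filter_upwards [hℓt.eventually (gt_mem_nhds hgt)] with s hs
          simp [hs.not_gt, hgt.not_gt]
      refine tendsto_const_nhds.congr' ?_
      filter_upwards [hev] with s hs
      by_cases h : x ∈ Ioo 0 (ℓ t)
      · rw [indicator_of_mem h, indicator_of_mem (hs.2 h), sub_self]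
      · rw [indicator_of_notMem h, indicator_of_notMem (fun h' => h (hs.1 h')), sub_self]
  have h3 := h1.add h2
  rw [add_zero] at h3
  refine tendsto_of_tendsto_of_tendsto_of_le_of_le tendsto_const_nhds h3
    (fun _ => zero_le) fun s => ?_
  have h4 : (fun x => (Ioo 0 (ℓ s)).indicator (fun y => p (g (s, y))) x
      - (Ioo 0 (ℓ t)).indicator (fun y => p (g (t, y))) x)
      = (Ioo 0 (ℓ s)).indicator (fun x => p (g (s, x)) - p (g (t, x)))
        + fun x => ((Ioo 0 (ℓ s)).indicator (fun y => p (g (t, y))) x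
          - (Ioo 0 (ℓ t)).indicator (fun y => p (g (t, y))) x) := by
    funext x
    by_cases h : x ∈ Ioo 0 (ℓ s) <;> simp [h]
  simp only
  rw [h4]
  refine (eLpNorm_add_le (((hpg s).1.sub (hpg t).1).indicator measurableSet_Ioo)
    (((hpg t).1.indicator measurableSet_Ioo).sub ((hpg t).1.indicator measurableSet_Ioo))
    (by norm_num)).trans ?_
  exact add_le_add (eLpNorm_indicator_le _) le_rfl

theorem ContL2.add {v v' : ℝ → ℝ → ℝ} (h : ContL2 ℓ T v) (h' : ContL2 ℓ T v') :
    ContL2 ℓ T fun x t => v x t + v' x t := by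
  refine ⟨fun t ht => (h.1 t ht).add (h'.1 t ht), fun t ht => ?_⟩
  have h3 := (h.2 t ht).add (h'.2 t ht)
  rw [add_zero] at h3
  refine tendsto_of_tendsto_of_tendsto_of_le_of_le' tendsto_const_nhds h3
    (Eventually.of_forall fun _ => zero_le) ?_
  filter_upwards [self_mem_nhdsWithin] with s hs
  refine le_trans (le_of_eq ?_) (eLpNorm_add_le
    ((h.memLp_indicator ⟨s, hs⟩).1.sub (h.memLp_indicator ⟨t, ht⟩).1)
    ((h'.memLp_indicator ⟨s, hs⟩).1.sub (h'.memLp_indicator ⟨t, ht⟩).1) (by norm_num))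
  congr 1
  funext x
  simp only [Pi.add_apply, indicator_apply]
  split_ifs <;> ring

theorem ContL2.neg {v : ℝ → ℝ → ℝ} (h : ContL2 ℓ T v) : ContL2 ℓ T fun x t => -v x t := by
  refine ⟨fun t ht => (h.1 t ht).neg, fun t ht => (h.2 t ht).congr fun s => ?_⟩
  rw [← eLpNorm_neg]
  congr 1
  funext x
  simp only [Pi.neg_apply, indicator_apply]
  split_ifs <;> ring

theorem ContL2.sub {v v' : ℝ → ℝ → ℝ} (h : ContL2 ℓ T v) (h' : ContL2 ℓ T v') :
    ContL2 ℓ T fun x t => v x t - v' x t := by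
  simpa only [sub_eq_add_neg] using h.add h'.neg

theorem MeasureTheory.MemLp.intervalIntegrable_two {p : ℝ → ℝ} (hp : MemLp p 2 volume) {a b : ℝ} :
    IntervalIntegrable p volume a b := by
  have : IsFiniteMeasure (volume.restrict (uIoc a b)) := ⟨by simp [uIoc]⟩
  exact intervalIntegrable_iff.2 ((hp.restrict _).integrable (by norm_num))

/-- The difference quotients of a primitive of `p ∈ L²(ℝ)` converge to `p` in `L²(ℝ)`: by Jensen
and Tonelli, the error is at most the largest `‖p(· + r) - p‖` with `|r| ≤ |δ|`. -/
theorem tendsto_eLpNorm_slope_sub {p f : ℝ → ℝ} (hpm : Measurable p) (hp : MemLp p 2 volume)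
    (hf : ∀ x y, f y - f x = ∫ z in x..y, p z) :
    Tendsto (fun δ => eLpNorm (fun z => (f (δ + z) - f z) / δ - p z) 2 volume) (𝓝[≠] 0) (𝓝 0) := by
  have htr := tendsto_eLpNorm_comp_sub hp (g := fun q => q.1 + q.2) (by fun_prop)
    (fun t => measurePreserving_add_left volume t) 0
  rw [ENNReal.tendsto_nhds_zero] at htr ⊢
  intro ε hε
  obtain ⟨r, hr, hrε⟩ := Metric.eventually_nhds_iff.1 (htr ε hε)
  filter_upwards [self_mem_nhdsWithin, nhdsWithin_le_nhds (Metric.ball_mem_nhds (0 : ℝ) hr)]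
    with δ hδ hδr
  have hδ0 : δ ≠ 0 := hδ
  set μ : Measure ℝ := volume.restrict (Ioc 0 1) with hμ
  have hprob : IsProbabilityMeasure μ := ⟨by simp [hμ]⟩
  have hq : ∀ z, (f (δ + z) - f z) / δ - p z = ∫ y, (p (δ * y + z) - p z) ∂μ := by
    intro z
    have hpi : IntervalIntegrable p volume z (δ + z) :=
      hp.intervalIntegrable_two
    have h1 : ∫ y in (0 : ℝ)..1, p (δ * y + z) = (f (δ + z) - f z) / δ := by
      rw [intervalIntegral.integral_comp_mul_add p hδ0 z, hf]
      simp only [mul_zero, zero_add, mul_one, smul_eq_mul]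
      ring
    have h2 : IntervalIntegrable (fun y => p (δ * y + z)) volume 0 1 := by
      have h3 := (hpi.comp_add_right z).comp_mul_left (c := δ)
      simpa [hδ0] using h3
    have h4 : ∫ y in (0 : ℝ)..1, (p (δ * y + z) - p z) = (f (δ + z) - f z) / δ - p z := by
      rw [intervalIntegral.integral_sub h2 intervalIntegrable_const, h1]
      simp
    rw [← h4, intervalIntegral.integral_of_le zero_le_one]
  have hmeas : Measurable fun w : ℝ × ℝ => ‖p (δ * w.2 + w.1) - p w.1‖ₑ ^ 2 := by fun_prop
  have hsq : eLpNorm (fun z => (f (δ + z) - f z) / δ - p z) 2 volume ^ (2 : ℝ) ≤ ε ^ (2 : ℝ) := by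
    have e1 : ∀ (ν : Measure ℝ) (F : ℝ → ℝ), eLpNorm F 2 ν ^ (2 : ℝ) = ∫⁻ x, ‖F x‖ₑ ^ 2 ∂ν := by
      intro ν F
      have := eLpNorm_nnreal_pow_eq_lintegral (f := F) (μ := ν) (p := 2) (by norm_num)
      simpa using this
    rw [e1]
    calc ∫⁻ z, ‖(f (δ + z) - f z) / δ - p z‖ₑ ^ 2
        ≤ ∫⁻ z, ∫⁻ y, ‖p (δ * y + z) - p z‖ₑ ^ 2 ∂μ := by
          apply lintegral_mono
          intro z
          simp only
          rw [hq z]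
          have h1 : ‖∫ y, (p (δ * y + z) - p z) ∂μ‖ₑ
              ≤ eLpNorm (fun y => p (δ * y + z) - p z) 2 μ := by
            refine (enorm_integral_le_lintegral_enorm _).trans ?_
            rw [← eLpNorm_one_eq_lintegral_enorm]
            exact eLpNorm_le_eLpNorm_of_exponent_le (by norm_num)
              (by fun_prop : Measurable fun y => p (δ * y + z) - p z).aestronglyMeasurable
          rw [← e1, ← ENNReal.rpow_two]
          exact ENNReal.rpow_le_rpow h1 (by norm_num)
      _ = ∫⁻ y, (∫⁻ z, ‖p (δ * y + z) - p z‖ₑ ^ 2) ∂μ := lintegral_lintegral_swap hmeas.aemeasurable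
      _ ≤ ∫⁻ _, ε ^ (2 : ℝ) ∂μ := by
          apply lintegral_mono_ae
          rw [hμ, ae_restrict_iff' measurableSet_Ioc]
          refine Eventually.of_forall fun y hy => ?_
          rw [← e1]
          have h2 := hrε (y := δ * y) (by
            rw [Real.dist_eq, sub_zero, abs_mul, abs_of_pos hy.1]
            have : |δ| < r := by simpa using hδr
            nlinarith [abs_nonneg δ, hy.2])
          simp only [zero_add] at h2
          exact ENNReal.rpow_le_rpow h2 (by norm_num)
      _ = ε ^ (2 : ℝ) := by simp
  exact (ENNReal.rpow_le_rpow_iff (by norm_num)).1 hsq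

theorem continuous_of_sub_eq_integral {p f : ℝ → ℝ} (hp : MemLp p 2 volume)
    (hf : ∀ x y, f y - f x = ∫ z in x..y, p z) : Continuous f := by
  have h1 : f = fun y => f 0 + ∫ z in (0 : ℝ)..y, p z := funext fun y => by rw [← hf]; ring
  rw [h1]
  exact continuous_const.add (intervalIntegral.continuous_primitive
    (fun a b => hp.intervalIntegrable_two) 0)

/-- A d'Alembert wave with square integrable profile derivative is of finite energy. -/
theorem MovingEnd.finiteEnergy_wave (hℓ : MovingEnd ℓ ℓd T) {p f : ℝ → ℝ} (hpm : Measurable p)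
    (hp : MemLp p 2 volume) (hf : ∀ x y, f y - f x = ∫ z in x..y, p z) :
    FiniteEnergy ℓ T (fun x t => f (t + x) - f (t - x)) (fun x t => p (t + x) + p (t - x))
      (fun x t => p (t + x) - p (t - x)) := by
  have hfc := continuous_of_sub_eq_integral hp hf
  have hL := contL2_of_continuous hℓ.continuousOn (v := fun x t => f (t + x) - f (t - x))
    (by fun_prop)
  have hp1 := hℓ.contL2_comp hp (g := fun q => q.1 + q.2) (by fun_prop)
    (fun t => measurePreserving_add_left volume t)
  have hp2 := hℓ.contL2_comp hp (g := fun q => q.1 - q.2) (by fun_prop)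
    (fun t => Measure.measurePreserving_sub_left volume t)
  have hLx := hp1.add hp2
  have hLt := hp1.sub hp2
  refine ⟨⟨fun t ht => ⟨?_, by simp, hL.1 t ht, hLx.1 t ht, ?_⟩, hL, hLx⟩, hL, hLt, fun t ht => ?_⟩
  · exact (by fun_prop : Continuous fun x => f (t + x) - f (t - x)).continuousOn
  · have hi1 : ∀ x, IntervalIntegrable (fun y => p (t + y)) volume 0 x := fun x =>
      (hp.comp_measurePreserving (measurePreserving_add_left volume t)).intervalIntegrable_two
    have hi2 : ∀ x, IntervalIntegrable (fun y => p (t - y)) volume 0 x := fun x =>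
      (hp.comp_measurePreserving (Measure.measurePreserving_sub_left volume t)).intervalIntegrable_two
    apply isWeakDerivOn_primitive (hℓ.pos t ht).le ((hi1 _).add (hi2 _))
    intro x _
    rw [intervalIntegral.integral_add (hi1 x) (hi2 x), intervalIntegral.integral_comp_add_left,
      intervalIntegral.integral_comp_sub_left, ← hf, ← hf]
    simp
  · have h1 := tendsto_eLpNorm_slope_sub hpm hp hf
    have hst : Tendsto (fun s => s - t) (𝓝[Icc 0 T \ {t}] t) (𝓝[≠] 0) := by
      rw [tendsto_nhdsWithin_iff]
      constructor
      · have : Tendsto (fun s => s - t) (𝓝 t) (𝓝 (t - t)) := (continuous_sub_right t).tendsto t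
        rw [sub_self] at this
        exact this.mono_left nhdsWithin_le_nhds
      · filter_upwards [self_mem_nhdsWithin] with s hs
        exact sub_ne_zero.2 hs.2
    have h2 := h1.comp hst
    have h3 := h2.add h2
    rw [add_zero] at h3
    refine tendsto_of_tendsto_of_tendsto_of_le_of_le tendsto_const_nhds h3
      (fun _ => zero_le) fun s => ?_
    set Q : ℝ → ℝ := fun z => (f (s - t + z) - f z) / (s - t) - p z with hQ
    have hQm : Measurable Q := by
      have := hfc.measurable
      fun_prop
    have e1 : (fun x => (f (s + x) - f (s - x) - (f (t + x) - f (t - x))) / (s - t)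
        - (p (t + x) - p (t - x))) = (fun x => Q (t + x)) - fun x => Q (t - x) := by
      funext x
      simp only [hQ, Pi.sub_apply]
      rw [show s - t + (t + x) = s + x by ring, show s - t + (t - x) = s - x by ring]
      ring
    simp only
    rw [e1]
    refine (eLpNorm_mono_measure _ Measure.restrict_le_self).trans ((eLpNorm_sub_le
      (by fun_prop : Measurable fun x => Q (t + x)).aestronglyMeasurable
      (by fun_prop : Measurable fun x => Q (t - x)).aestronglyMeasurable (by norm_num)).trans ?_)
    apply le_of_eq
    have e2 := eLpNorm_comp_measurePreserving (p := 2) hQm.aestronglyMeasurable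
      (measurePreserving_add_left volume t)
    have e3 := eLpNorm_comp_measurePreserving (p := 2) hQm.aestronglyMeasurable
      (Measure.measurePreserving_sub_left volume t)
    exact congrArg₂ (· + ·) e2 e3

end

section

variable {ℓ ℓd : ℝ → ℝ} {T : ℝ}

theorem MovingEnd.hasDerivAt_trace (hℓ : MovingEnd ℓ ℓd T) {ψ : ℝ × ℝ → ℝ} (hψ : ContDiff ℝ 1 ψ)
    {t : ℝ} (ht : t ∈ Ioc 0 T) :
    HasDerivAt (fun s => ψ (ℓ s, s)) (fderiv ℝ ψ (ℓ t, t) (ℓd t, 1)) t :=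
  HasFDerivAt.comp_hasDerivAt (f := fun s => (ℓ s, s)) t
    ((hψ.differentiable one_ne_zero (ℓ t, t)).hasFDerivAt)
    ((hℓ.hasDerivAt_of_mem_Ioc ht).prodMk (hasDerivAt_id t))

theorem MovingEnd.continuousOn_trace_deriv (hℓ : MovingEnd ℓ ℓd T) {ψ : ℝ × ℝ → ℝ}
    (hψ : ContDiff ℝ 1 ψ) :
    ContinuousOn (fun t => fderiv ℝ ψ (ℓ t, t) (ℓd t, 1)) (Icc 0 T) :=
  ((hψ.continuous_fderiv one_ne_zero).comp_continuousOn
    (hℓ.continuousOn.prodMk continuousOn_id)).clm_apply (hℓ.cont.prodMk continuousOn_const)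

/-- The action of a d'Alembert wave against a `C¹` test function `ψ`, after integration by parts
along the moving end. The pairing identity is applied with the test function in the role of the
finite energy function. -/
theorem MovingEnd.integral_waveAction_test (hℓ : MovingEnd ℓ ℓd T) {ψ : ℝ × ℝ → ℝ}
    (hψ : ContDiff ℝ 1 ψ) (h0 : ∀ t ∈ Icc 0 T, ψ (0, t) = 0)
    (hi : ∀ x ∈ Icc 0 (ℓ 0), ψ (x, 0) = 0) (hf : ∀ x ∈ Icc 0 (ℓ T), ψ (x, T) = 0)
    {h g : ℝ → ℝ} (hh : Continuous h) (hg : ∀ x, HasDerivAt g (h x) x) :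
    ∫ t in (0 : ℝ)..T, waveAction ℓ (fun x t => fderiv ℝ ψ (x, t) (1, 0))
        (fun x t => fderiv ℝ ψ (x, t) (0, 1)) h t
      = ∫ t in (0 : ℝ)..T, (g (t + ℓ t) + g (t - ℓ t)) * fderiv ℝ ψ (ℓ t, t) (ℓd t, 1) := by
  have hT := hℓ.T_pos.le
  have h0T : (0 : ℝ) ∈ Icc 0 T := ⟨le_rfl, hT⟩
  have hTT : T ∈ Icc 0 T := ⟨hT, le_rfl⟩
  have hFE := hℓ.finiteEnergy_of_contDiff hψ h0
  have hU := hℓ.integral_waveAction hFE hh hTT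
  have hgd : deriv g = h := funext fun x => (hg x).deriv
  have hg1 : ContDiff ℝ 1 g := by
    rw [contDiff_one_iff_deriv, hgd]
    exact ⟨fun x => (hg x).differentiableAt, hh⟩
  have hm : ∀ t ∈ Icc 0 T, (∀ x ∈ Icc 0 (ℓ t), ψ (x, t) = 0) →
      waveMoment ℓ (fun x t => ψ (x, t)) h t = 0 := by
    intro t ht hz
    apply intervalIntegral.integral_zero_ae
    refine Eventually.of_forall fun x hx => ?_
    rw [uIoc_of_le (hℓ.pos t ht).le] at hx
    simp only [hz x (Ioc_subset_Icc_self hx), zero_mul]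
  rw [hm T hTT hf, hm 0 h0T hi, sub_zero] at hU
  have hc1 := hℓ.continuousOn_waveAction hFE hh
  have hc2 := (hℓ.continuousOn_trace hFE).mul (hℓ.continuousOn_waveFlux hh)
  have hc3 : ContinuousOn (fun t => g (t + ℓ t) + g (t - ℓ t)) (Icc 0 T) :=
    (hg1.continuous.comp_continuousOn (continuousOn_id.add hℓ.continuousOn)).add
      (hg1.continuous.comp_continuousOn (continuousOn_id.sub hℓ.continuousOn))
  have hc4 := hc3.mul (hℓ.continuousOn_trace_deriv hψ)
  have hFTC := intervalIntegral.integral_eq_sub_of_hasDerivAt_of_le hT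
    ((hℓ.continuousOn_trace hFE).mul hc3)
    (f' := fun t => ψ (ℓ t, t) * waveFlux ℓ ℓd h t
      + (g (t + ℓ t) + g (t - ℓ t)) * fderiv ℝ ψ (ℓ t, t) (ℓd t, 1))
    (fun t ht => by
      have ht' := Ioo_subset_Ioc_self ht
      have h1 := (hℓ.hasDerivAt_trace hψ ht').mul
        ((hℓ.hasDerivAt_comp_add hg1 ht').add (hℓ.hasDerivAt_comp_sub hg1 ht'))
      refine h1.congr_deriv ?_
      rw [hgd, waveFlux]
      simp only [Pi.add_apply]
      ring)
    ((hc2.add hc4).intervalIntegrable_of_Icc hT)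
  have e0 : ψ (ℓ 0, 0) = 0 := hi _ ⟨(hℓ.pos 0 h0T).le, le_rfl⟩
  have eT : ψ (ℓ T, T) = 0 := hf _ ⟨(hℓ.pos T hTT).le, le_rfl⟩
  simp only [Pi.mul_apply, e0, eT, zero_mul, sub_zero] at hFTC
  have hs1 := intervalIntegral.integral_add (hc2.intervalIntegrable_of_Icc (μ := volume) hT)
    (hc4.intervalIntegrable_of_Icc hT)
  have hs2 := intervalIntegral.integral_add (hc1.intervalIntegrable_of_Icc (μ := volume) hT)
    (hc2.intervalIntegrable_of_Icc hT)
  simp only [Pi.mul_apply] at hs1 hs2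
  rw [hs1] at hFTC
  rw [hs2] at hU
  linarith

theorem abs_integral_le_eLpNorm {a b : ℝ} (hab : a ≤ b) {p : ℝ → ℝ} (hp : MemLp p 2 volume) :
    |∫ x in a..b, p x| ≤ Real.sqrt (b - a) * (eLpNorm p 2 volume).toReal := by
  have hmp := measurePreserving_add_left (volume : Measure ℝ) a
  have hpa := hp.comp_measurePreserving hmp
  have h1 := abs_integral_mul_le_eLpNorm (m := b - a) (C := 1) (f := fun x => p (a + x))
    (g := fun _ => 1) (sub_nonneg.2 hab) (hpa.restrict _) (fun x _ => by simp)
  simp only [mul_one, one_mul] at h1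
  rw [intervalIntegral.integral_comp_add_left, add_zero, add_sub_cancel] at h1
  refine h1.trans (mul_le_mul_of_nonneg_left (ENNReal.toReal_mono hp.2.ne ?_) (Real.sqrt_nonneg _))
  exact (eLpNorm_mono_measure _ Measure.restrict_le_self).trans
    (eLpNorm_comp_measurePreserving hp.1 hmp).le

/-- A d'Alembert wave with square integrable profile derivative is a weak solution if its profile
satisfies the integrated boundary condition. The identity for `C¹` profiles extends by density in
`L²`. -/
theorem MovingEnd.weakWaveEq_wave (hℓ : MovingEnd ℓ ℓd T) {η : ℝ} {p f : ℝ → ℝ}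
    (hpm : Measurable p) (hp : MemLp p 2 volume) (hf : ∀ x y, f y - f x = ∫ z in x..y, p z)
    (hbc : ∀ t ∈ Icc 0 T, (1 + η) * f (t + ℓ t) + (1 - η) * f (t - ℓ t) = 0) :
    WeakWaveEq ℓ η T (fun x t => f (t + x) - f (t - x)) (fun x t => p (t + x) + p (t - x))
      (fun x t => p (t + x) - p (t - x)) := by
  intro ψ hψ h0 hi hfin
  have hT := hℓ.T_pos.le
  have hfc := continuous_of_sub_eq_integral hp hf
  have hFE := hℓ.finiteEnergy_wave hpm hp hf
  have hFEψ := hℓ.finiteEnergy_of_contDiff hψ h0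
  set ψx : ℝ × ℝ → ℝ := fun q => fderiv ℝ ψ q (1, 0) with hψx
  set ψt : ℝ × ℝ → ℝ := fun q => fderiv ℝ ψ q (0, 1) with hψt
  have hcx : Continuous ψx := continuous_fderiv_slice hψ (1, 0)
  have hct : Continuous ψt := continuous_fderiv_slice hψ (0, 1)
  set bd : ℝ → ℝ := fun t => fderiv ℝ ψ (ℓ t, t) (ℓd t, 1) with hbd
  have hbdc : ContinuousOn bd (Icc 0 T) := hℓ.continuousOn_trace_deriv hψ
  -- the volume term of the weak equation is the action of `ψ` against the wave, as the action is
  -- symmetric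
  set a : ℝ → ℝ := waveAction ℓ (fun x t => ψx (x, t)) (fun x t => ψt (x, t)) p with ha
  have hi1 : ∀ t ∈ Icc 0 T, IntervalIntegrable (fun x => (p (t + x) - p (t - x)) * ψt (x, t))
      volume 0 (ℓ t) := fun t ht =>
    hFE.contDiffL2.2.1.intervalIntegrable_mul ht (hℓ.pos t ht).le (by fun_prop)
  have hi2 : ∀ t ∈ Icc 0 T, IntervalIntegrable (fun x => (p (t + x) + p (t - x)) * ψx (x, t))
      volume 0 (ℓ t) := fun t ht =>
    hFE.contV0.2.2.intervalIntegrable_mul ht (hℓ.pos t ht).le (by fun_prop)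
  have ha1 : ∀ t, a t = ∫ x in (0 : ℝ)..ℓ t, ((p (t + x) - p (t - x)) * ψt (x, t)
      - (p (t + x) + p (t - x)) * ψx (x, t)) := by
    intro t
    rw [ha, waveAction]
    congr 1; ext x; ring
  have hac : ContinuousOn a (Icc 0 T) := by
    refine ((hFE.contDiffL2.2.1.continuousOn_integral_mul hℓ.continuousOn
      (fun t ht => (hℓ.pos t ht).le) hct).sub (hFE.contV0.2.2.continuousOn_integral_mul
      hℓ.continuousOn (fun t ht => (hℓ.pos t ht).le) hcx)).congr fun t ht => ?_
    rw [ha1, intervalIntegral.integral_sub (hi1 t ht) (hi2 t ht)]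
    rfl
  have hfab : ContinuousOn (fun t => f (t + ℓ t) + f (t - ℓ t)) (Icc 0 T) :=
    (hfc.comp_continuousOn (continuousOn_id.add hℓ.continuousOn)).add
      (hfc.comp_continuousOn (continuousOn_id.sub hℓ.continuousOn))
  have hcc : ContinuousOn (fun t => (f (t + ℓ t) + f (t - ℓ t)) * bd t) (Icc 0 T) := hfab.mul hbdc
  -- the identity for the given profile, by density of `C¹` profiles
  have hE : (∫ t in (0 : ℝ)..T, a t) - ∫ t in (0 : ℝ)..T, (f (t + ℓ t) + f (t - ℓ t)) * bd t = 0 := by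
    obtain ⟨M, hM0, hM⟩ := exists_bound_Icc hℓ.continuousOn
    have hbdp : ∀ K : ℝ × ℝ → ℝ, Continuous K →
        ∃ C, ∀ x ∈ Icc 0 M, ∀ s ∈ Icc 0 T, |K (x, s)| ≤ C := by
      intro K hK
      obtain ⟨C, hC⟩ := (isCompact_Icc.prod isCompact_Icc).exists_bound_of_continuousOn
        (hK.continuousOn (s := Icc (0 : ℝ) M ×ˢ Icc (0 : ℝ) T))
      exact ⟨C, fun x hx s hs => hC (x, s) ⟨hx, hs⟩⟩
    obtain ⟨C1, hC1⟩ := hbdp (fun q => ψt q - ψx q) (hct.sub hcx)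
    obtain ⟨C2, hC2⟩ := hbdp (fun q => ψt q + ψx q) (hct.add hcx)
    obtain ⟨D, hD⟩ := isCompact_Icc.exists_bound_of_continuousOn hbdc
    have h0T : (0 : ℝ) ∈ Icc 0 T := ⟨le_rfl, hT⟩
    have hC10 : 0 ≤ C1 := (abs_nonneg _).trans (hC1 0 ⟨le_rfl, hM0.le⟩ 0 h0T)
    have hC20 : 0 ≤ C2 := (abs_nonneg _).trans (hC2 0 ⟨le_rfl, hM0.le⟩ 0 h0T)
    have hD0 : 0 ≤ D := (norm_nonneg _).trans (hD 0 h0T)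
    set K : ℝ := (C1 * Real.sqrt M + C2 * Real.sqrt M + 2 * Real.sqrt (T + 2 * M) * D) * T with hK
    have hK0 : 0 ≤ K := by positivity
    rw [← abs_nonpos_iff]
    apply le_of_forall_pos_le_add
    intro ε hε
    set ε' := ε / (K + 1) with hε'
    have hε'0 : 0 < ε' := by positivity
    obtain ⟨h, hhc, hhs, hhε⟩ := hp.exist_eLpNorm_sub_le (by norm_num) (by norm_num) hε'0
    have hhL : MemLp h 2 volume := hhs.continuous.memLp_of_hasCompactSupport hhc
    set δ : ℝ → ℝ := p - h with hδ
    have hδL : MemLp δ 2 volume := hp.sub hhL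
    have hδε : (eLpNorm δ 2 volume).toReal ≤ ε' := ENNReal.toReal_le_of_le_ofReal hε'0.le hhε
    set g : ℝ → ℝ := fun y => f (-M) + ∫ z in (-M)..y, h z with hg
    have hgd : ∀ x, HasDerivAt g (h x) x := fun x =>
      (intervalIntegral.integral_hasDerivAt_right (hhs.continuous.intervalIntegrable _ _)
        hhs.continuous.stronglyMeasurable.stronglyMeasurableAtFilter
        hhs.continuous.continuousAt).const_add _
    have hsm := hℓ.integral_waveAction_test hψ h0 hi hfin hhs.continuous hgd
    have hgc : Continuous g := continuous_iff_continuousAt.2 fun x => (hgd x).continuousAt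
    have hahc := hℓ.continuousOn_waveAction hFEψ hhs.continuous
    have hgab : ContinuousOn (fun t => (g (t + ℓ t) + g (t - ℓ t)) * bd t) (Icc 0 T) :=
      ((hgc.comp_continuousOn (continuousOn_id.add hℓ.continuousOn)).add
        (hgc.comp_continuousOn (continuousOn_id.sub hℓ.continuousOn))).mul hbdc
    have hfg : ∀ y ∈ Icc (-M) (T + M), |f y - g y| ≤ Real.sqrt (T + 2 * M) * ε' := by
      intro y hy
      have e1 : f y - g y = ∫ z in (-M)..y, δ z := by
        simp only [hg, hδ, Pi.sub_apply]
        rw [intervalIntegral.integral_sub hp.intervalIntegrable_two hhL.intervalIntegrable_two,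
          ← hf]
        ring
      rw [e1]
      refine (abs_integral_le_eLpNorm hy.1 hδL).trans ?_
      gcongr
      linarith [hy.2]
    have hadiff : ∀ t ∈ Icc 0 T, |a t - waveAction ℓ (fun x t => ψx (x, t))
        (fun x t => ψt (x, t)) h t| ≤ (C1 * Real.sqrt M + C2 * Real.sqrt M) * ε' := by
      intro t ht
      have hl := hℓ.pos t ht
      have m1 := measurePreserving_add_left (volume : Measure ℝ) t
      have m2 := Measure.measurePreserving_sub_left (volume : Measure ℝ) t
      have l1 := hδL.comp_measurePreserving m1
      have l2 := hδL.comp_measurePreserving m2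
      have hk1 : Continuous fun x => ψt (x, t) - ψx (x, t) := by fun_prop
      have hk2 : Continuous fun x => ψt (x, t) + ψx (x, t) := by fun_prop
      have e1 : a t - waveAction ℓ (fun x t => ψx (x, t)) (fun x t => ψt (x, t)) h t
          = (∫ x in (0 : ℝ)..ℓ t, δ (t + x) * (ψt (x, t) - ψx (x, t)))
            - ∫ x in (0 : ℝ)..ℓ t, δ (t - x) * (ψt (x, t) + ψx (x, t)) := by
        have i1 : IntervalIntegrable (fun x => δ (t + x) * (ψt (x, t) - ψx (x, t))) volume 0 (ℓ t) :=
          (l1.intervalIntegrable_two).mul_continuousOn hk1.continuousOn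
        have i2 : IntervalIntegrable (fun x => δ (t - x) * (ψt (x, t) + ψx (x, t))) volume 0 (ℓ t) :=
          (l2.intervalIntegrable_two).mul_continuousOn hk2.continuousOn
        have i3 : IntervalIntegrable (fun x => ψt (x, t) * (h (t + x) - h (t - x))
            - ψx (x, t) * (h (t + x) + h (t - x))) volume 0 (ℓ t) := by
          have := hhs.continuous
          exact Continuous.intervalIntegrable (by fun_prop) _ _
        rw [ha1, waveAction, ← intervalIntegral.integral_sub ((hi1 t ht).sub (hi2 t ht)) i3,
          ← intervalIntegral.integral_sub i1 i2]
        congr 1; ext x; simp only [hδ, Pi.sub_apply]; ring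
      have bound : ∀ (κ : ℝ → ℝ) (m : ℝ → ℝ), MeasurePreserving m →
          ∀ C, 0 ≤ C → (∀ x ∈ Icc 0 (ℓ t), |κ x| ≤ C) →
          |∫ x in (0 : ℝ)..ℓ t, δ (m x) * κ x| ≤ C * Real.sqrt M * ε' := by
        intro κ m hm C hC hκ
        refine (abs_integral_mul_le_eLpNorm hl.le ((hδL.comp_measurePreserving hm).restrict _)
          (fun x hx => hκ x (Ioo_subset_Icc_self hx))).trans ?_
        rw [mul_assoc]
        gcongr
        · exact hM t ht
        · refine le_trans (ENNReal.toReal_mono hδL.2.ne ?_) hδε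
          exact (eLpNorm_mono_measure _ Measure.restrict_le_self).trans
            (eLpNorm_comp_measurePreserving hδL.1 hm).le
      have b1 := bound (fun x => ψt (x, t) - ψx (x, t)) _ m1 C1 hC10
        fun x hx => hC1 x ⟨hx.1, hx.2.trans (hM t ht)⟩ t ht
      have b2 := bound (fun x => ψt (x, t) + ψx (x, t)) _ m2 C2 hC20
        fun x hx => hC2 x ⟨hx.1, hx.2.trans (hM t ht)⟩ t ht
      rw [e1]
      refine (abs_sub _ _).trans ?_
      linarith
    have e2 : (∫ t in (0 : ℝ)..T, a t) - ∫ t in (0 : ℝ)..T, (f (t + ℓ t) + f (t - ℓ t)) * bd t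
        = ∫ t in (0 : ℝ)..T, ((a t - waveAction ℓ (fun x t => ψx (x, t)) (fun x t => ψt (x, t)) h t)
          - ((f (t + ℓ t) + f (t - ℓ t)) * bd t - (g (t + ℓ t) + g (t - ℓ t)) * bd t)) := by
      have j1 := hac.intervalIntegrable_of_Icc (μ := volume) hT
      have j2 := hahc.intervalIntegrable_of_Icc (μ := volume) hT
      have j3 := hcc.intervalIntegrable_of_Icc (μ := volume) hT
      have j4 := hgab.intervalIntegrable_of_Icc (μ := volume) hT
      rw [intervalIntegral.integral_sub (j1.sub j2) (j3.sub j4),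
        intervalIntegral.integral_sub j1 j2, intervalIntegral.integral_sub j3 j4, hsm]
      ring
    rw [e2, zero_add]
    have e3 : ∀ t ∈ uIoc 0 T, ‖(a t - waveAction ℓ (fun x t => ψx (x, t)) (fun x t => ψt (x, t)) h t)
          - ((f (t + ℓ t) + f (t - ℓ t)) * bd t - (g (t + ℓ t) + g (t - ℓ t)) * bd t)‖
        ≤ (C1 * Real.sqrt M + C2 * Real.sqrt M + 2 * Real.sqrt (T + 2 * M) * D) * ε' := by
      intro t ht
      rw [uIoc_of_le hT] at ht
      have ht' : t ∈ Icc 0 T := Ioc_subset_Icc_self ht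
      have hl := hℓ.pos t ht'
      have hlM := hM t ht'
      have k1 := hfg (t + ℓ t) ⟨by linarith [ht'.1], by linarith [ht'.2]⟩
      have k2 := hfg (t - ℓ t) ⟨by linarith [ht'.1], by linarith [ht'.2]⟩
      have k3 : |(f (t + ℓ t) + f (t - ℓ t)) * bd t - (g (t + ℓ t) + g (t - ℓ t)) * bd t|
          ≤ 2 * Real.sqrt (T + 2 * M) * ε' * D := by
        rw [← sub_mul, abs_mul]
        refine mul_le_mul ?_ (hD t ht') (abs_nonneg _) (by positivity)
        rw [show f (t + ℓ t) + f (t - ℓ t) - (g (t + ℓ t) + g (t - ℓ t))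
          = (f (t + ℓ t) - g (t + ℓ t)) + (f (t - ℓ t) - g (t - ℓ t)) by ring]
        refine (abs_add_le _ _).trans ?_
        linarith
      rw [Real.norm_eq_abs]
      refine (abs_sub _ _).trans ?_
      linarith [hadiff t ht']
    refine (intervalIntegral.norm_integral_le_of_norm_le_const e3).trans ?_
    rw [sub_zero, abs_of_nonneg hT, hε', ← mul_div_assoc, div_mul_eq_mul_div,
      div_le_iff₀ (by positivity)]
    nlinarith
  have hd1 : ∀ x t, deriv (fun s => ψ (x, s)) t = ψt (x, t) := fun x t =>
    (hasDerivAt_slice_snd hψ x t).deriv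
  have hd2 : ∀ x t, deriv (fun y => ψ (y, t)) x = ψx (x, t) := fun x t =>
    (hasDerivAt_slice_fst hψ x t).deriv
  have hfinal : ∫ t in (0 : ℝ)..T, ((∫ x in (0 : ℝ)..ℓ t,
        ((p (t + x) - p (t - x)) * deriv (fun s => ψ (x, s)) t
          - (p (t + x) + p (t - x)) * deriv (fun y => ψ (y, t)) x))
        + η * (f (t + ℓ t) - f (t - ℓ t)) * deriv (fun s => ψ (ℓ s, s)) t)
      = ∫ t in (0 : ℝ)..T, (a t - (f (t + ℓ t) + f (t - ℓ t)) * bd t) := by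
    apply intervalIntegral.integral_congr_ae
    refine Eventually.of_forall fun t ht => ?_
    rw [uIoc_of_le hT] at ht
    simp only [hd1, hd2]
    rw [(hℓ.hasDerivAt_trace hψ ht).deriv, ← ha1]
    have hb := hbc t (Ioc_subset_Icc_self ht)
    have : η * (f (t + ℓ t) - f (t - ℓ t)) = -(f (t + ℓ t) + f (t - ℓ t)) := by linarith
    rw [this]
    ring
  simp only
  rw [hfinal, intervalIntegral.integral_sub (hac.intervalIntegrable_of_Icc hT)
    (hcc.intervalIntegrable_of_Icc hT), hE]

end

/-! ### Quasi-periodic profiles and their Fourier series -/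

/-- Extension of a square integrable function on one period to a function with `G(s + 2) = r G(s)`,
and its primitive `F` normalized such that `F(s + 2) = r F(s)`. -/
theorem exists_quasiPeriodic_primitive {q : ℝ → ℝ} (hqm : Measurable q) {a r : ℝ}
    (hq : MemLp q 2 (volume.restrict (Ioc a (a + 2)))) (hr0 : r ≠ 0) (hr1 : r ≠ 1) :
    ∃ G F : ℝ → ℝ, Measurable G ∧ (∀ s, G (s + 2) = r * G s) ∧ (∀ s ∈ Ico a (a + 2), G s = q s) ∧
      (∀ c d, MemLp G 2 (volume.restrict (Ioc c d))) ∧ (∀ x y, F y - F x = ∫ s in x..y, G s) ∧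
      ∀ s, F (s + 2) = r * F s := by
  set k : ℝ → ℤ := fun s => ⌊(s - a) / 2⌋ with hk
  set G : ℝ → ℝ := fun s => r ^ k s * q (s - 2 * k s) with hG
  have hkm : Measurable k := by
    have : Measurable fun s : ℝ => (s - a) / 2 := by fun_prop
    exact Int.measurable_floor.comp this
  have hkm' : Measurable fun s => (k s : ℝ) := (measurable_from_top (f := fun n : ℤ => (n : ℝ))).comp hkm
  have hGm : Measurable G := by
    refine Measurable.mul ?_ (hqm.comp (measurable_id.sub (hkm'.const_mul 2)))
    exact (measurable_from_top (f := fun n : ℤ => r ^ n)).comp hkm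
  have hk1 : ∀ s, k (s + 2) = k s + 1 := by
    intro s
    simp only [hk]
    rw [← Int.floor_add_one]
    congr 1
    ring
  have hGper : ∀ s, G (s + 2) = r * G s := by
    intro s
    simp only [hG]
    rw [hk1, zpow_add_one₀ hr0]
    push_cast
    rw [show s + 2 - 2 * ((k s : ℝ) + 1) = s - 2 * k s by ring]
    ring
  have hGq : ∀ s ∈ Ico a (a + 2), G s = q s := by
    intro s hs
    have : k s = 0 := by
      simp only [hk]
      rw [Int.floor_eq_zero_iff]
      constructor
      · have := hs.1
        apply div_nonneg <;> linarith
      · have := hs.2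
        rw [div_lt_one (by norm_num)]
        linarith
    simp [hG, this]
  -- `G²` times a suitable exponential is periodic
  set lam : ℝ := Real.log |r| with hlam
  have hexp : Real.exp (-lam * 2) * r ^ 2 = 1 := by
    rw [neg_mul, Real.exp_neg, mul_comm lam, ← Real.log_abs] at *
    rw [show (2 : ℝ) * Real.log |r| = Real.log |r| + Real.log |r| by ring, Real.exp_add,
      Real.exp_log (abs_pos.2 hr0), abs_mul_abs_self, ← sq]
    exact inv_mul_cancel₀ (pow_ne_zero 2 hr0)
  have hper : Function.Periodic (fun s => G s ^ 2 * Real.exp (-lam * s)) 2 := by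
    intro s
    simp only
    rw [hGper, mul_add, Real.exp_add]
    linear_combination (G s ^ 2 * Real.exp (-lam * s)) * hexp
  have hGq2 : IntervalIntegrable (fun s => G s ^ 2) volume a (a + 2) := by
    have h1 : IntervalIntegrable (fun s => q s ^ 2) volume a (a + 2) := by
      rw [intervalIntegrable_iff_integrableOn_Ioc_of_le (by linarith)]
      exact hq.integrable_sq
    rw [intervalIntegrable_iff_integrableOn_Ico_of_le (by linarith)] at h1 ⊢
    refine h1.congr_fun (fun s hs => ?_) measurableSet_Ico
    simp only
    rw [hGq s hs]
  have hint : ∀ c d, IntervalIntegrable (fun s => G s ^ 2) volume c d := by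
    intro c d
    have h1 := hper.intervalIntegrable (by norm_num)
      (hGq2.mul_continuousOn (Continuous.continuousOn (by fun_prop))) c d
    have h2 := h1.mul_continuousOn (g := fun s => Real.exp (lam * s))
      (Continuous.continuousOn (by fun_prop))
    refine h2.congr (fun s _ => ?_)
    rw [mul_assoc, ← Real.exp_add]
    simp
  have hL2 : ∀ c d, MemLp G 2 (volume.restrict (Ioc c d)) := by
    intro c d
    rw [memLp_two_iff_integrable_sq hGm.aestronglyMeasurable]
    exact (hint c d).1
  have hGi : ∀ c d, IntervalIntegrable G volume c d := fun c d =>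
    ⟨(hL2 c d).integrable (by norm_num), (hL2 d c).integrable (by norm_num)⟩
  set I : ℝ := ∫ s in a..a + 2, G s with hI
  have hr1' : r - 1 ≠ 0 := sub_ne_zero.2 hr1
  -- the additive constant is the one that makes the primitive quasi-periodic
  refine ⟨G, fun s => I / (r - 1) + ∫ y in a..s, G y, hGm, hGper, hGq, hL2, fun x y => ?_, fun s => ?_⟩
  · rw [add_sub_add_left_eq_sub, intervalIntegral.integral_interval_sub_left (hGi _ _) (hGi _ _)]
  · have h1 : ∫ y in (a + 2)..(s + 2), G y = r * ∫ y in a..s, G y := by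
      rw [← intervalIntegral.integral_comp_add_right, ← intervalIntegral.integral_const_mul]
      simp only [hGper]
    beta_reduce
    rw [← intervalIntegral.integral_add_adjacent_intervals (hGi a (a + 2)) (hGi (a + 2) (s + 2)),
      h1, ← hI]
    field_simp
    ring

/-- Integration by parts for a real indefinite integral against a complex function. -/
theorem integral_primitive_mul_deriv_complex {a b : ℝ} {F G : ℝ → ℝ} {m : ℝ → ℂ}
    (hG : IntervalIntegrable G volume a b)
    (hF : ∀ x y, F y - F x = ∫ s in x..y, G s) (hm : ContDiff ℝ 1 m) :
    ∫ x in a..b, (F x : ℂ) * deriv m x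
      = F b * m b - F a * m a - ∫ x in a..b, (G x : ℂ) * m x := by
  have hFc : ContinuousOn F (uIcc a b) := by
    have h1 := intervalIntegral.continuousOn_primitive_interval' hG (left_mem_uIcc)
    refine ((continuousOn_const (c := F a)).add h1).congr fun x _ => ?_
    have := hF a x
    simp only [Pi.add_apply]
    linarith
  have hmd : Continuous (deriv m) := hm.continuous_deriv le_rfl
  have hd : ∀ x, HasDerivAt m (deriv m x) x := fun x =>
    (hm.differentiable one_ne_zero x).hasDerivAt
  have hi1 : IntervalIntegrable (fun x => (F x : ℂ) * deriv m x) volume a b :=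
    ((Complex.continuous_ofReal.comp_continuousOn hFc).mul hmd.continuousOn).intervalIntegrable
  have hGc : IntervalIntegrable (fun x => (G x : ℂ)) volume a b := ⟨hG.1.ofReal, hG.2.ofReal⟩
  have hi2 : IntervalIntegrable (fun x => (G x : ℂ) * m x) volume a b :=
    hGc.mul_continuousOn hm.continuous.continuousOn
  have key : ∀ R : ℂ →L[ℝ] ℝ, (∀ (x : ℝ) (z : ℂ), R (x * z) = x * R z) →
      R (∫ x in a..b, (F x : ℂ) * deriv m x)
        = R (F b * m b - F a * m a - ∫ x in a..b, (G x : ℂ) * m x) := by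
    intro R hR
    have h1 := integral_primitive_mul_deriv (w := F) (m := fun x => R (m x)) hG
      (fun x _ => by rw [← hF]; ring) (R.contDiff.comp hm)
    have h2 : ∀ x, deriv (fun x => R (m x)) x = R (deriv m x) := fun x =>
      (R.hasFDerivAt.comp_hasDerivAt x (hd x)).deriv
    simp only [h2] at h1
    rw [map_sub, map_sub, hR, hR, ← R.intervalIntegral_comp_comm hi1,
      ← R.intervalIntegral_comp_comm hi2]
    simp only [hR]
    exact h1
  apply Complex.ext
  · exact key Complex.reCLM (fun x z => by simp)
  · exact key Complex.imCLM (fun x z => by simp)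

/-- The reciprocals of an arithmetic progression in the imaginary direction are square summable; a
vanishing term does no harm, since its reciprocal is `0`. -/
theorem summable_inv_norm_sq_add_int_mul_pi (w : ℂ) :
    Summable fun n : ℤ => (‖w + n * (Real.pi * Complex.I)‖⁻¹) ^ 2 := by
  set x : ℝ := w.im / Real.pi with hx
  have h1 : Summable fun n : ℤ => (Real.pi⁻¹) ^ 2 * (1 / |(n : ℝ) + x| ^ (2 : ℝ)) :=
    ((Real.summable_one_div_int_add_rpow x 2).2 (by norm_num)).mul_left _
  apply Summable.of_norm_bounded_eventually h1
  have hfin : {n : ℤ | (n : ℝ) + x = 0}.Finite := by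
    apply Set.Subsingleton.finite
    intro n hn m hm
    have h2 : (n : ℝ) = m := by
      have e1 : (n : ℝ) + x = 0 := hn
      have e2 : (m : ℝ) + x = 0 := hm
      linarith
    exact_mod_cast h2
  filter_upwards [hfin.compl_mem_cofinite] with n hn
  have hn' : (n : ℝ) + x ≠ 0 := hn
  have hpi := Real.pi_pos
  have him : (w + n * (Real.pi * Complex.I)).im = Real.pi * (n + x) := by
    simp [hx]
    field_simp
    ring
  have h3 : Real.pi * |(n : ℝ) + x| ≤ ‖w + n * (Real.pi * Complex.I)‖ := by
    have := Complex.abs_im_le_norm (w + n * (Real.pi * Complex.I))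
    rwa [him, abs_mul, abs_of_pos hpi] at this
  have h4 : 0 < Real.pi * |(n : ℝ) + x| := mul_pos hpi (abs_pos.2 hn')
  rw [norm_pow, norm_inv, norm_norm, Real.rpow_two, one_div, ← inv_pow, ← mul_pow, ← mul_inv]
  gcongr

/-- Parseval and pointwise convergence for a quasi-periodic profile `F` with square integrable
derivative `G`. Here `F(s) e^{-om(0) s}` is `2`-periodic, its Fourier coefficients are found by
integration by parts, and they are summable as products of two square summable sequences. -/
theorem hasSum_quasiPeriodic {F G : ℝ → ℝ} {a r : ℝ} (hGm : Measurable G)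
    (hG : ∀ c d, MemLp G 2 (volume.restrict (Ioc c d))) (hF : ∀ x y, F y - F x = ∫ s in x..y, G s)
    (hFper : ∀ s, F (s + 2) = r * F s) {om : ℤ → ℂ} (hom : ∀ n, om n = om 0 + n * (Real.pi * Complex.I))
    (hom0 : ∀ n, om n ≠ 0) (homr : ∀ n, Complex.exp (2 * om n) = r) {c : ℤ → ℂ}
    (hc : ∀ n, c n = 1 / (2 * om n) * ∫ s in a..a + 2, (G s : ℂ) * Complex.exp (-om n * s)) :
    (∀ s : ℝ, HasSum (fun n => c n * Complex.exp (om n * s)) (F s : ℂ)) ∧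
      HasSum (fun n => ‖om n * c n‖ ^ 2)
        (1 / 2 * ∫ s in a..a + 2, G s ^ 2 * Real.exp (-(2 * (om 0).re * s))) := by
  have hGi : ∀ c d, IntervalIntegrable G volume c d := fun c d =>
    ⟨(hG c d).integrable (by norm_num), (hG d c).integrable (by norm_num)⟩
  have hab : a < a + 2 := by linarith
  have hexp : ∀ n (s : ℝ), Complex.exp (-om n * s)
      = Complex.exp (-(n * Real.pi * Complex.I * s)) * Complex.exp (-om 0 * s) := by
    intro n s
    rw [← Complex.exp_add, hom n]
    congr 1; ring
  -- Parseval
  set Q : ℝ → ℂ := fun s => G s * Complex.exp (-om 0 * s) with hQ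
  have hQnorm : ∀ s, ‖Q s‖ ^ 2 = G s ^ 2 * Real.exp (-(2 * (om 0).re * s)) := by
    intro s
    simp only [hQ]
    rw [norm_mul, Complex.norm_exp, mul_pow, Complex.norm_real, Real.norm_eq_abs, sq_abs,
      ← Real.exp_nat_mul]
    congr 2
    simp
    ring
  have hQL : MemLp Q 2 (volume.restrict (Ioc a (a + 2))) := by
    have hm : AEStronglyMeasurable Q (volume.restrict (Ioc a (a + 2))) := by
      apply Measurable.aestronglyMeasurable
      have : Measurable fun s => (G s : ℂ) := Complex.measurable_ofReal.comp hGm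
      fun_prop
    rw [memLp_two_iff_integrable_sq_norm hm]
    simp only [hQnorm]
    have h1 : IntervalIntegrable (fun s => G s ^ 2) volume a (a + 2) := by
      rw [intervalIntegrable_iff_integrableOn_Ioc_of_le hab.le]
      exact (hG a (a + 2)).integrable_sq
    exact (h1.mul_continuousOn (Continuous.continuousOn (by fun_prop))).1
  have hpars := hasSum_sq_fourierCoeffOn hab hQL
  have hcoef : ∀ n, fourierCoeffOn hab Q n = om n * c n := by
    intro n
    rw [fourierCoeffOn_eq_integral, hc]
    have e1 : ∀ s : ℝ, fourier (-n) (s : AddCircle (a + 2 - a)) • Q s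
        = (G s : ℂ) * Complex.exp (-om n * s) := by
      intro s
      rw [fourier_coe_apply, hexp n s, smul_eq_mul]
      simp only [hQ]
      have : (2 * (Real.pi : ℂ) * Complex.I * ((-n : ℤ) : ℂ) * s / ((a + 2 - a : ℝ) : ℂ))
          = -(n * Real.pi * Complex.I * s) := by
        rw [show (a + 2 - a : ℝ) = 2 by ring]
        push_cast
        ring
      rw [this]
      ring
    simp only [e1]
    have := hom0 n
    rw [show (1 / (a + 2 - a) : ℝ) = 1 / 2 by ring_nf, Complex.real_smul]
    push_cast
    field_simp
  have hsum2 : HasSum (fun n => ‖om n * c n‖ ^ 2)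
      (1 / 2 * ∫ s in a..a + 2, G s ^ 2 * Real.exp (-(2 * (om 0).re * s))) := by
    simp only [hcoef, hQnorm] at hpars
    convert hpars using 1
    rw [smul_eq_mul]
    ring_nf
  refine ⟨?_, hsum2⟩
  -- the continuous periodic function
  have hFc : Continuous F := by
    have h1 : F = fun y => F 0 + ∫ z in (0 : ℝ)..y, G z := funext fun y => by rw [← hF]; ring
    rw [h1]
    exact continuous_const.add (intervalIntegral.continuous_primitive hGi 0)
  set P : ℝ → ℂ := fun s => F s * Complex.exp (-om 0 * s) with hP
  have hPc : Continuous P := by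
    have : Continuous fun s => (F s : ℂ) := Complex.continuous_ofReal.comp hFc
    fun_prop
  have hPper : Function.Periodic P 2 := by
    intro s
    simp only [hP]
    rw [hFper]
    push_cast
    rw [mul_add, Complex.exp_add, ← homr 0]
    have : Complex.exp (-om 0 * 2) * Complex.exp (2 * om 0) = 1 := by
      rw [← Complex.exp_add]; ring_nf; exact Complex.exp_zero
    linear_combination (F s * Complex.exp (-om 0 * s)) * this
  have : Fact ((0 : ℝ) < 2) := ⟨by norm_num⟩
  set Pc : C(AddCircle (2 : ℝ), ℂ) := ⟨hPper.lift, continuous_coinduced_dom.2 hPc⟩ with hPcdef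
  have hPcoe : ∀ s : ℝ, Pc (s : AddCircle (2 : ℝ)) = P s := fun s => rfl
  have hfour : ∀ (n : ℤ) (s : ℝ), fourier n (s : AddCircle (2 : ℝ))
      = Complex.exp (n * Real.pi * Complex.I * s) := by
    intro n s
    rw [fourier_coe_apply]
    congr 1
    push_cast
    ring
  have hPcoef : ∀ n, fourierCoeff Pc n = c n := by
    intro n
    rw [fourierCoeff_eq_intervalIntegral Pc n a]
    have e1 : ∀ s : ℝ, fourier (-n) (s : AddCircle (2 : ℝ)) • Pc (s : AddCircle (2 : ℝ))
        = (F s : ℂ) * Complex.exp (-om n * s) := by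
      intro s
      rw [hPcoe, hfour, hexp n s, smul_eq_mul]
      simp only [hP]
      push_cast
      ring_nf
    simp only [e1]
    set m : ℝ → ℂ := fun s => -(om n)⁻¹ * Complex.exp (-om n * s) with hm
    have hmd : ∀ s : ℝ, HasDerivAt m (Complex.exp (-om n * s)) s := by
      intro s
      have h1 : HasDerivAt (fun s : ℝ => -om n * (s : ℂ)) (-om n * 1) s :=
        ((hasDerivAt_id (s : ℂ)).comp_ofReal).const_mul (-om n)
      have h2 := (h1.cexp).const_mul (-(om n)⁻¹)
      refine h2.congr_deriv ?_
      have := hom0 n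
      field_simp
    have hmder : deriv m = fun s : ℝ => Complex.exp (-om n * s) := funext fun s => (hmd s).deriv
    have hm1 : ContDiff ℝ 1 m := by
      rw [contDiff_one_iff_deriv, hmder]
      exact ⟨fun s => (hmd s).differentiableAt, by fun_prop⟩
    have ibp := integral_primitive_mul_deriv_complex (hGi a (a + 2)) hF hm1
    rw [hmder] at ibp
    -- the boundary terms cancel, by quasi-periodicity
    have hbdry : (F (a + 2) : ℂ) * m (a + 2) = F a * m a := by
      rw [hFper]
      simp only [hm]
      push_cast
      rw [mul_add, Complex.exp_add, ← homr n]
      have : Complex.exp (-om n * 2) * Complex.exp (2 * om n) = 1 := by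
        rw [← Complex.exp_add]; ring_nf; exact Complex.exp_zero
      linear_combination (-(F a * (om n)⁻¹ * Complex.exp (-om n * a))) * this
    rw [ibp, hbdry, sub_self, zero_sub, hc]
    have e2 : ∫ s in a..a + 2, (G s : ℂ) * m s
        = -(om n)⁻¹ * ∫ s in a..a + 2, (G s : ℂ) * Complex.exp (-om n * s) := by
      rw [← intervalIntegral.integral_const_mul]
      congr 1; ext s; simp only [hm]; ring
    rw [e2, Complex.real_smul]
    have := hom0 n
    push_cast
    field_simp
  -- `|c_n| = |om_n c_n| |om_n|⁻¹` is a product of two square summable sequences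
  have hsummable : Summable c := by
    have h1 : Summable fun n => (‖om n‖⁻¹) ^ 2 := by
      have := summable_inv_norm_sq_add_int_mul_pi (om 0)
      refine this.congr fun n => by rw [hom n]
    have h2 := (hsum2.summable.add h1)
    apply Summable.of_norm_bounded h2
    intro n
    have h3 : ‖c n‖ = ‖om n * c n‖ * ‖om n‖⁻¹ := by
      have := norm_ne_zero_iff.2 (hom0 n)
      rw [norm_mul]
      field_simp
    rw [h3]
    nlinarith [sq_nonneg (‖om n * c n‖ - ‖om n‖⁻¹), sq_nonneg (‖om n * c n‖), sq_nonneg (‖om n‖⁻¹)]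
  intro s
  have hps := has_pointwise_sum_fourier_series_of_summable (f := Pc)
    (by simpa only [funext hPcoef] using hsummable) (s : AddCircle (2 : ℝ))
  have h1 := hps.mul_right (Complex.exp (om 0 * s))
  rw [hPcoe] at h1
  have h2 : P s * Complex.exp (om 0 * s) = F s := by
    simp only [hP]
    rw [mul_assoc, ← Complex.exp_add]
    simp
  rw [h2] at h1
  refine h1.congr_fun ?_
  intro n
  rw [hPcoef, hfour, smul_eq_mul, mul_assoc, ← Complex.exp_add, hom n]
  congr 2
  ring

/-! ### The moving end and the phase -/

/-- The left end `t - ℓ(t)` of the characteristic interval moves to the right, since `|ℓ'| < 1`, so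
it stays in the half line on which the phase is defined. -/
theorem neg_le_sub_of_abs_derivWithin_lt_one {ℓ : ℝ → ℝ} (hd : DifferentiableOn ℝ ℓ (Ici 0))
    (hd1 : ∀ t, 0 ≤ t → |derivWithin ℓ (Ici 0) t| < 1) {t : ℝ} (ht : 0 ≤ t) :
    -ℓ 0 ≤ t - ℓ t := by
  have hmono : MonotoneOn (fun t => t - ℓ t) (Ici 0) := by
    apply monotoneOn_of_deriv_nonneg (convex_Ici 0)
    · exact continuousOn_id.sub hd.continuousOn
    · rw [interior_Ici]
      exact differentiableOn_id.sub (hd.mono Ioi_subset_Ici_self)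
    · rw [interior_Ici]
      intro s hs
      have h1 : HasDerivAt ℓ (derivWithin ℓ (Ici 0) s) s :=
        (hd s (Ioi_subset_Ici_self hs)).hasDerivWithinAt.hasDerivAt (Ici_mem_nhds hs)
      have h2 : HasDerivAt (fun t => t - ℓ t) (1 - derivWithin ℓ (Ici 0) s) s :=
        (hasDerivAt_id' s).sub h1
      rw [h2.deriv]
      have := (abs_lt.1 (hd1 s (le_of_lt hs))).2
      linarith
  have := hmono (mem_Ici.2 le_rfl) (mem_Ici.2 ht) ht
  simpa using this

/-- The velocity of the moving end is continuous: differentiating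
`φ(t + ℓ(t)) - φ(t - ℓ(t)) = 2` expresses it through `φ'`. -/
theorem movingEnd_of_moore {ℓ φ : ℝ → ℝ} {T : ℝ} (hT : 0 < T) (hpos : ∀ t, 0 ≤ t → 0 < ℓ t)
    (hd : DifferentiableOn ℝ ℓ (Ici 0)) (hd1 : ∀ t, 0 ≤ t → |derivWithin ℓ (Ici 0) t| < 1)
    (hφ : ContDiffOn ℝ 1 φ (Ici (-ℓ 0)))
    (hφ' : ∀ x, -ℓ 0 ≤ x → 0 < derivWithin φ (Ici (-ℓ 0)) x)
    (hM : ∀ t, 0 ≤ t → φ (t + ℓ t) - φ (t - ℓ t) = 2) :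
    MovingEnd ℓ (derivWithin ℓ (Ici 0)) T := by
  set ℓd := derivWithin ℓ (Ici 0) with hℓd
  set φd := derivWithin φ (Ici (-ℓ 0)) with hφd
  have hℓh : ∀ t, 0 ≤ t → HasDerivWithinAt ℓ (ℓd t) (Ici 0) t := fun t ht =>
    (hd t ht).hasDerivWithinAt
  have hφc : ContinuousOn φd (Ici (-ℓ 0)) :=
    hφ.continuousOn_derivWithin (uniqueDiffOn_Ici _) le_rfl
  have hφh : ∀ x, -ℓ 0 ≤ x → HasDerivWithinAt φ (φd x) (Ici (-ℓ 0)) x := fun x hx =>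
    (hφ.differentiableOn one_ne_zero x hx).hasDerivWithinAt
  have hβ : MapsTo (fun t => t - ℓ t) (Ici 0) (Ici (-ℓ 0)) := fun t ht =>
    neg_le_sub_of_abs_derivWithin_lt_one hd hd1 ht
  have hα : MapsTo (fun t => t + ℓ t) (Ici 0) (Ici (-ℓ 0)) := fun t ht => by
    have h1 := hpos t ht
    have h2 := hpos 0 le_rfl
    have h3 : (0 : ℝ) ≤ t := ht
    simp only [mem_Ici]
    linarith
  have hform : ∀ t ∈ Ici (0 : ℝ), ℓd t
      = (φd (t - ℓ t) - φd (t + ℓ t)) / (φd (t + ℓ t) + φd (t - ℓ t)) := by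
    intro t ht
    have h1 := (hφh _ (hα ht)).comp t ((hasDerivWithinAt_id t (Ici 0)).add (hℓh t ht)) hα
    have h2 := (hφh _ (hβ ht)).comp t ((hasDerivWithinAt_id t (Ici 0)).sub (hℓh t ht)) hβ
    have h3 : HasDerivWithinAt (fun _ : ℝ => (2 : ℝ))
        (φd (t + ℓ t) * (1 + ℓd t) - φd (t - ℓ t) * (1 - ℓd t)) (Ici 0) t :=
      (h1.sub h2).congr (fun s hs => (hM s hs).symm) (hM t ht).symm
    have h4 := (uniqueDiffOn_Ici (0 : ℝ) t ht).eq_deriv _ h3 (hasDerivWithinAt_const t _ 2)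
    have p1 := hφ' _ (hα ht)
    have p2 := hφ' _ (hβ ht)
    rw [eq_div_iff (by positivity)]
    linarith
  refine ⟨hT, fun t ht => hpos t ht.1, fun t ht => hℓh t ht.1, ?_, fun t ht => hd1 t ht.1⟩
  have c1 : ContinuousOn (fun t => φd (t + ℓ t)) (Ici 0) :=
    hφc.comp (continuousOn_id.add hd.continuousOn) hα
  have c2 : ContinuousOn (fun t => φd (t - ℓ t)) (Ici 0) :=
    hφc.comp (continuousOn_id.sub hd.continuousOn) hβ
  refine (((c2.sub c1).div (c1.add c2) fun t ht => ?_).congr hform).mono Icc_subset_Ici_self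
  have p1 := hφ' _ (hα ht)
  have p2 := hφ' _ (hβ ht)
  exact (add_pos p1 p2).ne'

/-- A `C¹` function with positive derivative on a half line coincides on a compact interval with a
`C¹` diffeomorphism of `ℝ` (it is continued with constant slope on both sides). -/
theorem exists_diffeomorph_eqOn_Icc {φ : ℝ → ℝ} {A B : ℝ} (hAB : A ≤ B)
    (hφ : ContDiffOn ℝ 1 φ (Ici A)) (hφ' : ∀ x, A ≤ x → 0 < derivWithin φ (Ici A) x) :
    ∃ Φ Ψ : ℝ → ℝ, ContDiff ℝ 1 Φ ∧ (∀ x, 0 < deriv Φ x) ∧ (∀ x, Ψ (Φ x) = x) ∧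
      (∀ s, Φ (Ψ s) = s) ∧ ContDiff ℝ 1 Ψ ∧
      ∀ x ∈ Icc A B, Φ x = φ x ∧ deriv Φ x = derivWithin φ (Ici A) x := by
  set φd := derivWithin φ (Ici A) with hφd
  have hφc : ContinuousOn φd (Ici A) :=
    hφ.continuousOn_derivWithin (uniqueDiffOn_Ici _) le_rfl
  set d : ℝ → ℝ := fun x => φd (max A (min x B)) with hd
  have hdc : Continuous d := hφc.comp_continuous (by fun_prop) fun x => mem_Ici.2 (le_max_left _ _)
  have hdeq : ∀ x ∈ Icc A B, d x = φd x := fun x hx => by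
    simp only [hd]
    rw [min_eq_left hx.2, max_eq_right hx.1]
  obtain ⟨c, hc, hcd⟩ : ∃ c, 0 < c ∧ ∀ x, c ≤ d x := by
    obtain ⟨x0, hx0, hmin⟩ := isCompact_Icc.exists_isMinOn (nonempty_Icc.2 hAB)
      (hφc.mono Icc_subset_Ici_self)
    refine ⟨φd x0, hφ' _ hx0.1, fun x => hmin ⟨le_max_left _ _, max_le hAB (min_le_right _ _)⟩⟩
  set Φ : ℝ → ℝ := fun x => φ A + ∫ y in A..x, d y with hΦ
  have hΦd : ∀ x, HasDerivAt Φ (d x) x := fun x =>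
    (hdc.integral_hasStrictDerivAt A x).hasDerivAt.const_add _
  have hderiv : deriv Φ = d := funext fun x => (hΦd x).deriv
  have hdiff : Differentiable ℝ Φ := fun x => (hΦd x).differentiableAt
  have hpos : ∀ x, 0 < d x := fun x => hc.trans_le (hcd x)
  have hmono : StrictMono Φ := strictMono_of_deriv_pos fun x => by rw [hderiv]; exact hpos x
  have hgrow := mul_sub_le_image_sub_of_le_deriv hdiff (C := c) fun x => by rw [hderiv]; exact hcd x
  have hsurj : Function.Surjective Φ := by
    apply hdiff.continuous.surjective
    · have h1 : Tendsto (fun x => Φ 0 + c * x) atTop atTop :=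
        tendsto_atTop_add_const_left _ _ (tendsto_id.const_mul_atTop hc)
      refine tendsto_atTop_mono' _ ?_ h1
      filter_upwards [eventually_ge_atTop 0] with x hx
      have := hgrow hx
      rw [sub_zero] at this
      linarith
    · have h1 : Tendsto (fun x => Φ 0 + c * x) atBot atBot :=
        tendsto_atBot_add_const_left _ _ (tendsto_id.const_mul_atBot hc)
      refine tendsto_atBot_mono' _ ?_ h1
      filter_upwards [eventually_le_atBot 0] with x hx
      have := hgrow hx
      rw [zero_sub] at this
      linarith
  set e := hmono.orderIsoOfSurjective Φ hsurj with he
  have hl : ∀ x, e.symm (Φ x) = x := fun x => e.symm_apply_apply x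
  have hr : ∀ s, Φ (e.symm s) = s := fun s => e.apply_symm_apply s
  have hinv : ∀ s, HasDerivAt (e.symm : ℝ → ℝ) (d (e.symm s))⁻¹ s := fun s =>
    HasDerivAt.of_local_left_inverse e.symm.continuous.continuousAt (hΦd _) (hpos _).ne'
      (Eventually.of_forall hr)
  refine ⟨Φ, e.symm, ?_, fun x => by rw [hderiv]; exact hpos x, hl, hr, ?_, fun x hx => ⟨?_, ?_⟩⟩
  · rw [contDiff_one_iff_deriv, hderiv]
    exact ⟨hdiff, hdc⟩
  · rw [contDiff_one_iff_deriv]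
    refine ⟨fun s => (hinv s).differentiableAt, ?_⟩
    rw [show deriv (e.symm : ℝ → ℝ) = fun s => (d (e.symm s))⁻¹ from
      funext fun s => (hinv s).deriv]
    exact (hdc.comp e.symm.continuous).inv₀ fun s => (hpos _).ne'
  · have h1 : ∫ y in A..x, d y = φ x - φ A := by
      apply intervalIntegral.integral_eq_sub_of_hasDeriv_right_of_le hx.1
        (hφ.continuousOn.mono Icc_subset_Ici_self)
      · intro y hy
        rw [hdeq y ⟨hy.1.le, hy.2.le.trans hx.2⟩]
        exact ((hφ.differentiableOn one_ne_zero y hy.1.le).hasDerivWithinAt).mono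
          (fun z hz => hy.1.le.trans (le_of_lt hz))
      · exact hdc.intervalIntegrable _ _
    simp only [hΦ]
    rw [h1]
    ring
  · rw [hderiv, hdeq x hx]

/-! ### Change of variables by the phase -/

namespace StraighteningPhase

variable {ℓ Φ Ψ : ℝ → ℝ} {T : ℝ}

theorem hasDerivAt (h : StraighteningPhase ℓ Φ Ψ T) (x : ℝ) : HasDerivAt Φ (deriv Φ x) x :=
  (h.contDiff.differentiable one_ne_zero x).hasDerivAt

theorem continuous_deriv (h : StraighteningPhase ℓ Φ Ψ T) : Continuous (deriv Φ) :=
  h.contDiff.continuous_deriv le_rfl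

theorem deriv_inv (h : StraighteningPhase ℓ Φ Ψ T) (x : ℝ) : deriv Ψ (Φ x) * deriv Φ x = 1 := by
  have h1 := ((h.contDiff_inv.differentiable one_ne_zero (Φ x)).hasDerivAt).comp x (h.hasDerivAt x)
  have h2 : Ψ ∘ Φ = id := funext h.left_inv
  rw [h2] at h1
  exact h1.unique (hasDerivAt_id x)

theorem integral_deriv_mul_comp {E : Type*} [NormedAddCommGroup E] [NormedSpace ℝ E]
    (h : StraighteningPhase ℓ Φ Ψ T) (g : ℝ → E) {x y : ℝ} (hxy : x ≤ y) :
    ∫ z in x..y, deriv Φ z • g (Φ z) = ∫ s in Φ x..Φ y, g s := by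
  rw [intervalIntegral.integral_of_le hxy, intervalIntegral.integral_of_le (h.strictMono.monotone hxy),
    ← integral_Icc_eq_integral_Ioc, ← integral_Icc_eq_integral_Ioc]
  exact integral_Icc_deriv_smul_of_deriv_nonneg h.contDiff.continuous.continuousOn
    (fun z _ => h.hasDerivAt z) (fun z _ => (h.deriv_pos z).le) hxy

theorem integrableOn_deriv_mul_comp_iff (h : StraighteningPhase ℓ Φ Ψ T) (g : ℝ → ℝ) {x y : ℝ}
    (hxy : x ≤ y) :
    IntegrableOn (fun z => deriv Φ z * g (Φ z)) (Icc x y) ↔ IntegrableOn g (Icc (Φ x) (Φ y)) :=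
  integrableOn_Icc_deriv_smul_iff_of_deriv_nonneg h.contDiff.continuous.continuousOn
    (fun z _ => h.hasDerivAt z) (fun z _ => (h.deriv_pos z).le) hxy

/-- The profile `G` in the straightened variable becomes the profile `(G ∘ Φ) Φ'`. -/
theorem memLp_mul_deriv (h : StraighteningPhase ℓ Φ Ψ T) {G : ℝ → ℝ} (hGm : Measurable G)
    {x y : ℝ} (hxy : x ≤ y) (hG : MemLp G 2 (volume.restrict (Icc (Φ x) (Φ y)))) :
    MemLp (fun z => G (Φ z) * deriv Φ z) 2 (volume.restrict (Icc x y)) := by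
  have hm : Measurable fun z => G (Φ z) * deriv Φ z :=
    (hGm.comp h.contDiff.continuous.measurable).mul h.continuous_deriv.measurable
  rw [memLp_two_iff_integrable_sq hm.aestronglyMeasurable]
  have h1 := (h.integrableOn_deriv_mul_comp_iff (fun s => G s ^ 2) hxy).2 hG.integrable_sq
  refine (h1.mul_continuousOn h.continuous_deriv.continuousOn isCompact_Icc).congr
    (Eventually.of_forall fun z => ?_)
  simp only
  ring

/-- The profile `e` in space becomes the profile `(e ∘ Ψ) Ψ'` in the straightened variable. -/
theorem memLp_inv_mul_deriv (h : StraighteningPhase ℓ Φ Ψ T) {e : ℝ → ℝ} (hem : Measurable e)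
    {x y : ℝ} (hxy : x ≤ y) (he : MemLp e 2 (volume.restrict (Icc x y))) :
    MemLp (fun s => e (Ψ s) * deriv Ψ s) 2 (volume.restrict (Icc (Φ x) (Φ y))) := by
  have hm : Measurable fun s => e (Ψ s) * deriv Ψ s :=
    (hem.comp h.contDiff_inv.continuous.measurable).mul
      (h.contDiff_inv.continuous_deriv le_rfl).measurable
  rw [memLp_two_iff_integrable_sq hm.aestronglyMeasurable]
  refine (h.integrableOn_deriv_mul_comp_iff (fun s => (e (Ψ s) * deriv Ψ s) ^ 2) hxy).1 ?_
  have hc : Continuous fun z => deriv Ψ (Φ z) :=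
    (h.contDiff_inv.continuous_deriv le_rfl).comp h.contDiff.continuous
  have he2 : IntegrableOn (fun z => e z ^ 2) (Icc x y) volume := he.integrable_sq
  refine (he2.mul_continuousOn hc.continuousOn isCompact_Icc).congr (Eventually.of_forall fun z => ?_)
  simp only
  rw [h.left_inv]
  have := h.deriv_inv z
  linear_combination (-(e z ^ 2 * deriv Ψ (Φ z))) * this

/-- The profile of the wave on a bounded range: `f = F ∘ Φ` there, with square integrable
derivative `p`, cut off outside of the range. -/
theorem exists_wave_profile (h : StraighteningPhase ℓ Φ Ψ T) {F G : ℝ → ℝ} (hGm : Measurable G)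
    (hG : ∀ c d, MemLp G 2 (volume.restrict (Ioc c d)))
    (hF : ∀ x y, F y - F x = ∫ s in x..y, G s) {A B : ℝ} (hAB : A ≤ B) :
    ∃ f p : ℝ → ℝ, Measurable p ∧ MemLp p 2 volume ∧ (∀ x y, f y - f x = ∫ z in x..y, p z) ∧
      (∀ x ∈ Icc A B, f x = F (Φ x)) ∧ ∀ x ∈ Icc A B, p x = G (Φ x) * deriv Φ x := by
  have hm : Measurable fun z => G (Φ z) * deriv Φ z :=
    (hGm.comp h.contDiff.continuous.measurable).mul h.continuous_deriv.measurable
  set p : ℝ → ℝ := (Icc A B).indicator fun z => G (Φ z) * deriv Φ z with hp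
  have hpL : MemLp p 2 volume := by
    rw [hp, memLp_indicator_iff_restrict measurableSet_Icc]
    apply h.memLp_mul_deriv hGm hAB
    rw [← restrict_Ioc_eq_restrict_Icc]
    exact hG _ _
  have hpA : ∀ x ∈ Icc A B, p x = G (Φ x) * deriv Φ x := fun x hx => indicator_of_mem hx _
  refine ⟨fun x => F (Φ A) + ∫ z in A..x, p z, p, hm.indicator measurableSet_Icc, hpL,
    fun x y => ?_, fun x hx => ?_, hpA⟩
  · rw [add_sub_add_left_eq_sub, intervalIntegral.integral_interval_sub_left
      hpL.intervalIntegrable_two hpL.intervalIntegrable_two]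
  · have h1 : ∫ z in A..x, p z = ∫ z in A..x, deriv Φ z • G (Φ z) := by
      apply intervalIntegral.integral_congr
      intro z hz
      rw [uIcc_of_le hx.1] at hz
      simp only [smul_eq_mul]
      rw [hpA z ⟨hz.1, hz.2.trans hx.2⟩, mul_comm]
    simp only
    rw [h1, h.integral_deriv_mul_comp G hx.1, ← hF]
    ring

end StraighteningPhase

/-! ### The exponents `ω_n` and the initial data -/

theorem omegaN_eq_add (η : ℝ) (n : ℤ) :
    omegaN η n = omegaN η 0 + n * (Real.pi * Complex.I) := by
  unfold omegaN
  split_ifs <;> push_cast <;> ring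

theorem omegaN_re (η : ℝ) (n : ℤ) : (omegaN η n).re = -(1 / 2) * Real.log |gammaEta η| := by
  unfold omegaN
  split_ifs <;> simp [div_eq_mul_inv]

theorem abs_gammaEta {η : ℝ} (hη : 0 ≤ η) : |gammaEta η| = (1 + η) / |1 - η| := by
  rw [gammaEta, abs_div, abs_of_pos (by linarith : (0 : ℝ) < 1 + η)]

theorem omegaN_ne_zero {η : ℝ} (hη : 0 ≤ η) (hη1 : η ≠ 1) (n : ℤ) : omegaN η n ≠ 0 := by
  intro h0
  rcases lt_or_gt_of_ne hη1 with h | h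
  · have him : (omegaN η n).im = (2 * n + 1) / 2 * Real.pi := by
      unfold omegaN
      rw [if_pos h]
      simp [div_eq_mul_inv]
    rw [h0, Complex.zero_im, eq_comm, mul_eq_zero, or_iff_left Real.pi_ne_zero] at him
    have h1 : ((2 * n + 1 : ℤ) : ℝ) = 0 := by push_cast; linarith
    have h2 : 2 * n + 1 = 0 := by exact_mod_cast h1
    omega
  · have hre := omegaN_re η n
    rw [h0, Complex.zero_re] at hre
    have h1 : 1 < |gammaEta η| := by
      rw [abs_gammaEta hη, abs_of_neg (by linarith), one_lt_div (by linarith)]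
      linarith
    have := Real.log_pos h1
    linarith

/-- `e^{2 ω_n} = -1 / γ_η`, the reflection coefficient of the moving end. -/
theorem exp_two_mul_omegaN {η : ℝ} (hη : 0 ≤ η) (hη1 : η ≠ 1) (n : ℤ) :
    Complex.exp (2 * omegaN η n) = ((-(1 - η) / (1 + η) : ℝ) : ℂ) := by
  have hlog : ∀ x : ℝ, 0 < x → Complex.exp (-((Real.log x : ℝ) : ℂ)) = ((x⁻¹ : ℝ) : ℂ) := by
    intro x hx
    rw [← Complex.ofReal_neg, ← Complex.ofReal_exp, Real.exp_neg, Real.exp_log hx]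
  have h1 : (0 : ℝ) < 1 + η := by linarith
  have hγ : 0 < |gammaEta η| := by
    rw [abs_gammaEta hη]
    exact div_pos h1 (abs_pos.2 (sub_ne_zero.2 hη1.symm))
  unfold omegaN
  rcases lt_or_gt_of_ne hη1 with h | h
  · rw [if_pos h, show 2 * (-(1 / 2) * ((Real.log |gammaEta η| : ℝ) : ℂ)
        + (2 * (n : ℂ) + 1) / 2 * Complex.I * (Real.pi : ℂ))
        = -((Real.log |gammaEta η| : ℝ) : ℂ) + (Real.pi * Complex.I
          + n * (2 * Real.pi * Complex.I)) by ring,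
      Complex.exp_add, hlog _ hγ, Complex.exp_add, Complex.exp_int_mul_two_pi_mul_I,
      Complex.exp_pi_mul_I, abs_gammaEta hη, abs_of_pos (by linarith), inv_div]
    push_cast
    ring
  · rw [if_neg (by linarith), show 2 * (-(1 / 2) * ((Real.log |gammaEta η| : ℝ) : ℂ)
        + (n : ℂ) * Complex.I * (Real.pi : ℂ))
        = -((Real.log |gammaEta η| : ℝ) : ℂ) + n * (2 * Real.pi * Complex.I) by ring,
      Complex.exp_add, hlog _ hγ, Complex.exp_int_mul_two_pi_mul_I,
      abs_gammaEta hη, abs_of_neg (by linarith), inv_div, mul_one]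

theorem extData_of_pos {u0' u1 : ℝ → ℝ} {x : ℝ} (hx : 0 < x) :
    extData u0' u1 x = u0' x + u1 x := by
  rw [extData, abs_of_pos hx, Real.sign_of_pos hx, one_mul]

theorem extData_neg_of_pos {u0' u1 : ℝ → ℝ} {x : ℝ} (hx : 0 < x) :
    extData u0' u1 (-x) = u0' x - u1 x := by
  rw [extData, abs_neg, abs_of_pos hx, Real.sign_of_neg (neg_lt_zero.2 hx)]
  ring

theorem memLp_extData {L : ℝ} {u0' u1 : ℝ → ℝ} (h0 : MemLp u0' 2 (volume.restrict (Ioo 0 L)))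
    (h1 : MemLp u1 2 (volume.restrict (Ioo 0 L))) (hL : 0 < L) :
    MemLp (extData u0' u1) 2 (volume.restrict (Icc (-L) L)) := by
  have hp : MemLp (extData u0' u1) 2 (volume.restrict (Ioo 0 L)) := by
    refine (h0.add h1).ae_eq ?_
    filter_upwards [ae_restrict_mem measurableSet_Ioo] with x hx
    rw [extData_of_pos hx.1, Pi.add_apply]
  have hn : MemLp (extData u0' u1) 2 (volume.restrict (Ioo (-L) 0)) := by
    have hmp : MeasurePreserving (fun x : ℝ => -x) (volume.restrict (Ioo (-L) 0))
        (volume.restrict (Ioo 0 L)) := by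
      have := (Measure.measurePreserving_neg (volume : Measure ℝ)).restrict_preimage
        (measurableSet_Ioo (a := (0 : ℝ)) (b := L))
      simpa using this
    refine ((h0.sub h1).comp_measurePreserving hmp).ae_eq ?_
    filter_upwards [ae_restrict_mem measurableSet_Ioo] with x hx
    have h2 := extData_neg_of_pos (u0' := u0') (u1 := u1) (neg_pos.2 hx.2)
    rw [neg_neg] at h2
    rw [h2, Function.comp_apply, Pi.sub_apply]
  have hae : (Ioo (-L) 0 ∪ Ioo 0 L : Set ℝ) =ᵐ[volume] Icc (-L) L := by
    rw [← Icc_union_Icc_eq_Icc (neg_nonpos.2 hL.le) hL.le]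
    exact Ioo_ae_eq_Icc.union Ioo_ae_eq_Icc
  rw [← Measure.restrict_congr_set hae]
  have hm : AEStronglyMeasurable (extData u0' u1)
      (volume.restrict (Ioo (-L) 0 ∪ Ioo 0 L)) := aestronglyMeasurable_union_iff.2 ⟨hn.1, hp.1⟩
  rw [memLp_two_iff_integrable_sq hm]
  exact IntegrableOn.union hn.integrable_sq hp.integrable_sq

/-- The profile of the solution in the straightened variable: it is quasi-periodic, and on one
period it is given by prescribed data `D` on the interval that the phase maps onto this period. -/
theorem StraighteningPhase.exists_quasiPeriodic_profile {ℓ Φ Ψ : ℝ → ℝ} {T : ℝ}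
    (h : StraighteningPhase ℓ Φ Ψ T) {L : ℝ} (hL : 0 < L) (hΦL : Φ L = Φ (-L) + 2)
    {D : ℝ → ℝ} (hD : MemLp D 2 (volume.restrict (Icc (-L) L))) {r : ℝ} (hr0 : r ≠ 0)
    (hr1 : r ≠ 1) :
    ∃ G F : ℝ → ℝ, Measurable G ∧ (∀ c d, MemLp G 2 (volume.restrict (Ioc c d))) ∧
      (∀ x y, F y - F x = ∫ s in x..y, G s) ∧ (∀ s, F (s + 2) = r * F s) ∧
      ∀ᵐ x, x ∈ Ioo (-L) L → G (Φ x) * deriv Φ x = D x := by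
  set e := hD.1.mk D with he
  have hem : Measurable e := hD.1.stronglyMeasurable_mk.measurable
  have heD : D =ᵐ[volume.restrict (Icc (-L) L)] e := hD.1.ae_eq_mk
  have hLL : -L ≤ L := by linarith
  have hq := h.memLp_inv_mul_deriv hem hLL ((memLp_congr_ae heD).1 hD)
  rw [← restrict_Ioc_eq_restrict_Icc, hΦL] at hq
  have hqm : Measurable fun s => e (Ψ s) * deriv Ψ s :=
    (hem.comp h.contDiff_inv.continuous.measurable).mul
      (h.contDiff_inv.continuous_deriv le_rfl).measurable
  obtain ⟨G, F, hGm, -, hGq, hG2, hF, hFr⟩ := exists_quasiPeriodic_primitive hqm hq hr0 hr1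
  refine ⟨G, F, hGm, hG2, hF, hFr, ?_⟩
  filter_upwards [(ae_restrict_iff' measurableSet_Icc).1 heD] with x hx hxL
  rw [hGq (Φ x) ⟨(h.strictMono hxL.1).le, by rw [← hΦL]; exact h.strictMono hxL.2⟩,
    h.left_inv, hx ⟨hxL.1.le, hxL.2.le⟩, mul_assoc, h.deriv_inv, mul_one]

/-- The d'Alembert wave whose profile derivative at time `0` is half the extended data takes the
initial data. -/
theorem wave_initial_data {L : ℝ} (hL : 0 < L) {u0 u0' u1 f p : ℝ → ℝ} (hu0 : MemV0 L u0 u0')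
    (hp : MemLp p 2 volume) (hf : ∀ x y, f y - f x = ∫ z in x..y, p z)
    (hpD : ∀ᵐ x, x ∈ Ioo (-L) L → p x = 1 / 2 * extData u0' u1 x) :
    (∀ x ∈ Icc 0 L, f (0 + x) - f (0 - x) = u0 x) ∧
      ∀ᵐ x ∂(volume.restrict (Ioo 0 L)), p (0 + x) - p (0 - x) = u1 x := by
  have hpn : ∀ᵐ x, -x ∈ Ioo (-L) L → p (-x) = 1 / 2 * extData u0' u1 (-x) :=
    (Measure.measurePreserving_neg (volume : Measure ℝ)).quasiMeasurePreserving.ae hpD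
  have hmem : ∀ x ∈ Ioo 0 L, x ∈ Ioo (-L) L ∧ -x ∈ Ioo (-L) L := fun x hx =>
    ⟨⟨by linarith [hx.1], hx.2⟩, ⟨by linarith [hx.2], by linarith [hx.1]⟩⟩
  refine ⟨fun x hx => ?_, ?_⟩
  · have hpi : ∀ a b, IntervalIntegrable p volume a b := fun a b => hp.intervalIntegrable_two
    have hpi' : IntervalIntegrable (fun z => p (-z)) volume 0 x :=
      (hp.comp_measurePreserving (Measure.measurePreserving_neg volume)).intervalIntegrable_two
    rw [hu0.eq_integral hL x hx, zero_add, zero_sub, hf,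
      ← intervalIntegral.integral_add_adjacent_intervals (hpi (-x) 0) (hpi 0 x)]
    have h1 : ∫ z in (-x)..0, p z = ∫ z in (0 : ℝ)..x, p (-z) := by
      rw [intervalIntegral.integral_comp_neg, neg_zero]
    rw [h1, ← intervalIntegral.integral_add hpi' (hpi 0 x)]
    apply intervalIntegral.integral_congr_ae
    have hne : ∀ᵐ z : ℝ, z ≠ L := by simp [ae_iff]
    filter_upwards [hpD, hpn, hne] with z h1 h2 h3 hz
    rw [uIoc_of_le hx.1] at hz
    have hz' : z ∈ Ioo 0 L := ⟨hz.1, lt_of_le_of_ne (hz.2.trans hx.2) h3⟩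
    rw [h1 (hmem z hz').1, h2 (hmem z hz').2, extData_of_pos hz.1, extData_neg_of_pos hz.1]
    ring
  · rw [ae_restrict_iff' measurableSet_Ioo]
    filter_upwards [hpD, hpn] with z h1 h2 hz
    rw [zero_add, zero_sub, h1 (hmem z hz).1, h2 (hmem z hz).2, extData_of_pos hz.1,
      extData_neg_of_pos hz.1]
    ring

theorem mainTheorem5
    (ℓ φ : ℝ → ℝ) (η T : ℝ) (u0 u0' u1 : ℝ → ℝ)
    (hη : 0 ≤ η) (hη1 : η ≠ 1) (hT : 0 < T)
    (hℓpos : ∀ t, 0 ≤ t → 0 < ℓ t)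
    (hℓdiff : DifferentiableOn ℝ ℓ (Ici 0))
    (hℓ' : ∀ t, 0 ≤ t → |derivWithin ℓ (Ici 0) t| < 1)
    (hφ : ContDiffOn ℝ 1 φ (Ici (-ℓ 0)))
    (hφ' : ∀ x, -ℓ 0 ≤ x → 0 < derivWithin φ (Ici (-ℓ 0)) x)
    (hMoore : ∀ t, 0 ≤ t → φ (t + ℓ t) - φ (t - ℓ t) = 2)
    (hu0 : MemV0 (ℓ 0) u0 u0')
    (hu1 : MemLp u1 2 (volume.restrict (Ioo 0 (ℓ 0)))) :
    (∃ u : ℝ → ℝ → ℝ,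
      IsSolutionWP ℓ η T u0 u1 u ∧
      (∀ v : ℝ → ℝ → ℝ, IsSolutionWP ℓ η T u0 u1 v →
        ∀ t ∈ Icc 0 T, ∀ x ∈ Icc 0 (ℓ t), v x t = u x t) ∧
      (∀ t ∈ Icc 0 T, ∀ x ∈ Icc 0 (ℓ t),
        HasSum
          (fun n : ℤ => coeffC η (ℓ 0) φ u0' u1 n *
            (Complex.exp (omegaN η n * (φ (t + x) : ℂ))
              - Complex.exp (omegaN η n * (φ (t - x) : ℂ))))
          (u x t : ℂ))) ∧
    IntervalIntegrable
      (fun x => extData u0' u1 x ^ 2 * Real.exp (Real.log |gammaEta η| * φ x)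
        / derivWithin φ (Ici (-ℓ 0)) x) volume (-ℓ 0) (ℓ 0) ∧
    HasSum (fun n : ℤ => ‖omegaN η n * coeffC η (ℓ 0) φ u0' u1 n‖ ^ 2)
      (1 / 8 * ∫ x in (-ℓ 0)..(ℓ 0),
        extData u0' u1 x ^ 2 * Real.exp (Real.log |gammaEta η| * φ x)
          / derivWithin φ (Ici (-ℓ 0)) x) := by
  have hℓ := movingEnd_of_moore hT hℓpos hℓdiff hℓ' hφ hφ' hMoore
  obtain ⟨M, -, hM⟩ := exists_bound_Icc hℓ.continuousOn
  set L := ℓ 0 with hLdef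
  set φd := derivWithin φ (Ici (-L)) with hφd
  have hL : 0 < L := hℓpos 0 le_rfl
  have hLL : -L ≤ L := by linarith
  have h0T : (0 : ℝ) ∈ Icc 0 T := ⟨le_rfl, hT.le⟩
  have hLM : L ≤ M := hM 0 h0T
  have hAB : -L ≤ T + M := by linarith
  have hβ : ∀ t ∈ Icc 0 T, -L ≤ t - ℓ t := fun t ht =>
    neg_le_sub_of_abs_derivWithin_lt_one hℓdiff hℓ' ht.1
  -- all characteristics that meet the domain start in `[-L, T + M]`
  have hplus : ∀ t ∈ Icc 0 T, ∀ x ∈ Icc 0 (ℓ t), t + x ∈ Icc (-L) (T + M) := fun t ht x hx =>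
    ⟨by linarith [ht.1, hx.1], by linarith [ht.2, hx.2, hM t ht]⟩
  have hminus : ∀ t ∈ Icc 0 T, ∀ x ∈ Icc 0 (ℓ t), t - x ∈ Icc (-L) (T + M) := fun t ht x hx =>
    ⟨by linarith [hβ t ht, hx.2], by linarith [ht.2, hx.1, hM t ht, hℓpos t ht.1]⟩
  have hend : ∀ t ∈ Icc 0 T, ℓ t ∈ Icc 0 (ℓ t) := fun t ht => ⟨(hℓpos t ht.1).le, le_rfl⟩
  obtain ⟨Φ, Ψ, hΦ1, hΦ2, hΦ3, hΦ4, hΦ5, hΦφ⟩ := exists_diffeomorph_eqOn_Icc hAB hφ hφ'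
  have hΦ : StraighteningPhase ℓ Φ Ψ T := ⟨hΦ1, hΦ2, hΦ3, hΦ4, hΦ5, fun t ht => by
    rw [(hΦφ _ (hplus t ht _ (hend t ht))).1, (hΦφ _ (hminus t ht _ (hend t ht))).1]
    linarith [hMoore t ht.1]⟩
  have hΦL : Φ L = Φ (-L) + 2 := by simpa using hΦ.moore 0 h0T
  have hsub : Icc (-L) L ⊆ Icc (-L) (T + M) := Icc_subset_Icc_right (by linarith)
  -- the reflection coefficient of the moving end
  set r : ℝ := -(1 - η) / (1 + η) with hr
  have h1η : (0 : ℝ) < 1 + η := by linarith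
  have hr0 : r ≠ 0 := div_ne_zero (neg_ne_zero.2 (sub_ne_zero.2 hη1.symm)) h1η.ne'
  have hr1 : r ≠ 1 := by
    rw [hr, Ne, div_eq_one_iff_eq h1η.ne']
    intro h
    linarith
  have hD := memLp_extData hu0.memLp_deriv hu1 hL
  obtain ⟨G, F, hGm, hG2, hF, hFr, hGD⟩ :=
    hΦ.exists_quasiPeriodic_profile hL hΦL (hD.const_mul (1 / 2)) hr0 hr1
  obtain ⟨f, p, hpm, hp, hf, hfF, hpG⟩ := hΦ.exists_wave_profile hGm hG2 hF hAB
  have hfφ : ∀ x ∈ Icc (-L) (T + M), f x = F (φ x) := fun x hx => by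
    rw [hfF x hx, (hΦφ x hx).1]
  have hbc : ∀ t ∈ Icc 0 T, (1 + η) * f (t + ℓ t) + (1 - η) * f (t - ℓ t) = 0 := by
    intro t ht
    rw [hfF _ (hplus t ht _ (hend t ht)), hfF _ (hminus t ht _ (hend t ht)), hΦ.moore t ht, hFr, hr]
    field_simp
    ring
  have hpD : ∀ᵐ x, x ∈ Ioo (-L) L → p x = 1 / 2 * extData u0' u1 x := by
    filter_upwards [hGD] with x hx hxL
    rw [hpG x (hsub (Ioo_subset_Icc_self hxL)), hx hxL]
  have hinit := wave_initial_data hL hu0 hp hf hpD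
  have hFE := hℓ.finiteEnergy_wave hpm hp hf
  have hsol : IsSolutionWP ℓ η T u0 u1 (fun x t => f (t + x) - f (t - x)) :=
    ⟨_, _, hFE.contV0, hFE.contDiffL2, hℓ.weakWaveEq_wave hpm hp hf hbc, hinit.1, hinit.2⟩
  -- the coefficients and the energy in the straightened variable
  have hGD' : ∀ᵐ x, x ∈ uIoc (-L) L → deriv Φ x * G (Φ x) = 1 / 2 * extData u0' u1 x := by
    have hne : ∀ᵐ z : ℝ, z ≠ L := by simp [ae_iff]
    filter_upwards [hGD, hne] with x hx hxne hxL
    rw [uIoc_of_le hLL] at hxL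
    rw [mul_comm, hx ⟨hxL.1, lt_of_le_of_ne hxL.2 hxne⟩]
  have hΦmem : ∀ x ∈ uIoc (-L) L, Φ x = φ x ∧ deriv Φ x = φd x := fun x hx => by
    rw [uIoc_of_le hLL] at hx
    exact hΦφ x (hsub (Ioc_subset_Icc_self hx))
  have hcoeff : ∀ n, coeffC η L φ u0' u1 n = 1 / (2 * omegaN η n) *
      ∫ s in Φ (-L)..Φ (-L) + 2, (G s : ℂ) * Complex.exp (-omegaN η n * s) := by
    intro n
    rw [← hΦL, ← hΦ.integral_deriv_mul_comp
      (fun s => (G s : ℂ) * Complex.exp (-omegaN η n * s)) hLL]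
    have h1 : ∫ x in (-L)..L, deriv Φ x • ((G (Φ x) : ℂ) * Complex.exp (-omegaN η n * Φ x))
        = ∫ x in (-L)..L, (1 / 2 : ℂ) *
          ((extData u0' u1 x : ℂ) * Complex.exp (-omegaN η n * (φ x : ℂ))) := by
      apply intervalIntegral.integral_congr_ae
      filter_upwards [hGD'] with x hx hxL
      rw [Complex.real_smul, ← mul_assoc, ← Complex.ofReal_mul, hx hxL, (hΦmem x hxL).1]
      push_cast
      ring
    rw [h1, intervalIntegral.integral_const_mul, coeffC]
    have := omegaN_ne_zero hη hη1 n
    field_simp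
    ring
  have hFourier := hasSum_quasiPeriodic (a := Φ (-L)) hGm hG2 hF hFr (fun n => omegaN_eq_add η n)
    (fun n => omegaN_ne_zero hη hη1 n) (fun n => exp_two_mul_omegaN hη hη1 n) hcoeff
  have henergy : ∫ s in Φ (-L)..Φ (-L) + 2, G s ^ 2 * Real.exp (-(2 * (omegaN η 0).re * s))
      = 1 / 4 * ∫ x in (-L)..L, extData u0' u1 x ^ 2 * Real.exp (Real.log |gammaEta η| * φ x)
          / φd x := by
    rw [← hΦL, ← hΦ.integral_deriv_mul_comp _ hLL, ← intervalIntegral.integral_const_mul]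
    apply intervalIntegral.integral_congr_ae
    filter_upwards [hGD'] with x hx hxL
    have h1 := hΦ.deriv_pos x
    have h2 : G (Φ x) = 1 / 2 * extData u0' u1 x / deriv Φ x := by
      rw [eq_div_iff h1.ne', mul_comm, hx hxL]
    rw [smul_eq_mul, h2, ← (hΦmem x hxL).2, (hΦmem x hxL).1, omegaN_re,
      show -(2 * (-(1 / 2) * Real.log |gammaEta η|) * φ x) = Real.log |gammaEta η| * φ x by ring]
    field_simp
    ring
  refine ⟨⟨_, hsol, fun v hv t ht => hsol.eqOn hΦ hℓ hη hη1 hv ht, fun t ht x hx => ?_⟩, ?_, ?_⟩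
  · have hs := (hFourier.1 (φ (t + x))).sub (hFourier.1 (φ (t - x)))
    rw [hfφ _ (hplus t ht x hx), hfφ _ (hminus t ht x hx), Complex.ofReal_sub]
    simpa only [mul_sub] using hs
  · have h1 : IntervalIntegrable (fun x => extData u0' u1 x ^ 2) volume (-L) L := by
      rw [intervalIntegrable_iff_integrableOn_Icc_of_le hLL]
      exact hD.integrable_sq
    have h2 : ContinuousOn (fun x => Real.exp (Real.log |gammaEta η| * φ x) / φd x)
        (uIcc (-L) L) := by
      rw [uIcc_of_le hLL]
      have c1 : ContinuousOn φ (Icc (-L) L) := hφ.continuousOn.mono Icc_subset_Ici_self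
      have c2 : ContinuousOn φd (Icc (-L) L) :=
        (hφ.continuousOn_derivWithin (uniqueDiffOn_Ici _) le_rfl).mono Icc_subset_Ici_self
      exact (Real.continuous_exp.comp_continuousOn (continuousOn_const.mul c1)).div c2
        fun x hx => (hφ' x hx.1).ne'
    simpa only [mul_div_assoc] using h1.mul_continuousOn h2
  · have h3 := hFourier.2
    rw [henergy, ← mul_assoc] at h3
    norm_num at h3 ⊢
    exact h3
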